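/- **Theorem.** *Graphs.* A graph $E=(E^0,E^1,r,s)$ is a countable directed graph with range map $r$ and source map $s$; loops and (possibly infinitely many) parallel edges are allowed. A vertex is regular if it emits at least one and only finitely many edges, and singular otherwise. Paths may have length $0$; a cycle is a path of positive length from a vertex to itself; a return path at $v$ is a cycle at $v$ meeting $v$ only at its two ends. Write $u\ge v$ if there is a path from $u$ to $v$. Let $\mathsf A_E(u,v)\in\{0,1,\dots,\infty\}$ be the number of edges from $u$ to $v$, and let $\mathsf B^\bullet_E$ be $\mathsf A_E-I$ with the rows of the singular vertices removed. *Moves.* Move prime equivalence $\sim_{M'}$ is the equivalence relation on graphs generated by isomorphism and the following moves. (S) Remove a regular source $w$ together with the edges it emits. (R) If $w$ is a regular vertex with $s^{-1}(w)=\{f\}$, $r(f)\ne w$ and $s(r^{-1}(w))=\{x\}$, delete $w$ and $f$, and replace each edge $e$ into $w$ by an edge from $x$ to $r(f)$. (O) If $w$ is not a sink and $s^{-1}(w)=\mathcal E_1\sqcup\dots\sqcup\mathcal E_k$ with all $\mathcal E_j$ nonempty and at most one infinite, replace $w$ by $w^1,\dots,w^k$, let the edges in $\mathcal E_j$ start at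 $w^j$, and replace each edge $e$ into $w$ by $e^1,\dots,e^k$, where $e^i$ has range $w^i$ and the (new) source of $e$. (I) If $w$ is regular and not a source and $r^{-1}(w)=\mathcal E_1\sqcup\dots\sqcup\mathcal E_k$ with all $\mathcal E_j$ nonempty, replace $w$ by $w^1,\dots,w^k$, let the edges in $\mathcal E_j$ end at $w^j$, and replace each edge $e$ out of $w$ by $e^1,\dots,e^k$, where $e^i$ has source $w^i$ and the (new) range of $e$. (C) If $v$ is regular and supports at least two return paths, add vertices $u_1,u_2$ and six edges, one each $v\to u_1$, $u_1\to v$, $u_1\to u_1$, $u_1\to u_2$, $u_2\to u_1$, $u_2\to u_2$. *Block matrices.* Fix a partial order $\preceq$ on $\mathcal P=\{1,\dots,N\}$ such that $i\preceq j$ implies $i\le j$. For $\mathbf m,\mathbf n\in\mathbb N_0^N$ let $\mathfrak M_{\mathcal P}(\mathbf m\times\mathbf n,\mathbb Z)$ be the set of integer block matrices $B$ with blocks $B\{i,j\}$ of size $m_i\times n_j$ (possibly empty) such that $B\{i,j\}\ne0$ only if $i\preceq j$; write $B\{i\}=B\{i,i\}$. Let $\mathrm{GL}_{\mathcal P}(\mathbf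 n,\mathbb Z)$ be the set of elements of $\mathfrak M_{\mathcal P}(\mathbf n\times\mathbf n,\mathbb Z)$ with an inverse in that set, and $\mathrm{SL}_{\mathcal P}(\mathbf n,\mathbb Z)$ the set of those $U$ among them with $\det U\{i\}=1$ whenever $n_i\neq0$. A $\mathrm{GL}_{\mathcal P}$-equivalence from $B$ to $B'$ is a pair $U\in\mathrm{GL}_{\mathcal P}(\mathbf m,\mathbb Z)$, $V\in\mathrm{GL}_{\mathcal P}(\mathbf n,\mathbb Z)$ with $UBV=B'$; $B$ and $B'$ are $\mathrm{SL}_{\mathcal P}$-equivalent if such $U,V$ exist in $\mathrm{SL}_{\mathcal P}$. *Standard form.* Let $E$ be a graph with finitely many vertices whose strongly connected components (blocks) are numbered by $\mathcal P$ so that $i\preceq j$ if and only if the $i$-th component reaches the $j$-th by a path. Let $n_i$ be the number of vertices and $m_i$ the number of regular vertices of the $i$-th component, and list the vertices of each component in some order, its regular vertices being listed in the induced order; then $\mathsf B^\bullet_E\in\mathfrak M_{\mathcal P}(\mathbf m\times\mathbf n,\mathbb Z)$. The graph $E$ is in canonical form if: (1) every vertex is either regular and the base of a loop, or singular and such that it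 emits infinitely many edges to each vertex to which it has a path of positive length; (2) if $v\ge w$ with $v,w$ regular, there is a path from $v$ to $w$ through regular vertices only; (3) $m_i\ge3$ whenever the subgraph of $E$ induced on the $i$-th component contains a cycle; (4) if $i\preceq j$, all entries of $\mathsf B^\bullet_E\{i,j\}$ are positive; (5) if $\mathsf B^\bullet_E\{i\}$ is not the empty matrix, its Smith normal form has at least two entries equal to $1$. A pair of graphs is in standard form if both are in canonical form with the same $\mathcal P$, the same $\mathbf m$ and the same $\mathbf n$. *Claim.* Let $(E_1,E_2)$ be a pair of graphs with finitely many vertices in standard form, and let $(U,V)$ be a $\mathrm{GL}_{\mathcal P}$-equivalence from $\mathsf B^\bullet_{E_1}$ to $\mathsf B^\bullet_{E_2}$ such that $V\{i\}=1$ whenever $n_i=1$. Then there are graphs $F_1,F_2$ with finitely many vertices such that $E_1\sim_{M'}F_1$, $E_2\sim_{M'}F_2$, the pair $(F_1,F_2)$ is in standard form (with the same $\mathcal P$, and possibly other $\mathbf m,\mathbf n$), and $\mathsf B^\bullet_{F_1}$ is $\mathrm{SL}_{\mathcal P}$-equivalent to $\mathsf B^\bullet_{F_2}$ (for suitable listings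 of the vertices of $F_1$ and $F_2$ within their blocks). -/

import Mathlib

/-- A countable directed graph: countable sets of vertices and edges, with a range and a source map.
Loops and (possibly infinitely many) parallel edges are allowed. -/
structure DirGraph where
  V : Type
  Edge : Type
  r : Edge → V
  s : Edge → V
  countable_V : Countable V
  countable_Edge : Countable Edge

namespace DirGraph

variable (E : DirGraph)

/-- Graph isomorphism. -/
def Iso (F : DirGraph) : Prop :=
  ∃ (φ₀ : E.V ≃ F.V) (φ₁ : E.Edge ≃ F.Edge),
    (∀ e, F.s (φ₁ e) = φ₀ (E.s e)) ∧ (∀ e, F.r (φ₁ e) = φ₀ (E.r e))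

/-- `E.IsPath u μ v`: the list of edges `μ` is a path from `u` to `v`
(the empty list being the path of length zero at `u`). -/
def IsPath : E.V → List E.Edge → E.V → Prop
  | u, [], v => u = v
  | u, e :: μ, v => E.s e = u ∧ IsPath (E.r e) μ v

/-- `u ≥ v`: there is a path, possibly of length zero, from `u` to `v`. -/
def Reaches (u v : E.V) : Prop := ∃ μ, E.IsPath u μ v

/-- A return path based at `v`: a cycle based at `v` that visits `v` only at its two ends. -/
def IsReturnPath (v : E.V) (μ : List E.Edge) : Prop :=
  μ ≠ [] ∧ E.IsPath v μ v ∧ ∀ e ∈ μ.dropLast, E.r e ≠ v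

/-- A regular vertex emits at least one and only finitely many edges; the other vertices
(sinks and infinite emitters) are singular. -/
def IsRegular (v : E.V) : Prop := {e | E.s e = v}.Finite ∧ {e | E.s e = v}.Nonempty

/-- A source receives no edge. -/
def IsSource (v : E.V) : Prop := ∀ e, E.r e ≠ v

/-- A sink emits no edge. -/
def IsSink (v : E.V) : Prop := ∀ e, E.s e ≠ v

/-- The adjacency matrix, with entries in `{0, 1, 2, …, ∞}`. -/
noncomputable def adj (u v : E.V) : ℕ∞ := {e | E.s e = u ∧ E.r e = v}.encard

open Classical in
/-- The matrix `B•`: the adjacency matrix minus the identity, with the rows of the singular vertices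
removed. The remaining rows have finite entries only. -/
noncomputable def Bdot : Matrix {v : E.V // E.IsRegular v} E.V ℤ :=
  fun u v => ((E.adj u v).toNat : ℤ) - if (u : E.V) = v then 1 else 0

/-! ### The moves -/

/-- Move (S): remove the source `w`, together with the edges it emits. -/
def moveS (w : E.V) (hw : E.IsSource w) : DirGraph where
  V := {v : E.V // v ≠ w}
  Edge := {e : E.Edge // E.s e ≠ w}
  r e := ⟨E.r e, hw e⟩
  s e := ⟨E.s e, e.2⟩
  countable_V := haveI := E.countable_V; inferInstance
  countable_Edge := haveI := E.countable_Edge; inferInstance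

/-- Move (R): reduce at a vertex `w` whose only outgoing edge is `f`, with `r f ≠ w`.
`Sum.inr e` is the new edge `e_f`, for an edge `e` with range `w`. -/
def moveR (w : E.V) (f : E.Edge) (hf : {e | E.s e = w} = {f}) (hr : E.r f ≠ w) : DirGraph where
  V := {v : E.V // v ≠ w}
  Edge := {e : E.Edge // e ≠ f ∧ E.r e ≠ w} ⊕ {e : E.Edge // E.r e = w}
  r := Sum.elim (fun e => ⟨E.r e, e.2.2⟩) (fun _ => ⟨E.r f, hr⟩)
  s := Sum.elim (fun e => ⟨E.s e, fun h => e.2.1 (hf.subset h)⟩)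
    (fun e => ⟨E.s e, fun h => hr ((congrArg E.r (hf.subset h)).symm.trans e.2)⟩)
  countable_V := haveI := E.countable_V; inferInstance
  countable_Edge := haveI := E.countable_Edge; inferInstance

open Classical in
/-- Move (O): outsplit at `w`. The partition of `s⁻¹(w)` into `k` nonempty sets is given by the
surjection `c` sending an edge to the number of its set (surjectivity is required in `Move`).
The vertex `w` is replaced by `w^1, …, w^k`, which are the elements `Sum.inr i`, and each edge `e`
with range `w` is replaced by `e^1, …, e^k`. -/
noncomputable def moveO (w : E.V) (k : ℕ) (c : {e : E.Edge // E.s e = w} → Fin k) : DirGraph where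
  V := {v : E.V // v ≠ w} ⊕ Fin k
  Edge := {e : E.Edge // E.r e ≠ w} ⊕ ({e : E.Edge // E.r e = w} × Fin k)
  r := Sum.elim (fun e => Sum.inl ⟨E.r e, e.2⟩) (fun p => Sum.inr p.2)
  s x :=
    let e : E.Edge := Sum.elim (fun e => e.1) (fun p => p.1.1) x
    if h : E.s e = w then Sum.inr (c ⟨e, h⟩) else Sum.inl ⟨E.s e, h⟩
  countable_V := haveI := E.countable_V; inferInstance
  countable_Edge := haveI := E.countable_Edge; inferInstance

open Classical in
/-- Move (I): insplit at `w`. The partition of `r⁻¹(w)` into `k` nonempty sets is given by the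
surjection `c` (surjectivity is required in `Move`). -/
noncomputable def moveI (w : E.V) (k : ℕ) (c : {e : E.Edge // E.r e = w} → Fin k) : DirGraph where
  V := {v : E.V // v ≠ w} ⊕ Fin k
  Edge := {e : E.Edge // E.s e ≠ w} ⊕ ({e : E.Edge // E.s e = w} × Fin k)
  r x :=
    let e : E.Edge := Sum.elim (fun e => e.1) (fun p => p.1.1) x
    if h : E.r e = w then Sum.inr (c ⟨e, h⟩) else Sum.inl ⟨E.r e, h⟩
  s := Sum.elim (fun e => Sum.inl ⟨E.s e, e.2⟩) (fun p => Sum.inr p.2)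
  countable_V := haveI := E.countable_V; inferInstance
  countable_Edge := haveI := E.countable_Edge; inferInstance

/-- Move (C): Cuntz splice at `v`. The new vertices `u₁, u₂` are `Sum.inr 0, Sum.inr 1`; the three
copies of `Fin 2` in the edge set are `{e₁, e₂}`, `{f₁, f₂}` and `{h₁, h₂}`, with
`e₁ : v → u₁`, `e₂ : u₁ → v`, `fᵢ : u₁ → uᵢ`, `hᵢ : u₂ → uᵢ`. -/
def moveC (v : E.V) : DirGraph where
  V := E.V ⊕ Fin 2
  Edge := E.Edge ⊕ (Fin 2 ⊕ (Fin 2 ⊕ Fin 2))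
  r := Sum.elim (fun e => Sum.inl (E.r e))
    (Sum.elim ![Sum.inr 0, Sum.inl v] (Sum.elim (fun i => Sum.inr i) (fun i => Sum.inr i)))
  s := Sum.elim (fun e => Sum.inl (E.s e))
    (Sum.elim ![Sum.inl v, Sum.inr 0] (Sum.elim (fun _ => Sum.inr 0) (fun _ => Sum.inr 1)))
  countable_V := haveI := E.countable_V; inferInstance
  countable_Edge := haveI := E.countable_Edge; inferInstance

/-- `Move E F`: the graph `F` is isomorphic to `E`, or is formed by performing one of the moves
(S), (R), (O), (I), (C) to `E`. -/
inductive Move : DirGraph → DirGraph → Prop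
  | iso (E F : DirGraph) : E.Iso F → Move E F
  | S (E : DirGraph) (w : E.V) (hw : E.IsSource w) : E.IsRegular w → Move E (E.moveS w hw)
  | R (E : DirGraph) (w x : E.V) (f : E.Edge) (hf : {e | E.s e = w} = {f}) (hr : E.r f ≠ w) :
      E.IsRegular w → E.s '' {e | E.r e = w} = {x} → Move E (E.moveR w f hf hr)
  | O (E : DirGraph) (w : E.V) (k : ℕ) (c : {e : E.Edge // E.s e = w} → Fin k) :
      ¬ E.IsSink w → Function.Surjective c →
      (∀ i j, {e | c e = i}.Infinite → {e | c e = j}.Infinite → i = j) → Move E (E.moveO w k c)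
  | I (E : DirGraph) (w : E.V) (k : ℕ) (c : {e : E.Edge // E.r e = w} → Fin k) :
      E.IsRegular w → ¬ E.IsSource w → Function.Surjective c → Move E (E.moveI w k c)
  | C (E : DirGraph) (v : E.V) :
      E.IsRegular v → (∃ μ ν, μ ≠ ν ∧ E.IsReturnPath v μ ∧ E.IsReturnPath v ν) →
      Move E (E.moveC v)

/-- Move prime equivalence: the equivalence relation generated by the moves
(O), (I), (R), (S), (C) together with graph isomorphism. -/
def MovePrimeEquiv : DirGraph → DirGraph → Prop := Relation.EqvGen Move

end DirGraph

/-! ### Block matrices -/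

/-- A partial order `≼` on `{1, …, N}` (here `Fin N`) such that `i ≼ j` implies `i ≤ j`. -/
structure BlockOrder (N : ℕ) where
  rel : Fin N → Fin N → Prop
  refl : ∀ i, rel i i
  antisymm : ∀ i j, rel i j → rel j i → i = j
  trans : ∀ i j k, rel i j → rel j k → rel i k
  le_of_rel : ∀ i j, rel i j → i ≤ j

/-- Integer block matrices with row blocks of sizes `m 0, m 1, …` and column blocks of sizes
`n 0, n 1, …`; blocks may be empty. -/
abbrev BlockMatrix {N : ℕ} (m n : Fin N → ℕ) : Type :=
  Matrix (Σ i, Fin (m i)) (Σ i, Fin (n i)) ℤ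

/-- The block `B{i,j}`. -/
def blk {N : ℕ} {m n : Fin N → ℕ} (B : BlockMatrix m n) (i j : Fin N) :
    Matrix (Fin (m i)) (Fin (n j)) ℤ :=
  fun a b => B ⟨i, a⟩ ⟨j, b⟩

/-- The block matrices `B` with `B{i,j} ≠ 0` only if `i ≼ j`. -/
def MP {N : ℕ} (P : BlockOrder N) (m n : Fin N → ℕ) : Set (BlockMatrix m n) :=
  {B | ∀ i j, blk B i j ≠ 0 → P.rel i j}

/-- The automorphisms of `n` in the category with morphisms `MP P`. -/
def GLP {N : ℕ} (P : BlockOrder N) (n : Fin N → ℕ) : Set (BlockMatrix n n) :=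
  {U | U ∈ MP P n n ∧ ∃ W ∈ MP P n n, U * W = 1 ∧ W * U = 1}

/-- The elements of `GLP P n` all of whose nonempty diagonal blocks have determinant one. -/
def SLP {N : ℕ} (P : BlockOrder N) (n : Fin N → ℕ) : Set (BlockMatrix n n) :=
  {U | U ∈ GLP P n ∧ ∀ i, n i ≠ 0 → (blk U i i).det = 1}

/-- `(U, V)` is a `GL_P`-equivalence from `B` to `B'`. -/
def IsGLPEquiv {N : ℕ} (P : BlockOrder N) {m n : Fin N → ℕ} (U : BlockMatrix m m)
    (V : BlockMatrix n n) (B B' : BlockMatrix m n) : Prop :=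
  U ∈ GLP P m ∧ V ∈ GLP P n ∧ U * B * V = B'

/-- `B` and `B'` are `SL_P`-equivalent. -/
def SLPEquivalent {N : ℕ} (P : BlockOrder N) {m n : Fin N → ℕ} (B B' : BlockMatrix m n) : Prop :=
  B ∈ MP P m n ∧ B' ∈ MP P m n ∧ ∃ U ∈ SLP P m, ∃ V ∈ SLP P n, U * B * V = B'

/-- A rectangular integer matrix in Smith normal form: diagonal, with nonnegative diagonal entries
each of which divides the next ones (so that the zeros come last). -/
structure IsSmithNormalForm {p q : ℕ} (D : Matrix (Fin p) (Fin q) ℤ) : Prop where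
  offDiag : ∀ (a : Fin p) (b : Fin q), (a : ℕ) ≠ (b : ℕ) → D a b = 0
  nonneg : ∀ (a : Fin p) (b : Fin q), (a : ℕ) = (b : ℕ) → 0 ≤ D a b
  dvd : ∀ (a a' : Fin p) (b b' : Fin q), (a : ℕ) = (b : ℕ) → (a' : ℕ) = (b' : ℕ) → a ≤ a' →
    D a b ∣ D a' b'

/-- The Smith normal form of `B` has at least two entries equal to `1`. -/
def SmithHasTwoOnes {p q : ℕ} (B : Matrix (Fin p) (Fin q) ℤ) : Prop :=
  ∃ (U : GL (Fin p) ℤ) (V : GL (Fin q) ℤ) (D : Matrix (Fin p) (Fin q) ℤ),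
    (U : Matrix (Fin p) (Fin p) ℤ) * B * (V : Matrix (Fin q) (Fin q) ℤ) = D ∧
    IsSmithNormalForm D ∧ 2 ≤ {x : Fin p × Fin q | D x.1 x.2 = 1}.ncard

/-! ### Block structure of a graph, canonical and standard form -/

/-- The block structure of a graph `E` with finitely many vertices, in which the `i`-th block has
`n i` vertices, `m i` of them regular.
The blocks are the strongly connected components of `E`, numbered by `P` in such a way that `i ≼ j`
if and only if the `i`-th component reaches the `j`-th. The vertices of each block are
listed in some order; `row i` lists the regular ones among them in the same order (so it is
determined by `vertex`), as happens when the rows of singular vertices are deleted from a matrix.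

For the graphs in canonical form all hereditary vertex sets are saturated, there are no breaking
vertices and Condition (K) holds, so that the ideals of the graph algebra correspond to the
hereditary vertex sets and `P` is its primitive ideal space with the specialization order:
the point `i` corresponds to the hereditary set `H1 i` generated by the `i`-th component. -/
structure BlockForm {N : ℕ} (P : BlockOrder N) (m n : Fin N → ℕ) (E : DirGraph) where
  vertex : (Σ i, Fin (n i)) ≃ E.V
  pos : ∀ i, 0 < n i
  reaches_iff : ∀ x y, E.Reaches (vertex x) (vertex y) ↔ P.rel x.1 y.1
  row : ∀ i, Fin (m i) ↪o Fin (n i)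
  mem_range_row : ∀ i a, a ∈ Set.range (row i) ↔ E.IsRegular (vertex ⟨i, a⟩)

namespace BlockForm

variable {N : ℕ} {P : BlockOrder N} {m n : Fin N → ℕ} {E : DirGraph}

/-- The block of a vertex. -/
def block (β : BlockForm P m n E) (v : E.V) : Fin N := (β.vertex.symm v).1

/-- The hereditary vertex set generated by the `i`-th block. -/
def H1 (β : BlockForm P m n E) (i : Fin N) : Set E.V := {v | P.rel i (β.block v)}

/-- The largest hereditary set properly contained in `H1 i`. -/
def H0 (β : BlockForm P m n E) (i : Fin N) : Set E.V :=
  {v | P.rel i (β.block v) ∧ β.block v ≠ i}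

/-- The matrix `B•` of `E` as a block matrix. -/
noncomputable def B (β : BlockForm P m n E) : BlockMatrix m n :=
  fun x y => E.Bdot ⟨β.vertex ⟨x.1, β.row x.1 x.2⟩,
    (β.mem_range_row x.1 (β.row x.1 x.2)).1 ⟨x.2, rfl⟩⟩ (β.vertex y)

/-- The graph with vertex set `H1 i \ H0 i` and edge set `r⁻¹(H1 i \ H0 i) ∩ s⁻¹(H1 i)`
contains a cycle. -/
def HasCycle (β : BlockForm P m n E) (i : Fin N) : Prop :=
  ∃ v ∈ β.H1 i \ β.H0 i, ∃ μ, μ ≠ [] ∧ E.IsPath v μ v ∧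
    ∀ e ∈ μ, E.r e ∈ β.H1 i \ β.H0 i ∧ E.s e ∈ β.H1 i

/-- Canonical form. -/
structure IsCanonical (β : BlockForm P m n E) : Prop where
  /-- Every vertex is either regular and the base of a loop, or singular and emitting infinitely
  many edges to each vertex it reaches by a path of positive length. -/
  loops_inf : ∀ v : E.V, (E.IsRegular v ∧ ∃ e, E.s e = v ∧ E.r e = v) ∨
    (¬ E.IsRegular v ∧ ∀ w, (∃ μ, μ ≠ [] ∧ E.IsPath v μ w) → E.adj v w = ⊤)
  /-- A regular vertex that reaches a regular vertex does so through regular vertices. -/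
  paths : ∀ v w : E.V, E.IsRegular v → E.IsRegular w → E.Reaches v w →
    ∃ μ, E.IsPath v μ w ∧ ∀ e ∈ μ, E.IsRegular (E.s e) ∧ E.IsRegular (E.r e)
  size_three : ∀ i, β.HasCycle i → 3 ≤ m i
  positive : ∀ i j, P.rel i j → ∀ a b, 0 < blk β.B i j a b
  smith : ∀ i, m i ≠ 0 → n i ≠ 0 → SmithHasTwoOnes (blk β.B i i)

/-- A pair of graphs in standard form: both are in canonical form, with the same ordered set of
blocks `P` and the same block sizes `m` and `n`. -/
def IsStandardForm {E₁ E₂ : DirGraph} (β₁ : BlockForm P m n E₁) (β₂ : BlockForm P m n E₂) : Prop :=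
  β₁.IsCanonical ∧ β₂.IsCanonical

end BlockForm

namespace DirGraph

/-! ### Graphs given by adjacency matrices -/

/-! The diagonal blocks of `U` and `V` are invertible over the integers, so their determinants are
signs `δ i` and `δ' i`. These signs are corrected one block at a time by enlarging the `i`-th block
of both graphs by two regular vertices.

Suppose that moves turn the two matrices, up to SL-equivalence, into `B₁ ⊕ (-δδ') ⊕ (-1)` and `B₂ ⊕
(-1) ⊕ (-1)`, with the new summands in block `i`. Then `U ⊕ δ ⊕ 1` and `V ⊕ δ' ⊕ 1` carry the first
to the second, because `δ · (-δδ') · δ' = -1`. Their determinants in block `i` are `δ² = δ'² = 1`,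
and the other blocks are untouched (`BlockEquiv.sum_one`, `exists_blockEquiv_one`). A block without
regular vertices cannot be enlarged in this way, but it needs no correction: it is a single vertex
on no cycle, so the block of `U` is empty and that of `V` is `1` by hypothesis.

Two constructions supply the summands. An outsplit giving a new vertex one of the loops at `w` turns
`B` into `B ⊕ (-1)` (`Canon.exists_enlarge`). A Cuntz splice turns `B` into `B ⊕ 1 ⊕ (-1)`, its two
new vertices contributing a swap matrix of determinant `-1` (`Canon.exists_splice`). Hence two
outsplits serve for `δδ' = 1` and one splice for `δδ' = -1`.

The raw outcomes are not canonical, since the new vertices have too few edges. This is repaired by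
adding one row or column of `A - 1` to another, which is a transvection on the matrix `B•` and is
realised by moves (`addRow_equiv`, `addCol_equiv`): split off a single edge `u → v`, then collapse
the vertex so created.

Everything is computed on adjacency matrices, which determine countable graphs up to isomorphism
(`Iso.of_adj`). `canon_of_graph` and `Canon.isCanonical` translate canonical form into conditions on
such a matrix and back. -/

theorem nonempty_equiv_of_encard_eq {α β : Type} {s : Set α} {t : Set β} [Countable α] [Countable β]
    (h : s.encard = t.encard) : Nonempty (s ≃ t) := by
  have h1 : Cardinal.mk s ≤ Cardinal.aleph0 := Cardinal.mk_le_aleph0_iff.2 inferInstance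
  have h2 : Cardinal.mk t ≤ Cardinal.aleph0 := Cardinal.mk_le_aleph0_iff.2 inferInstance
  exact Cardinal.eq.1 (Cardinal.toENat_strictMonoOn.injOn h1 h2 h)

/-- Countability of the edge sets is essential: entries of `adj` do not distinguish infinite
cardinals, but between countable sets equal `encard` gives a bijection. The bijections for the pairs
of endpoints are glued over the fibers of the endpoint map. -/
theorem Iso.of_adj {E F : DirGraph} (φ : E.V ≃ F.V)
    (h : ∀ u v, F.adj (φ u) (φ v) = E.adj u v) : E.Iso F := by
  have := E.countable_Edge
  have := F.countable_Edge
  have key : ∀ p : E.V × E.V, Nonempty ({e : E.Edge // (E.s e, E.r e) = p} ≃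
      {e : F.Edge // (F.s e, F.r e) = (φ.prodCongr φ) p}) := by
    rintro ⟨u, v⟩
    obtain ⟨g⟩ := nonempty_equiv_of_encard_eq (h u v).symm
    refine ⟨(Equiv.subtypeEquivRight ?_).trans (g.trans (Equiv.subtypeEquivRight ?_))⟩
    · intro e; simp
    · intro e; simp
  let g := fun p => (key p).some
  let ψ : E.Edge ≃ F.Edge := (Equiv.sigmaFiberEquiv fun e => (E.s e, E.r e)).symm.trans
    ((Equiv.sigmaCongr (φ.prodCongr φ) g).trans (Equiv.sigmaFiberEquiv fun e => (F.s e, F.r e)))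
  have hψ : ∀ e, (F.s (ψ e), F.r (ψ e)) = (φ (E.s e), φ (E.r e)) := fun e =>
    (g (E.s e, E.r e) ⟨e, rfl⟩).2
  exact ⟨φ, ψ, fun e => congrArg Prod.fst (hψ e), fun e => congrArg Prod.snd (hψ e)⟩

/-- Parallel edges will be numbered by naturals below the matrix entry. After the first `a'` of `a`
edges are removed, the truncated difference counts the rest, including the cases where an entry is
infinite. -/
theorem encard_nat_interval (a a' : ℕ∞) :
    {k : ℕ | a' ≤ (k : ℕ∞) ∧ (k : ℕ∞) < a}.encard = a - a' := by
  induction a' using ENat.recTopCoe with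
  | top => simp
  | coe n =>
    induction a using ENat.recTopCoe with
    | top =>
      have : {k : ℕ | (n : ℕ∞) ≤ (k : ℕ∞) ∧ (k : ℕ∞) < ⊤} = Set.Ici n := by
        ext k; simp
      rw [this]
      simp [(Set.Ici_infinite n).encard_eq]
    | coe m =>
      have : {k : ℕ | (n : ℕ∞) ≤ (k : ℕ∞) ∧ (k : ℕ∞) < m} = ((Finset.Ico n m : Finset ℕ) : Set ℕ) := by
        ext k; simp
      rw [this, Set.encard_coe_eq_coe_finsetCard]
      simp

theorem encard_nat_lt (a : ℕ∞) : {k : ℕ | (k : ℕ∞) < a}.encard = a := by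
  simpa using encard_nat_interval a 0

/-- The graph with vertex set `V` and adjacency matrix `A`. -/
@[reducible] def ofAdj (V : Type) [Countable V] (A : V → V → ℕ∞) : DirGraph where
  V := V
  Edge := {x : V × V × ℕ // (x.2.2 : ℕ∞) < A x.1 x.2.1}
  s e := e.1.1
  r e := e.1.2.1
  countable_V := inferInstance
  countable_Edge := inferInstance

section ofAdj

variable {V : Type} [Countable V] (A : V → V → ℕ∞)

/-- The number of edges from `u` to `v` whose index satisfies a given condition. -/
theorem encard_ofAdj (u v : V) (p : (ofAdj V A).Edge → Prop) :
    {e : (ofAdj V A).Edge | (ofAdj V A).s e = u ∧ (ofAdj V A).r e = v ∧ p e}.encard =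
      {k : ℕ | ∃ h : (k : ℕ∞) < A u v, p ⟨(u, v, k), h⟩}.encard := by
  have hinj : Function.Injective (fun e : (ofAdj V A).Edge => e.1) := Subtype.val_injective
  have hinj' : Function.Injective (fun k : ℕ => (u, v, k)) := fun a b h => by simpa using h
  rw [← hinj.encard_image, ← hinj'.encard_image]
  congr 1
  ext ⟨a, b, k⟩
  constructor
  · rintro ⟨e, ⟨h1, h2, h3⟩, h4⟩
    obtain ⟨⟨a', b', k'⟩, h⟩ := e
    obtain ⟨rfl, rfl, rfl⟩ : a' = a ∧ b' = b ∧ k' = k := by simpa using h4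
    change a' = u at h1
    change b' = v at h2
    subst h1 h2
    exact ⟨k', ⟨h, h3⟩, rfl⟩
  · rintro ⟨k', ⟨h, h3⟩, h4⟩
    obtain ⟨rfl, rfl, rfl⟩ : u = a ∧ v = b ∧ k' = k := by simpa using h4
    exact ⟨⟨(u, v, k'), h⟩, ⟨rfl, rfl, h3⟩, rfl⟩

@[simp] theorem adj_ofAdj (u v : V) : (ofAdj V A).adj u v = A u v := by
  have := encard_ofAdj A u v (fun _ => True)
  simp only [and_true, exists_prop] at this
  exact this.trans (encard_nat_lt _)

theorem exists_edge_ofAdj {u v : V} (h : A u v ≠ 0) :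
    ∃ e, (ofAdj V A).s e = u ∧ (ofAdj V A).r e = v :=
  ⟨⟨(u, v, 0), by simpa using pos_iff_ne_zero.2 h⟩, rfl, rfl⟩

theorem adj_ne_zero (e : (ofAdj V A).Edge) :
    A ((ofAdj V A).s e) ((ofAdj V A).r e) ≠ 0 := fun h => by
  have := e.2
  change A e.1.1 e.1.2.1 = 0 at h
  simp [h] at this

theorem finite_emitted_ofAdj [Finite V] {u : V} (h : ∀ v, A u v ≠ ⊤) :
    {e | (ofAdj V A).s e = u}.Finite := by
  have : {e | (ofAdj V A).s e = u} = ⋃ v, {e | (ofAdj V A).s e = u ∧ (ofAdj V A).r e = v} := by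
    ext e; simp
  rw [this]
  refine Set.finite_iUnion fun v => ?_
  rw [← Set.encard_ne_top_iff]
  exact (adj_ofAdj A u v).trans_ne (h v)

theorem isRegular_ofAdj [Finite V] {u : V} (h : ∀ v, A u v ≠ ⊤) {v : V} (h' : A u v ≠ 0) :
    (ofAdj V A).IsRegular u :=
  ⟨finite_emitted_ofAdj A h, (exists_edge_ofAdj A h').imp fun _ h => h.1⟩

theorem ofAdj_equiv {W : Type} [Countable W] (φ : V ≃ W) (A' : W → W → ℕ∞)
    (h : ∀ u v, A' (φ u) (φ v) = A u v) : MovePrimeEquiv (ofAdj V A) (ofAdj W A') :=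
  .rel _ _ (.iso _ _ (Iso.of_adj (E := ofAdj V A) (F := ofAdj W A') φ fun u v => by
    rw [adj_ofAdj, adj_ofAdj]; exact h u v))

theorem equiv_ofAdj {E : DirGraph} (φ : E.V ≃ V) (h : ∀ u v, A (φ u) (φ v) = E.adj u v) :
    MovePrimeEquiv E (ofAdj V A) :=
  .rel _ _ (.iso _ _ (Iso.of_adj (F := ofAdj V A) φ fun u v => by
    rw [adj_ofAdj]; exact h u v))

end ofAdj

/-! ### Adjacency matrices of the graphs formed by the moves -/

section moves

variable (E : DirGraph)

/-- The vertex of `E` from which a vertex of a split graph comes. -/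
def splitBase {E : DirGraph} (w : E.V) {k : ℕ} : {v : E.V // v ≠ w} ⊕ Fin k → E.V :=
  Sum.elim (fun v => v.1) (fun _ => w)

-- The copies of an edge into `w` differ only in their range, so once the two endpoints are fixed,
-- sending an edge of the split graph to the original edge is injective.
open Classical in
theorem adj_moveO (w : E.V) (k : ℕ) (c : {e : E.Edge // E.s e = w} → Fin k)
    (a b : (E.moveO w k c).V) :
    (E.moveO w k c).adj a b = {e | (if h : E.s e = w then Sum.inr (c ⟨e, h⟩)
      else Sum.inl ⟨E.s e, h⟩ : {v : E.V // v ≠ w} ⊕ Fin k) = a ∧ E.r e = splitBase w b}.encard := by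
  let π : (E.moveO w k c).Edge → E.Edge := Sum.elim (fun e => e.1) (fun p => p.1.1)
  have hinj : Set.InjOn π {e | (E.moveO w k c).s e = a ∧ (E.moveO w k c).r e = b} := by
    rintro x ⟨-, hx⟩ y ⟨-, hy⟩ h
    rcases x with x | ⟨x, i⟩ <;> rcases y with y | ⟨y, j⟩
    · exact congrArg Sum.inl (Subtype.ext h)
    · exact absurd ((congrArg E.r h).trans y.2) x.2
    · exact absurd ((congrArg E.r h).symm.trans x.2) y.2
    · have h1 : (Sum.inr i : {v : E.V // v ≠ w} ⊕ Fin k) = Sum.inr j := hx.trans hy.symm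
      obtain rfl := Sum.inr_injective h1
      have h2 : x = y := Subtype.ext h
      rw [h2]
  refine hinj.encard_image.symm.trans ?_
  congr 1
  ext e
  constructor
  · rintro ⟨x, ⟨h1, h2⟩, rfl⟩
    refine ⟨h1, ?_⟩
    rw [← h2]
    rcases x with x | ⟨x, i⟩
    · rfl
    · exact x.2
  · rintro ⟨h1, h2⟩
    rcases b with b | j
    · exact ⟨Sum.inl ⟨e, fun h => b.2 (h2.symm.trans h)⟩, ⟨h1, congrArg Sum.inl (Subtype.ext h2)⟩, rfl⟩
    · exact ⟨Sum.inr (⟨e, h2⟩, j), ⟨h1, rfl⟩, rfl⟩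

open Classical in
theorem adj_moveI (w : E.V) (k : ℕ) (c : {e : E.Edge // E.r e = w} → Fin k)
    (a b : (E.moveI w k c).V) :
    (E.moveI w k c).adj a b = {e | E.s e = splitBase w a ∧ (if h : E.r e = w then Sum.inr (c ⟨e, h⟩)
      else Sum.inl ⟨E.r e, h⟩ : {v : E.V // v ≠ w} ⊕ Fin k) = b}.encard := by
  let π : (E.moveI w k c).Edge → E.Edge := Sum.elim (fun e => e.1) (fun p => p.1.1)
  have hinj : Set.InjOn π {e | (E.moveI w k c).s e = a ∧ (E.moveI w k c).r e = b} := by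
    rintro x ⟨hx, -⟩ y ⟨hy, -⟩ h
    rcases x with x | ⟨x, i⟩ <;> rcases y with y | ⟨y, j⟩
    · exact congrArg Sum.inl (Subtype.ext h)
    · exact absurd ((congrArg E.s h).trans y.2) x.2
    · exact absurd ((congrArg E.s h).symm.trans x.2) y.2
    · have h1 : (Sum.inr i : {v : E.V // v ≠ w} ⊕ Fin k) = Sum.inr j := hx.trans hy.symm
      obtain rfl := Sum.inr_injective h1
      have h2 : x = y := Subtype.ext h
      rw [h2]
  refine hinj.encard_image.symm.trans ?_
  congr 1
  ext e
  constructor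
  · rintro ⟨x, ⟨h1, h2⟩, rfl⟩
    refine ⟨?_, h2⟩
    rw [← h1]
    rcases x with x | ⟨x, i⟩
    · rfl
    · exact x.2
  · rintro ⟨h1, h2⟩
    rcases a with b | j
    · exact ⟨Sum.inl ⟨e, fun h => b.2 (h1.symm.trans h)⟩, ⟨congrArg Sum.inl (Subtype.ext h1), h2⟩, rfl⟩
    · exact ⟨Sum.inr (⟨e, h1⟩, j), ⟨rfl, h2⟩, rfl⟩

open Classical in
theorem adj_moveR (w : E.V) (f : E.Edge) (hf : {e | E.s e = w} = {f}) (hr : E.r f ≠ w)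
    (a b : (E.moveR w f hf hr).V) :
    (E.moveR w f hf hr).adj a b =
      E.adj a.1 b.1 + if E.r f = b.1 then E.adj a.1 w else 0 := by
  have hsplit : {e | (E.moveR w f hf hr).s e = a ∧ (E.moveR w f hf hr).r e = b} =
      Sum.inl '' {e : {e : E.Edge // e ≠ f ∧ E.r e ≠ w} | E.s e = a.1 ∧ E.r e = b.1} ∪
      Sum.inr '' {e : {e : E.Edge // E.r e = w} | E.s e = a.1 ∧ E.r f = b.1} := by
    ext x
    rcases x with x | x
    · refine (Subtype.ext_iff.and Subtype.ext_iff).trans ⟨fun h => Or.inl ⟨x, h, rfl⟩, ?_⟩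
      rintro (⟨y, h, hy⟩ | ⟨y, h, hy⟩)
      · cases hy; exact h
      · cases hy
    · refine (Subtype.ext_iff.and Subtype.ext_iff).trans ⟨fun h => Or.inr ⟨x, h, rfl⟩, ?_⟩
      rintro (⟨y, h, hy⟩ | ⟨y, h, hy⟩)
      · cases hy
      · cases hy; exact h
  have hfs : E.s f = w := hf.superset rfl
  refine (congrArg Set.encard hsplit).trans ?_
  refine (Set.encard_union_eq ?_).trans (congrArg₂ (· + ·)
    ((Sum.inl_injective.encard_image _).trans ?_) ((Sum.inr_injective.encard_image _).trans ?_))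
  · refine Set.disjoint_left.2 ?_
    rintro _ ⟨x, -, rfl⟩ ⟨y, -, h⟩
    cases h
  · refine (Subtype.val_injective.encard_image _).symm.trans (congrArg Set.encard ?_)
    ext e
    constructor
    · rintro ⟨e, h, rfl⟩; exact h
    · rintro ⟨h1, h2⟩
      exact ⟨⟨e, fun h => a.2 (by rw [← h1, h, hfs]), fun h => b.2 (h2.symm.trans h)⟩, ⟨h1, h2⟩, rfl⟩
  · split_ifs with h
    · refine (Subtype.val_injective.encard_image _).symm.trans (congrArg Set.encard ?_)
      ext e
      constructor
      · rintro ⟨e, h, rfl⟩; exact ⟨h.1, e.2⟩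
      · rintro ⟨h1, h2⟩
        exact ⟨⟨e, h2⟩, ⟨h1, h⟩, rfl⟩
    · rw [Set.encard_eq_zero, Set.eq_empty_iff_forall_notMem]
      exact fun e he => h he.2

theorem adj_moveC_old (v x y : E.V) : (E.moveC v).adj (Sum.inl x) (Sum.inl y) = E.adj x y := by
  refine (congrArg Set.encard ?_).trans (Sum.inl_injective.encard_image _)
  ext e
  constructor
  · rintro ⟨h1, h2⟩
    rcases e with e | (i | (i | i))
    · exact ⟨e, ⟨Sum.inl_injective h1, Sum.inl_injective h2⟩, rfl⟩
    · fin_cases i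
      · cases h2
      · cases h1
    · cases h1
    · cases h1
  · rintro ⟨e, ⟨h1, h2⟩, rfl⟩
    exact ⟨congrArg Sum.inl h1, congrArg Sum.inl h2⟩

open Classical in
theorem adj_moveC_to (v x : E.V) (j : Fin 2) :
    (E.moveC v).adj (Sum.inl x) (Sum.inr j) = if x = v ∧ j = 0 then 1 else 0 := by
  have hset : ∀ e, (E.moveC v).s e = Sum.inl x ∧ (E.moveC v).r e = Sum.inr j →
      e = Sum.inr (Sum.inl 0) ∧ x = v ∧ j = 0 := by
    rintro e ⟨h1, h2⟩
    rcases e with e | (i | (i | i))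
    · cases h2
    · fin_cases i
      · exact ⟨rfl, (Sum.inl_injective h1).symm, (Sum.inr_injective h2).symm⟩
      · cases h2
    · cases h1
    · cases h1
  split_ifs with h
  · refine Set.encard_eq_one.2 ⟨Sum.inr (Sum.inl 0), ?_⟩
    obtain ⟨rfl, rfl⟩ := h
    exact Set.Subset.antisymm (fun e he => (hset e he).1) (by rintro _ rfl; exact ⟨rfl, rfl⟩)
  · refine Set.encard_eq_zero.2 (Set.eq_empty_iff_forall_notMem.2 fun e he => h (hset e he).2)

open Classical in
theorem adj_moveC_from (v x : E.V) (j : Fin 2) :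
    (E.moveC v).adj (Sum.inr j) (Sum.inl x) = if x = v ∧ j = 0 then 1 else 0 := by
  have hset : ∀ e, (E.moveC v).s e = Sum.inr j ∧ (E.moveC v).r e = Sum.inl x →
      e = Sum.inr (Sum.inl 1) ∧ x = v ∧ j = 0 := by
    rintro e ⟨h1, h2⟩
    rcases e with e | (i | (i | i))
    · cases h1
    · fin_cases i
      · cases h1
      · exact ⟨rfl, (Sum.inl_injective h2).symm, (Sum.inr_injective h1).symm⟩
    · cases h2
    · cases h2
  split_ifs with h
  · refine Set.encard_eq_one.2 ⟨Sum.inr (Sum.inl 1), ?_⟩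
    obtain ⟨rfl, rfl⟩ := h
    exact Set.Subset.antisymm (fun e he => (hset e he).1) (by rintro _ rfl; exact ⟨rfl, rfl⟩)
  · refine Set.encard_eq_zero.2 (Set.eq_empty_iff_forall_notMem.2 fun e he => h (hset e he).2)

theorem adj_moveC_new (v : E.V) (i j : Fin 2) :
    (E.moveC v).adj (Sum.inr i) (Sum.inr j) = 1 := by
  refine Set.encard_eq_one.2 ⟨Sum.inr (Sum.inr (if i = 0 then Sum.inl j else Sum.inr j)), ?_⟩
  refine Set.Subset.antisymm ?_ ?_
  · rintro e ⟨h1, h2⟩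
    rcases e with e | (k | (k | k))
    · cases h1
    · fin_cases k
      · cases h1
      · cases h2
    · obtain rfl := Sum.inr_injective h1
      obtain rfl := Sum.inr_injective h2
      rfl
    · obtain rfl := Sum.inr_injective h1
      obtain rfl := Sum.inr_injective h2
      rfl
  · rintro _ rfl
    fin_cases i
    · exact ⟨rfl, rfl⟩
    · exact ⟨rfl, rfl⟩

end moves

end DirGraph

namespace DirGraph

/-! ### Moves on adjacency matrices -/

/-- The matrix `A` with one more column `c`, one more row `d`, and the corner entry `z`. -/
def bordered {V : Type} (A : V → V → ℕ∞) (c d : V → ℕ∞) (z : ℕ∞) : V ⊕ Unit → V ⊕ Unit → ℕ∞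
  | Sum.inl x, Sum.inl y => A x y
  | Sum.inl x, Sum.inr _ => c x
  | Sum.inr _, Sum.inl y => d y
  | Sum.inr _, Sum.inr _ => z

open Classical in
/-- The second part of a vertex that is split in two keeps its name, the first part is new. -/
noncomputable def splitEquiv {V : Type} (w : V) : {v : V // v ≠ w} ⊕ Fin 2 ≃ V ⊕ Unit where
  toFun := Sum.elim (fun v => Sum.inl v.1) ![Sum.inr (), Sum.inl w]
  invFun := Sum.elim (fun v => if h : v = w then Sum.inr 1 else Sum.inl ⟨v, h⟩) (fun _ => Sum.inr 0)
  left_inv := by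
    rintro (v | i)
    · simp [v.2]
    · fin_cases i <;> simp
  right_inv := by
    rintro (v | i)
    · by_cases h : v = w
      · subst h; simp
      · simp [h]
    · simp

theorem adj_moveO_inl (E : DirGraph) (w : E.V) (k : ℕ) (c : {e : E.Edge // E.s e = w} → Fin k)
    (x : {v : E.V // v ≠ w}) (b : (E.moveO w k c).V) :
    (E.moveO w k c).adj (Sum.inl x) b = E.adj x.1 (splitBase w b) := by
  classical
  refine (adj_moveO ..).trans (congrArg Set.encard (Set.ext fun e => and_congr_left fun _ => ?_))
  split_ifs with h
  · simpa [h] using x.2.symm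
  · simp [Subtype.ext_iff]

theorem adj_moveO_inr (E : DirGraph) (w : E.V) (k : ℕ) (c : {e : E.Edge // E.s e = w} → Fin k)
    (i : Fin k) (b : (E.moveO w k c).V) :
    (E.moveO w k c).adj (Sum.inr i) b =
      {e | E.s e = w ∧ E.r e = splitBase w b ∧ ∃ h, c ⟨e, h⟩ = i}.encard := by
  classical
  refine (adj_moveO ..).trans (congrArg Set.encard (Set.ext fun e => ?_))
  change (dite _ _ _ = _ ∧ _) ↔ _
  split_ifs with h
  · simp [h, and_comm]
  · simp [h]

theorem adj_moveI_inl (E : DirGraph) (w : E.V) (k : ℕ) (c : {e : E.Edge // E.r e = w} → Fin k)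
    (a : (E.moveI w k c).V) (y : {v : E.V // v ≠ w}) :
    (E.moveI w k c).adj a (Sum.inl y) = E.adj (splitBase w a) y.1 := by
  classical
  refine (adj_moveI ..).trans (congrArg Set.encard (Set.ext fun e => and_congr_right fun _ => ?_))
  split_ifs with h
  · simpa [h] using y.2.symm
  · simp [Subtype.ext_iff]

theorem adj_moveI_inr (E : DirGraph) (w : E.V) (k : ℕ) (c : {e : E.Edge // E.r e = w} → Fin k)
    (a : (E.moveI w k c).V) (j : Fin k) :
    (E.moveI w k c).adj a (Sum.inr j) =
      {e | E.s e = splitBase w a ∧ E.r e = w ∧ ∃ h, c ⟨e, h⟩ = j}.encard := by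
  classical
  refine (adj_moveI ..).trans (congrArg Set.encard (Set.ext fun e => ?_))
  change (_ ∧ dite _ _ _ = _) ↔ _
  split_ifs with h
  · simp [h]
  · simp [h]

variable {V : Type} [Finite V]

/-- Move (O) with two parts: the new vertex takes the first `d y` edges from `w` to each `y`, and
the old name keeps the rest. The result `B` is described by its entries, so that any convenient
closed form may be supplied for it. -/
theorem outsplit (A : V → V → ℕ∞) (w : V) (d : V → ℕ∞) (hd : ∀ y, d y ≤ A w y)
    (hfin : ∀ y, d y ≠ ⊤) (h₁ : ∃ y, d y ≠ 0) (h₂ : ∃ y, A w y - d y ≠ 0)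
    (B : V ⊕ Unit → V ⊕ Unit → ℕ∞)
    (hold : ∀ x y, x ≠ w → B (Sum.inl x) (Sum.inl y) = A x y)
    (holdw : ∀ y, B (Sum.inl w) (Sum.inl y) = A w y - d y)
    (hcol : ∀ x, B (Sum.inl x) (Sum.inr ()) = B (Sum.inl x) (Sum.inl w))
    (hrow : ∀ y, B (Sum.inr ()) (Sum.inl y) = d y)
    (hz : B (Sum.inr ()) (Sum.inr ()) = d w) :
    MovePrimeEquiv (ofAdj V A) (ofAdj (V ⊕ Unit) B) := by
  classical
  let c : {e : (ofAdj V A).Edge // (ofAdj V A).s e = w} → Fin 2 :=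
    fun e => if (e.1.1.2.2 : ℕ∞) < d e.1.1.2.1 then 0 else 1
  have key0 : ∀ y, {e | (ofAdj V A).s e = w ∧ (ofAdj V A).r e = y ∧ ∃ h, c ⟨e, h⟩ = 0}.encard =
      d y := by
    intro y
    rw [encard_ofAdj, ← encard_nat_lt (d y)]
    congr 1
    ext k
    simp only [c, Set.mem_ofPred_eq]
    constructor
    · rintro ⟨h, h', h''⟩
      by_contra hk
      simp [hk] at h''
    · intro hk
      exact ⟨hk.trans_le (hd y), trivial, by simp [hk]⟩
  have key1 : ∀ y, {e | (ofAdj V A).s e = w ∧ (ofAdj V A).r e = y ∧ ∃ h, c ⟨e, h⟩ = 1}.encard =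
      A w y - d y := by
    intro y
    rw [encard_ofAdj, ← encard_nat_interval]
    congr 1
    ext k
    simp only [c, Set.mem_ofPred_eq]
    constructor
    · rintro ⟨h, h', h''⟩
      refine ⟨?_, h⟩
      by_contra hk
      simp [not_le.1 hk] at h''
    · rintro ⟨hk, hk'⟩
      exact ⟨hk', trivial, by simp [not_lt.2 hk]⟩
  have hne : ∀ i : Fin 2, ∃ e : {e : (ofAdj V A).Edge // (ofAdj V A).s e = w}, c e = i := by
    intro i
    have : ∃ y, {e | (ofAdj V A).s e = w ∧ (ofAdj V A).r e = y ∧ ∃ h, c ⟨e, h⟩ = i}.encard ≠ 0 := by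
      fin_cases i
      · exact h₁.imp fun y hy => (key0 y).trans_ne hy
      · exact h₂.imp fun y hy => (key1 y).trans_ne hy
    obtain ⟨y, hy⟩ := this
    obtain ⟨e, h1, -, h3, h4⟩ := Set.encard_ne_zero.1 hy
    exact ⟨⟨e, h3⟩, h4⟩
  -- The first part is finite because `V` is finite and all `d y` are, so only the second part can
  -- be infinite, as (O) requires.
  have hfin0 : {e | c e = 0}.Finite := by
    refine Set.Finite.of_finite_image ?_ Subtype.val_injective.injOn
    have : (Subtype.val '' {e | c e = 0}) ⊆
        ⋃ y, {e | (ofAdj V A).s e = w ∧ (ofAdj V A).r e = y ∧ ∃ h, c ⟨e, h⟩ = 0} := by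
      rintro _ ⟨e, he, rfl⟩
      exact Set.mem_iUnion.2 ⟨_, e.2, rfl, e.2, he⟩
    refine Set.Finite.subset (Set.finite_iUnion fun y => ?_) this
    rw [← Set.encard_ne_top_iff, key0]
    exact hfin y
  have hmove : Move (ofAdj V A) ((ofAdj V A).moveO w 2 c) := by
    refine Move.O (ofAdj V A) w 2 c ?_ hne ?_
    · intro h
      obtain ⟨e, -⟩ := hne 0
      exact h e.1 e.2
    · intro i j hi hj
      have : ∀ i : Fin 2, {e | c e = i}.Infinite → i = 1 := by
        intro i hi
        fin_cases i
        · exact absurd hfin0 hi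
        · rfl
      rw [this i hi, this j hj]
  refine (Relation.EqvGen.rel _ _ hmove).trans _ _ _ (equiv_ofAdj _ (splitEquiv w) ?_)
  have hB : ∀ (u : V ⊕ Unit) (b : {v : V // v ≠ w} ⊕ Fin 2),
      B u (splitEquiv w b) = B u (Sum.inl (Sum.elim (fun v => v.1) (fun _ => w) b)) := by
    rintro u (y | j)
    · rfl
    · fin_cases j
      · rcases u with x | _
        · exact hcol x
        · exact hz.trans (hrow w).symm
      · rfl
  rintro (x | i) b
  · exact ((hB _ b).trans (hold _ _ x.2)).trans
      ((adj_moveO_inl (ofAdj V A) w 2 c x b).trans (adj_ofAdj A _ _)).symm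
  · refine (hB _ b).trans (Eq.trans ?_ (adj_moveO_inr (ofAdj V A) w 2 c i b).symm)
    fin_cases i
    · exact (hrow _).trans (key0 _).symm
    · exact (holdw _).trans (key1 _).symm

/-- The transpose of `outsplit`, via move (I): the new vertex receives the first `c₀ x` edges from
each `x`. Here `w` must be regular, but the parts may both be infinite. -/
theorem insplit (A : V → V → ℕ∞) (w : V) (hreg : ∀ y, A w y ≠ ⊤) (hreg' : ∃ y, A w y ≠ 0)
    (c₀ : V → ℕ∞) (hd : ∀ x, c₀ x ≤ A x w)
    (h₁ : ∃ x, c₀ x ≠ 0) (h₂ : ∃ x, A x w - c₀ x ≠ 0)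
    (B : V ⊕ Unit → V ⊕ Unit → ℕ∞)
    (hold : ∀ x y, y ≠ w → B (Sum.inl x) (Sum.inl y) = A x y)
    (holdw : ∀ x, B (Sum.inl x) (Sum.inl w) = A x w - c₀ x)
    (hrow : ∀ y, B (Sum.inr ()) (Sum.inl y) = B (Sum.inl w) (Sum.inl y))
    (hcol : ∀ x, B (Sum.inl x) (Sum.inr ()) = c₀ x)
    (hz : B (Sum.inr ()) (Sum.inr ()) = c₀ w) :
    MovePrimeEquiv (ofAdj V A) (ofAdj (V ⊕ Unit) B) := by
  classical
  let c : {e : (ofAdj V A).Edge // (ofAdj V A).r e = w} → Fin 2 :=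
    fun e => if (e.1.1.2.2 : ℕ∞) < c₀ e.1.1.1 then 0 else 1
  have key0 : ∀ x, {e | (ofAdj V A).s e = x ∧ (ofAdj V A).r e = w ∧ ∃ h, c ⟨e, h⟩ = 0}.encard =
      c₀ x := by
    intro x
    rw [encard_ofAdj, ← encard_nat_lt (c₀ x)]
    congr 1
    ext k
    simp only [c, Set.mem_ofPred_eq]
    constructor
    · rintro ⟨h, h', h''⟩
      by_contra hk
      simp [hk] at h''
    · intro hk
      exact ⟨hk.trans_le (hd x), trivial, by simp [hk]⟩
  have key1 : ∀ x, {e | (ofAdj V A).s e = x ∧ (ofAdj V A).r e = w ∧ ∃ h, c ⟨e, h⟩ = 1}.encard =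
      A x w - c₀ x := by
    intro x
    rw [encard_ofAdj, ← encard_nat_interval]
    congr 1
    ext k
    simp only [c, Set.mem_ofPred_eq]
    constructor
    · rintro ⟨h, h', h''⟩
      refine ⟨?_, h⟩
      by_contra hk
      simp [not_le.1 hk] at h''
    · rintro ⟨hk, hk'⟩
      exact ⟨hk', trivial, by simp [not_lt.2 hk]⟩
  have hne : ∀ i : Fin 2, ∃ e : {e : (ofAdj V A).Edge // (ofAdj V A).r e = w}, c e = i := by
    intro i
    have : ∃ x, {e | (ofAdj V A).s e = x ∧ (ofAdj V A).r e = w ∧ ∃ h, c ⟨e, h⟩ = i}.encard ≠ 0 := by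
      fin_cases i
      · exact h₁.imp fun y hy => (key0 y).trans_ne hy
      · exact h₂.imp fun y hy => (key1 y).trans_ne hy
    obtain ⟨y, hy⟩ := this
    obtain ⟨e, h1, -, h3, h4⟩ := Set.encard_ne_zero.1 hy
    exact ⟨⟨e, h3⟩, h4⟩
  have hmove : Move (ofAdj V A) ((ofAdj V A).moveI w 2 c) := by
    refine Move.I (ofAdj V A) w 2 c ?_ ?_ hne
    · exact isRegular_ofAdj A hreg hreg'.choose_spec
    · intro h
      obtain ⟨e, -⟩ := hne 0
      exact h e.1 e.2
  refine (Relation.EqvGen.rel _ _ hmove).trans _ _ _ (equiv_ofAdj _ (splitEquiv w) ?_)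
  have hB : ∀ (u : V ⊕ Unit) (b : {v : V // v ≠ w} ⊕ Fin 2),
      B (splitEquiv w b) u = B (Sum.inl (Sum.elim (fun v => v.1) (fun _ => w) b)) u := by
    rintro u (y | j)
    · rfl
    · fin_cases j
      · rcases u with x | _
        · exact hrow x
        · exact hz.trans (hcol w).symm
      · rfl
  rintro a (y | i)
  · exact ((hB _ a).trans (hold _ _ y.2)).trans
      ((adj_moveI_inl (ofAdj V A) w 2 c a y).trans (adj_ofAdj A _ _)).symm
  · refine (hB _ a).trans (Eq.trans ?_ (adj_moveI_inr (ofAdj V A) w 2 c a i).symm)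
    fin_cases i
    · exact (hcol _).trans (key0 _).symm
    · exact (holdw _).trans (key1 _).symm

/-- Move (R) at the last vertex. -/
theorem reduceLast [DecidableEq V] (A : V → V → ℕ∞) (c : V → ℕ∞) (x₀ y₀ : V) (hc : c x₀ ≠ 0)
    (hc' : ∀ x, x ≠ x₀ → c x = 0) (d : V → ℕ∞) (hd : d = Pi.single y₀ 1) :
    MovePrimeEquiv (ofAdj (V ⊕ Unit) (bordered A c d 0))
      (ofAdj V fun x y => A x y + if y = y₀ then c x else 0) := by
  subst hd
  set G := ofAdj (V ⊕ Unit) (bordered A c (Pi.single y₀ 1) 0) with hG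
  have hadj : ∀ a b, G.adj a b = bordered A c (Pi.single y₀ 1) 0 a b := adj_ofAdj _
  have hone : G.adj (Sum.inr ()) (Sum.inl y₀) = 1 := by simp [hadj, bordered]
  obtain ⟨f, hf⟩ := Set.encard_eq_one.1 hone
  have hfm : G.s f = Sum.inr () ∧ G.r f = Sum.inl y₀ := hf.superset rfl
  have hsf : {e | G.s e = Sum.inr ()} = {f} := by
    rw [← hf]
    ext e
    refine ⟨fun h => ⟨h, ?_⟩, fun h => h.1⟩
    have h1 := adj_ne_zero _ e
    change bordered A c (Pi.single y₀ 1) 0 (G.s e) (G.r e) ≠ 0 at h1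
    rw [show G.s e = Sum.inr () from h] at h1
    rcases hr : G.r e with y | y
    · rw [hr] at h1
      by_cases hy : y = y₀
      · rw [hy]
      · simp [bordered, hy] at h1
    · rw [hr] at h1
      simp [bordered] at h1
  have hr : G.r f ≠ Sum.inr () := by rw [hfm.2]; simp
  have hmove : Move G (G.moveR (Sum.inr ()) f hsf hr) := by
    refine Move.R G (Sum.inr ()) (Sum.inl x₀) f hsf hr ?_ ?_
    · exact ⟨by rw [hsf]; exact Set.finite_singleton f, by rw [hsf]; exact Set.singleton_nonempty f⟩
    · refine Set.eq_singleton_iff_unique_mem.2 ⟨?_, ?_⟩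
      · have : G.adj (Sum.inl x₀) (Sum.inr ()) ≠ 0 := by rw [hadj]; exact hc
        obtain ⟨e, h1, h2⟩ := Set.encard_ne_zero.1 this
        exact ⟨e, h2, h1⟩
      · rintro _ ⟨e, he, rfl⟩
        have h1 := adj_ne_zero _ e
        change bordered A c (Pi.single y₀ 1) 0 (G.s e) (G.r e) ≠ 0 at h1
        rw [show G.r e = Sum.inr () from he] at h1
        rcases hs : G.s e with x | x
        · rw [hs] at h1
          by_contra hx
          exact h1 (hc' x fun h => hx (by rw [h]))
        · rw [hs] at h1
          simp [bordered] at h1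
  -- The value `x₀` at the last vertex is never used, since that vertex has been removed.
  let φ : {v : V ⊕ Unit // v ≠ Sum.inr ()} ≃ V :=
    { toFun := fun v => v.1.elim id (fun _ => x₀)
      invFun := fun v => ⟨Sum.inl v, by simp⟩
      left_inv := by
        rintro ⟨v | v, hv⟩
        · rfl
        · exact absurd rfl hv
      right_inv := fun v => rfl }
  refine (Relation.EqvGen.rel _ _ hmove).trans _ _ _ (equiv_ofAdj _ φ ?_)
  rintro ⟨x | x, hx⟩ ⟨y | y, hy⟩
  · refine Eq.trans ?_ (adj_moveR ..).symm
    rw [hadj, hadj, hfm.2]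
    refine congrArg₂ (· + ·) rfl ?_
    by_cases h : y = y₀
    · exact (if_pos h).trans (if_pos (congrArg Sum.inl h.symm)).symm
    · exact (if_neg h).trans (if_neg fun h' => h (Sum.inl_injective h').symm).symm
  · exact absurd rfl hy
  · exact absurd rfl hx
  · exact absurd rfl hx

end DirGraph

/-! ### Row and column additions, and the Cuntz splice, realised by moves -/

namespace DirGraph

open Classical in
/-- Add row `v` of `A - 1` to row `u`. -/
noncomputable def addRow {V : Type} (A : V → V → ℕ∞) (u v : V) : V → V → ℕ∞ :=
  fun x y => if x = u then (A u y - if y = v then 1 else 0) + A v y else A x y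

open Classical in
/-- Add column `u` of `A - 1` to column `v`. -/
noncomputable def addCol {V : Type} (A : V → V → ℕ∞) (u v : V) : V → V → ℕ∞ :=
  fun x y => if y = v then (A x v - if x = u then 1 else 0) + A x u else A x y

variable {V : Type} [Finite V]

open Classical in
/-- A vertex that receives a single edge, from `u`, can be collapsed. -/
theorem collapse_of_single_in (u : V) (n : ℕ) : ∀ (A : V → V → ℕ∞) (d : V → ℕ∞) (k : V → ℕ),
    (∀ y, d y = k y) → ∑ᶠ y, k y = n + 1 →
    MovePrimeEquiv (ofAdj (V ⊕ Unit) (bordered A (Pi.single u 1) d 0))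
      (ofAdj V fun x y => A x y + if x = u then d y else 0) := by
  have := Fintype.ofFinite V
  -- The number of emitted edges is `n + 1`. If it is one, move (R) applies. Otherwise one edge, to
  -- `y`, is split off by an outsplit. Both halves again receive one edge from `u`, so (R) removes
  -- the new half, leaving an edge `u → y`, and the other half has one edge fewer.
  induction n with
  | zero =>
    intro A d k hk hsum
    rw [finsum_eq_sum_of_fintype] at hsum
    obtain ⟨y, -, hy⟩ : ∃ y ∈ Finset.univ, k y ≠ 0 := Finset.exists_ne_zero_of_sum_ne_zero (by omega)
    have hle : ∀ z, z ≠ y → k z = 0 := by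
      intro z hz
      have := Finset.sum_le_sum_of_subset (f := k) (Finset.subset_univ {y, z})
      rw [Finset.sum_pair hz.symm] at this
      omega
    have hy1 : k y = 1 := by
      have := Finset.single_le_sum (f := k) (fun _ _ => Nat.zero_le _) (Finset.mem_univ y)
      omega
    have hd : d = Pi.single y 1 := by
      ext z
      rw [hk]
      by_cases hz : z = y
      · subst hz; simp [hy1]
      · simp [hz, hle z hz]
    refine (reduceLast A (Pi.single u 1) u y (by simp) (fun x hx => by simp [hx]) d hd).trans _ _ _
      (ofAdj_equiv _ (Equiv.refl V) _ fun x z => ?_)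
    simp only [Equiv.refl_apply, hd, Pi.single_apply]
    split_ifs <;> rfl
  | succ n ih =>
    intro A d k hk hsum
    rw [finsum_eq_sum_of_fintype] at hsum
    obtain ⟨y, -, hy⟩ : ∃ y ∈ Finset.univ, k y ≠ 0 := Finset.exists_ne_zero_of_sum_ne_zero (by omega)
    let k' : V → ℕ := fun z => k z - if z = y then 1 else 0
    have hk' : ∀ z, k z = k' z + if z = y then 1 else 0 := by
      intro z
      simp only [k']
      split_ifs with h
      · subst h; omega
      · rfl
    have hsum' : ∑ z, k' z = n + 1 := by
      have : ∑ z, k z = ∑ z, k' z + 1 := by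
        rw [Finset.sum_congr rfl fun z _ => hk' z, Finset.sum_add_distrib]
        simp
      omega
    -- Another edge remains, so that the second part of the outsplit is nonempty.
    obtain ⟨z, -, hz⟩ : ∃ z ∈ Finset.univ, k' z ≠ 0 :=
      Finset.exists_ne_zero_of_sum_ne_zero (by omega)
    let d' : V → ℕ∞ := fun z => k' z
    have hd' : ∀ z, d z = d' z + if z = y then 1 else 0 := fun z => by
      rw [hk, hk']; simp only [d']; push_cast; rfl
    let δ : V → ℕ∞ := Pi.single y 1
    have hδ : ∀ z, d z - δ z = d' z := fun z => by
      rw [hd']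
      simp only [δ, Pi.single_apply]
      split_ifs
      · simp only [d']; norm_cast
      · simp
    have h1 : MovePrimeEquiv (ofAdj (V ⊕ Unit) (bordered A (Pi.single u 1) d 0))
        (ofAdj ((V ⊕ Unit) ⊕ Unit) (bordered (bordered A (Pi.single u 1) d' 0)
          (Pi.single (Sum.inl u) 1) (Pi.single (Sum.inl y) 1) 0)) := by
      refine outsplit _ (Sum.inr ()) (Pi.single (Sum.inl y) 1) ?_ ?_ ⟨Sum.inl y, by simp⟩
        ⟨Sum.inl z, ?_⟩ _ ?_ ?_ ?_ ?_ ?_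
      · rintro (x | x)
        · simp only [bordered, hd', Pi.single_apply, Sum.inl.injEq]
          exact le_add_self
        · simp
      · intro x
        rw [Pi.single_apply]
        split_ifs <;> simp
      · have : d z - δ z ≠ 0 := by rw [hδ]; simpa [d'] using hz
        simpa [bordered, δ, Pi.single_apply] using this
      · rintro (x | x) (z | z) hx <;> simp_all [bordered]
      · rintro (x | x)
        · simp [bordered, ← hδ, δ, Pi.single_apply]
        · simp [bordered]
      · rintro (x | x) <;> simp [bordered, Pi.single_apply]
      · rintro (x | x) <;> simp [bordered]
      · simp [bordered]
    refine h1.trans _ _ _ ((reduceLast _ (Pi.single (Sum.inl u) 1) (Sum.inl u) (Sum.inl y) (by simp)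
      (fun x hx => by simp [hx]) _ rfl).trans _ _ _ ?_)
    refine (ofAdj_equiv _ (Equiv.refl _) (bordered (fun x z => A x z + if x = u then δ z else 0)
      (Pi.single u 1) d' 0) ?_).trans _ _ _ ((ih _ d' k' (fun _ => rfl)
        (by rw [finsum_eq_sum_of_fintype]; exact hsum')).trans _ _ _
      (ofAdj_equiv _ (Equiv.refl V) _ ?_))
    · rintro (x | x) (z | z)
      · by_cases hx : x = u <;> by_cases hz : z = y <;> simp [bordered, hx, hz, δ]
      · simp [bordered]
      · by_cases hz : z = y <;> simp [bordered, hz]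
      · simp [bordered]
    · intro x z
      by_cases hx : x = u
      · by_cases hz : z = y <;> simp [hx, hz, hd', δ, add_assoc, add_comm]
      · simp [hx]

open Classical in
/-- A vertex that emits a single edge, to `y`, can be collapsed. -/
theorem collapse_of_single_out (y : V) (n : ℕ) : ∀ (A : V → V → ℕ∞) (c : V → ℕ∞),
    {x | c x ≠ 0}.ncard = n + 1 →
    MovePrimeEquiv (ofAdj (V ⊕ Unit) (bordered A c (Pi.single y 1) 0))
      (ofAdj V fun x z => A x z + if z = y then c x else 0) := by
  -- Here `n + 1` counts the vertices with an edge into the collapsed vertex. Move (R) needs a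
  -- single such vertex but allows many edges from it, possibly infinitely many. So an insplit
  -- separates all edges coming from one `x₀`, and (R) removes that part.
  induction n with
  | zero =>
    intro A c hc
    obtain ⟨x₀, hx₀⟩ := Set.ncard_eq_one.1 hc
    refine reduceLast A c x₀ y (hx₀.superset rfl) (fun x hx => ?_) _ rfl
    by_contra h
    exact hx (hx₀.subset h)
  | succ n ih =>
    intro A c hc
    obtain ⟨x₀, hx₀ : c x₀ ≠ 0⟩ := Set.nonempty_of_ncard_ne_zero (by rw [hc]; omega)
    let c' : V → ℕ∞ := fun x => if x = x₀ then 0 else c x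
    let δ : V → ℕ∞ := Pi.single x₀ (c x₀)
    have hcard : {x | c' x ≠ 0}.ncard = n + 1 := by
      have : {x | c' x ≠ 0} = {x | c x ≠ 0} \ {x₀} := by
        ext x
        by_cases hx : x = x₀ <;> simp [c', hx]
      rw [this, Set.ncard_sdiff_singleton_of_mem hx₀, hc]
      rfl
    obtain ⟨x₁, hx₁ : c' x₁ ≠ 0⟩ := Set.nonempty_of_ncard_ne_zero (by rw [hcard]; omega)
    have hsub : ∀ x, c x - δ x = c' x := fun x => by
      by_cases hx : x = x₀ <;> simp [c', δ, hx]
    have hadd : ∀ x, c x = δ x + c' x := fun x => by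
      by_cases hx : x = x₀ <;> simp [c', δ, hx]
    have h1 : MovePrimeEquiv (ofAdj (V ⊕ Unit) (bordered A c (Pi.single y 1) 0))
        (ofAdj ((V ⊕ Unit) ⊕ Unit) (bordered (bordered A c' (Pi.single y 1) 0)
          (Pi.single (Sum.inl x₀) (c x₀)) (Pi.single (Sum.inl y) 1) 0)) := by
      refine insplit _ (Sum.inr ()) ?_ ⟨Sum.inl y, by simp [bordered]⟩
        (Pi.single (Sum.inl x₀) (c x₀)) ?_ ⟨Sum.inl x₀, by simpa using hx₀⟩
        ⟨Sum.inl x₁, ?_⟩ _ ?_ ?_ ?_ ?_ ?_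
      · rintro (x | x)
        · by_cases hx : x = y <;> simp [bordered, hx]
        · simp [bordered]
      · rintro (x | x)
        · by_cases hx : x = x₀ <;> simp [bordered, hx]
        · simp [bordered]
      · simpa [bordered, Pi.single_apply, ← hsub, δ] using hx₁
      · rintro (x | x) (z | z) hx <;> simp_all [bordered]
      · rintro (x | x)
        · simp [bordered, ← hsub, δ, Pi.single_apply]
        · simp [bordered]
      · rintro (x | x) <;> simp [bordered, Pi.single_apply]
      · rintro (x | x) <;> simp [bordered]
      · simp [bordered]
    refine h1.trans _ _ _ ((reduceLast _ (Pi.single (Sum.inl x₀) (c x₀)) (Sum.inl x₀) (Sum.inl y) (by simpa using hx₀)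
      (fun x hx => by simp [hx]) _ rfl).trans _ _ _ ?_)
    refine (ofAdj_equiv _ (Equiv.refl _) (bordered (fun x z => A x z + if z = y then δ x else 0)
      c' (Pi.single y 1) 0) ?_).trans _ _ _ ((ih _ c' hcard).trans _ _ _
      (ofAdj_equiv _ (Equiv.refl V) _ ?_))
    · rintro (x | x) (z | z)
      · by_cases hx : x = x₀ <;> by_cases hz : z = y <;> simp [bordered, hx, hz, δ]
      · simp [bordered]
      · simp [bordered]
      · simp [bordered]
    · intro x z
      by_cases hz : z = y
      · simp [hz, hadd, add_assoc]
      · simp [hz]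

/-- Insplit `v` so that one edge from `u` ends at a new copy of `v`, which emits what `v` emits.
Collapsing the copy replaces that edge by one edge from `u` for each edge out of `v`. The loop at
`v` keeps the other part of the insplit nonempty, and finiteness of the row makes the collapse
terminate. -/
theorem addRow_equiv (A : V → V → ℕ∞) {u v : V} (huv : u ≠ v) (h : A u v ≠ 0)
    (hreg : ∀ y, A v y ≠ ⊤) (hv : A v v ≠ 0) :
    MovePrimeEquiv (ofAdj V A) (ofAdj V (addRow A u v)) := by
  classical
  have := Fintype.ofFinite V
  let A' : V → V → ℕ∞ := fun x y => A x y - if x = u ∧ y = v then 1 else 0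
  have h1 : MovePrimeEquiv (ofAdj V A)
      (ofAdj (V ⊕ Unit) (bordered A' (Pi.single u 1) (A v) 0)) := by
    refine insplit A v hreg ⟨v, hv⟩ (Pi.single u 1) ?_ ⟨u, by simp⟩ ⟨v, by simpa [huv.symm] using hv⟩ _
      ?_ ?_ ?_ ?_ ?_
    · intro x
      by_cases hx : x = u
      · subst hx; simpa using Order.one_le_iff_ne_zero.2 h
      · simp [hx]
    · intro x y hy; simp [bordered, A', hy]
    · intro x; simp [bordered, A', Pi.single_apply]
    · intro y; simp [bordered, A', huv.symm]
    · intro x; rfl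
    · simp [bordered, huv.symm]
  have hk : ∀ y, A v y = ((A v y).toNat : ℕ) := fun y => (ENat.natCast_toNat (hreg y)).symm
  have hsum : ∑ᶠ y, (A v y).toNat ≠ 0 := by
    rw [finsum_eq_sum_of_fintype]
    intro h0
    have := Finset.sum_eq_zero_iff.1 h0 v (Finset.mem_univ v)
    exact hv (by rw [hk, this]; rfl)
  obtain ⟨n, hn⟩ := Nat.exists_eq_succ_of_ne_zero hsum
  refine h1.trans _ _ _ ((collapse_of_single_in u n A' (A v) _ hk hn).trans _ _ _
    (ofAdj_equiv _ (Equiv.refl V) _ fun x y => ?_))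
  by_cases hx : x = u <;> by_cases hy : y = v <;> simp [addRow, A', hx, hy]

/-- Outsplit `u` so that a new vertex emits just one edge, to `v`, and receives what `u` receives,
then collapse it. No regularity of `u` is needed, since (O) allows one infinite part; the loop at
`u` keeps that part nonempty. -/
theorem addCol_equiv (A : V → V → ℕ∞) {u v : V} (huv : u ≠ v) (h : A u v ≠ 0)
    (hu : A u u ≠ 0) :
    MovePrimeEquiv (ofAdj V A) (ofAdj V (addCol A u v)) := by
  classical
  let A' : V → V → ℕ∞ := fun x y => A x y - if x = u ∧ y = v then 1 else 0
  have h1 : MovePrimeEquiv (ofAdj V A)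
      (ofAdj (V ⊕ Unit) (bordered A' (fun x => A x u) (Pi.single v 1) 0)) := by
    refine outsplit A u (Pi.single v 1) ?_ ?_ ⟨v, by simp⟩ ⟨u, by simpa [huv] using hu⟩ _
      ?_ ?_ ?_ ?_ ?_
    · intro x
      by_cases hx : x = v
      · subst hx; simpa using Order.one_le_iff_ne_zero.2 h
      · simp [hx]
    · intro x
      by_cases hx : x = v <;> simp [hx]
    · intro x y hx; simp [bordered, A', hx]
    · intro x; simp [bordered, A', Pi.single_apply]
    · intro y; simp [bordered, A', huv]
    · intro x; rfl
    · simp [bordered, huv]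
  have hcard : {x | A x u ≠ 0}.ncard ≠ 0 :=
    Set.ncard_ne_zero_of_mem (a := u) hu
  obtain ⟨n, hn⟩ := Nat.exists_eq_succ_of_ne_zero hcard
  refine h1.trans _ _ _ ((collapse_of_single_out v n A' _ hn).trans _ _ _
    (ofAdj_equiv _ (Equiv.refl V) _ fun x y => ?_))
  by_cases hx : x = u <;> by_cases hy : y = v <;> simp [addCol, A', hx, hy]

open Classical in
/-- The adjacency matrix after a Cuntz splice at `w`. -/
noncomputable def spliceAdj (A : V → V → ℕ∞) (w : V) :
    (V ⊕ Unit) ⊕ Unit → (V ⊕ Unit) ⊕ Unit → ℕ∞ :=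
  bordered (bordered A (Pi.single w 1) (Pi.single w 1) 1) (Pi.single (Sum.inr ()) 1)
    (Pi.single (Sum.inr ()) 1) 1

theorem splice_equiv (A : V → V → ℕ∞) (w : V) (hw : 2 ≤ A w w) (hreg : ∀ y, A w y ≠ ⊤) :
    MovePrimeEquiv (ofAdj V A) (ofAdj ((V ⊕ Unit) ⊕ Unit) (spliceAdj A w)) := by
  classical
  have hloops : 1 < {e | (ofAdj V A).s e = w ∧ (ofAdj V A).r e = w}.encard := by
    refine lt_of_lt_of_eq ?_ (adj_ofAdj A w w).symm
    exact lt_of_lt_of_le (by norm_num) hw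
  obtain ⟨e, e', he, he', hne⟩ := Set.one_lt_encard_iff.1 hloops
  -- Two different loops are two return paths of length one.
  have hret : ∀ e, (ofAdj V A).s e = w ∧ (ofAdj V A).r e = w → (ofAdj V A).IsReturnPath w [e] :=
    fun e he => ⟨by simp, ⟨he.1, he.2⟩, by simp⟩
  have hmove : Move (ofAdj V A) ((ofAdj V A).moveC w) := by
    refine Move.C _ w (isRegular_ofAdj A hreg (v := w) ?_)
      ⟨[e], [e'], by simpa using hne, hret e he, hret e' he'⟩
    rintro h0
    rw [h0] at hw
    exact absurd hw (by norm_num)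
  let φ : V ⊕ Fin 2 ≃ (V ⊕ Unit) ⊕ Unit :=
    { toFun := Sum.elim (fun v => Sum.inl (Sum.inl v)) ![Sum.inl (Sum.inr ()), Sum.inr ()]
      invFun := Sum.elim (Sum.elim Sum.inl fun _ => Sum.inr 0) fun _ => Sum.inr 1
      left_inv := by
        rintro (v | i)
        · rfl
        · fin_cases i <;> rfl
      right_inv := by rintro ((v | i) | i) <;> rfl }
  let ν : Fin 2 → (V ⊕ Unit) ⊕ Unit := ![Sum.inl (Sum.inr ()), Sum.inr ()]
  have hto : ∀ x j, spliceAdj A w (Sum.inl (Sum.inl x)) (ν j) = if x = w ∧ j = 0 then 1 else 0 := by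
    intro x j
    fin_cases j <;> simp [ν, spliceAdj, bordered, Pi.single_apply]
  have hfrom : ∀ x j, spliceAdj A w (ν j) (Sum.inl (Sum.inl x)) = if x = w ∧ j = 0 then 1 else 0 := by
    intro x j
    fin_cases j <;> simp [ν, spliceAdj, bordered, Pi.single_apply]
  have hnew : ∀ i j, spliceAdj A w (ν i) (ν j) = 1 := by
    intro i j
    fin_cases i <;> fin_cases j <;> simp [ν, spliceAdj, bordered]
  refine (Relation.EqvGen.rel _ _ hmove).trans _ _ _ (equiv_ofAdj _ φ ?_)
  rintro (x | i) (y | j)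
  · exact ((adj_moveC_old _ w x y).trans (adj_ofAdj A x y)).symm
  · exact (hto x j).trans (adj_moveC_to (ofAdj V A) w x j).symm
  · exact (hfrom y i).trans (adj_moveC_from (ofAdj V A) w y i).symm
  · exact (hnew i j).trans (adj_moveC_new (ofAdj V A) w i j).symm

end DirGraph

/-! ### Block matrices over arbitrary index types -/

/-- The matrix `M`, with rows and columns divided into blocks by `b` and `b'`, vanishes outside the
blocks `(i, j)` with `i ≼ j`. -/
def BlockTri {N : ℕ} (P : BlockOrder N) {X Y : Type} (b : X → Fin N) (b' : Y → Fin N)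
    (M : Matrix X Y ℤ) : Prop :=
  ∀ x y, M x y ≠ 0 → P.rel (b x) (b' y)

/-- A diagonal block. -/
def diagBlock {N : ℕ} {X Y : Type} (b : X → Fin N) (b' : Y → Fin N) (M : Matrix X Y ℤ) (i : Fin N) :
    Matrix {x // b x = i} {y // b' y = i} ℤ :=
  M.submatrix Subtype.val Subtype.val

section BlockTri

variable {N : ℕ} {P : BlockOrder N} {X Y Z : Type} {b : X → Fin N} {b' : Y → Fin N} {b'' : Z → Fin N}

theorem BlockTri.one [DecidableEq X] : BlockTri P b b 1 := by
  intro x y h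
  by_cases hxy : x = y
  · subst hxy; exact P.refl _
  · exact absurd (Matrix.one_apply_ne hxy) h

theorem BlockTri.mul [Fintype Y] {M : Matrix X Y ℤ} {M' : Matrix Y Z ℤ} (h : BlockTri P b b' M)
    (h' : BlockTri P b' b'' M') : BlockTri P b b'' (M * M') := by
  intro x z hxz
  obtain ⟨y, -, hy⟩ := Finset.exists_ne_zero_of_sum_ne_zero hxz
  exact P.trans _ _ _ (h x y (left_ne_zero_of_mul hy)) (h' y z (right_ne_zero_of_mul hy))

/-- By antisymmetry, an intermediate index `y` with `i ≼ b' y ≼ i` lies in block `i`, so other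
blocks contribute nothing to the diagonal block of the product. -/
theorem diagBlock_mul [Fintype Y] {M : Matrix X Y ℤ} {M' : Matrix Y Z ℤ} (h : BlockTri P b b' M)
    (h' : BlockTri P b' b'' M') (i : Fin N) :
    diagBlock b b'' (M * M') i = diagBlock b b' M i * diagBlock b' b'' M' i := by
  ext ⟨x, rfl⟩ ⟨z, hz⟩
  simp only [diagBlock, Matrix.submatrix_apply, Matrix.mul_apply]
  refine (Finset.sum_of_injOn Subtype.val Subtype.val_injective.injOn (fun _ _ => by simp) ?_
    fun _ _ => rfl).symm
  intro y _ hy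
  by_contra hne
  have h1 := h x y (left_ne_zero_of_mul hne)
  have h2 := h' y z (right_ne_zero_of_mul hne)
  rw [hz] at h2
  exact hy ⟨⟨y, P.antisymm _ _ h2 h1⟩, by simp, rfl⟩

@[simp] theorem diagBlock_one [DecidableEq X] (i : Fin N) : diagBlock b b 1 i = 1 := by
  ext x y
  simp [diagBlock, Matrix.one_apply, Subtype.ext_iff]

end BlockTri

/-- Invertible block matrices with prescribed determinants of the diagonal blocks. -/
structure BlockGL {N : ℕ} (P : BlockOrder N) {X : Type} [Fintype X] [DecidableEq X]
    (b : X → Fin N) (δ : Fin N → ℤ) (U : Matrix X X ℤ) : Prop where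
  tri : BlockTri P b b U
  inv : ∃ W, BlockTri P b b W ∧ U * W = 1 ∧ W * U = 1
  det : ∀ i, (diagBlock b b U i).det = δ i

/-- Equivalence of block matrices by invertible block matrices with prescribed determinants of the
diagonal blocks. -/
def BlockEquiv {N : ℕ} (P : BlockOrder N) {R C : Type} [Fintype R] [DecidableEq R] [Fintype C]
    [DecidableEq C] (bR : R → Fin N) (bC : C → Fin N) (δ δ' : Fin N → ℤ) (B B' : Matrix R C ℤ) : Prop :=
  ∃ U V, BlockGL P bR δ U ∧ BlockGL P bC δ' V ∧ U * B * V = B'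

section BlockGL

variable {N : ℕ} {P : BlockOrder N} {X : Type} [Fintype X] [DecidableEq X] {b : X → Fin N}

theorem BlockGL.one : BlockGL P b 1 1 :=
  ⟨BlockTri.one, ⟨1, BlockTri.one, by simp, by simp⟩, by simp⟩

theorem BlockGL.mul {δ δ' : Fin N → ℤ} {U U' : Matrix X X ℤ} (h : BlockGL P b δ U)
    (h' : BlockGL P b δ' U') : BlockGL P b (δ * δ') (U * U') := by
  obtain ⟨W, hW, h1, h2⟩ := h.inv
  obtain ⟨W', hW', h1', h2'⟩ := h'.inv
  refine ⟨h.tri.mul h'.tri, ⟨W' * W, hW'.mul hW, ?_, ?_⟩, fun i => ?_⟩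
  · rw [Matrix.mul_assoc, ← Matrix.mul_assoc U', h1', Matrix.one_mul, h1]
  · rw [Matrix.mul_assoc, ← Matrix.mul_assoc W, h2, Matrix.one_mul, h2']
  · rw [diagBlock_mul h.tri h'.tri, Matrix.det_mul, h.det, h'.det, Pi.mul_apply]

theorem diagBlock_mul_inv {U W : Matrix X X ℤ} (hU : BlockTri P b b U) (hW : BlockTri P b b W)
    (h : U * W = 1) (i : Fin N) : diagBlock b b U i * diagBlock b b W i = 1 := by
  rw [← diagBlock_mul hU hW, h, diagBlock_one]

theorem BlockGL.exists_inv {U : Matrix X X ℤ} (h : BlockGL P b 1 U) :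
    ∃ W, BlockGL P b 1 W ∧ U * W = 1 ∧ W * U = 1 := by
  obtain ⟨W, hW, h1, h2⟩ := h.inv
  refine ⟨W, ⟨hW, ⟨U, h.tri, h2, h1⟩, fun i => ?_⟩, h1, h2⟩
  have := congrArg Matrix.det (diagBlock_mul_inv h.tri hW h1 i)
  rwa [Matrix.det_mul, h.det, Pi.one_apply, one_mul, Matrix.det_one] at this

/-- The diagonal blocks of `U` and `W` are mutually inverse, so their determinants are units of the
integers. -/
theorem exists_blockGL {U W : Matrix X X ℤ} (hU : BlockTri P b b U) (hW : BlockTri P b b W)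
    (h1 : U * W = 1) (h2 : W * U = 1) :
    ∃ δ : Fin N → ℤ, (∀ i, δ i = 1 ∨ δ i = -1) ∧ BlockGL P b δ U := by
  refine ⟨fun i => (diagBlock b b U i).det, fun i => ?_, hU, ⟨W, hW, h1, h2⟩, fun i => rfl⟩
  have := congrArg Matrix.det (diagBlock_mul_inv hU hW h1 i)
  rw [Matrix.det_mul, Matrix.det_one] at this
  exact Int.isUnit_iff.1 (IsUnit.of_mul_eq_one _ this)

theorem BlockGL.transvection {x y : X} (hxy : x ≠ y) (h : P.rel (b x) (b y)) (c : ℤ) :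
    BlockGL P b 1 (Matrix.transvection x y c) := by
  have htri : ∀ c : ℤ, BlockTri P b b (Matrix.transvection x y c) := by
    intro c u v huv
    by_cases h1 : u = v
    · subst h1; exact P.refl _
    · by_cases h2 : x = u ∧ y = v
      · obtain ⟨rfl, rfl⟩ := h2; exact h
      · simp [Matrix.transvection, Matrix.one_apply_ne h1, Matrix.single_apply_of_ne _ _ _ _ _ h2] at huv
  refine ⟨htri c, ⟨_, htri (-c), ?_, ?_⟩, fun i => ?_⟩
  · rw [Matrix.transvection_mul_transvection_same _ _ hxy]; simp
  · rw [Matrix.transvection_mul_transvection_same _ _ hxy]; simp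
  · by_cases hi : b x = i ∧ b y = i
    · have : diagBlock b b (Matrix.transvection x y c) i =
          Matrix.transvection ⟨x, hi.1⟩ ⟨y, hi.2⟩ c := by
        ext u v
        simp [diagBlock, Matrix.transvection, Matrix.single_apply, Matrix.one_apply, Subtype.ext_iff]
      rw [this, Matrix.det_transvection_of_ne _ _ (by simpa using hxy)]
      rfl
    · have : diagBlock b b (Matrix.transvection x y c) i = 1 := by
        ext ⟨u, hu⟩ ⟨v, hv⟩
        have : ¬ (x = u ∧ y = v) := by
          rintro ⟨rfl, rfl⟩; exact hi ⟨hu, hv⟩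
        simp [diagBlock, Matrix.transvection, Matrix.single_apply_of_ne _ _ _ _ _ this,
          Matrix.one_apply]
      rw [this, Matrix.det_one]
      rfl

/-- The direct sum with a matrix of size one. -/
def sumOne {R C : Type} (B : Matrix R C ℤ) (u : ℤ) : Matrix (R ⊕ Unit) (C ⊕ Unit) ℤ :=
  Matrix.fromBlocks B 0 0 (Matrix.of fun _ _ => u)

/-- The block map after a new index is added to the `i`-th block. -/
abbrev addIdx {X : Type} (b : X → Fin N) (i : Fin N) : X ⊕ Unit → Fin N := Sum.elim b fun _ => i

theorem sumOne_mul {R C D : Type} [Fintype C] (B : Matrix R C ℤ) (B' : Matrix C D ℤ) (u u' : ℤ) :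
    sumOne B u * sumOne B' u' = sumOne (B * B') (u * u') := by
  unfold sumOne
  rw [Matrix.fromBlocks_multiply]
  congr 1 <;> ext i j <;> simp [Matrix.mul_apply]

theorem sumOne_one {X : Type} [DecidableEq X] : sumOne (1 : Matrix X X ℤ) 1 = 1 := by
  rw [← Matrix.fromBlocks_one]
  unfold sumOne
  congr 1

theorem BlockTri.sum_one {R C : Type} {bR : R → Fin N} {bC : C → Fin N} {B : Matrix R C ℤ}
    (h : BlockTri P bR bC B) (i : Fin N) (u : ℤ) :
    BlockTri P (addIdx bR i) (addIdx bC i) (sumOne B u) := by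
  rintro (r | r) (c | c) hrc
  · exact h r c hrc
  · exact absurd rfl hrc
  · exact absurd rfl hrc
  · exact P.refl i

/-- The fibers of `addIdx b i`. -/
def fiberSum {X : Type} (b : X → Fin N) (i j : Fin N) :
    {x // addIdx b i x = j} ≃ {x // b x = j} ⊕ {_x : Unit // i = j} :=
  Equiv.subtypeSum (p := fun x => addIdx b i x = j)

/-- A diagonal block after a new index is added, up to reindexing. -/
theorem diagBlock_sumOne {R C : Type} (bR : R → Fin N) (bC : C → Fin N) (B : Matrix R C ℤ)
    (i : Fin N) (u : ℤ) (j : Fin N) :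
    diagBlock (addIdx bR i) (addIdx bC i) (sumOne B u) j =
      (Matrix.fromBlocks (diagBlock bR bC B j) 0 0 (Matrix.of fun _ _ => u)).submatrix
        (fiberSum bR i j) (fiberSum bC i j) := by
  ext ⟨r | r, hr⟩ ⟨c | c, hc⟩ <;> rfl

/-- The new index contributes a factor `u` to the determinant of block `i` and an empty determinant
elsewhere. -/
theorem BlockGL.sum_one {δ : Fin N → ℤ} {U : Matrix X X ℤ} (h : BlockGL P b δ U) (i : Fin N) {u : ℤ}
    (hu : u * u = 1) :
    BlockGL P (addIdx b i) (fun j => if j = i then δ j * u else δ j) (sumOne U u) := by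
  obtain ⟨W, hW, h1, h2⟩ := h.inv
  refine ⟨h.tri.sum_one i u, ⟨_, hW.sum_one i u, ?_, ?_⟩, fun j => ?_⟩
  · rw [sumOne_mul, h1, hu, sumOne_one]
  · rw [sumOne_mul, h2, hu, sumOne_one]
  · rw [diagBlock_sumOne, Matrix.det_submatrix_equiv_self, Matrix.det_fromBlocks_zero₁₂, h.det]
    split_ifs with hj
    · subst hj
      have : Unique {_x : Unit // j = j} := ⟨⟨⟨(), rfl⟩⟩, fun _ => rfl⟩
      rw [Matrix.det_unique]
      rfl
    · have : IsEmpty {_x : Unit // i = j} := ⟨fun y => hj y.2.symm⟩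
      rw [Matrix.det_isEmpty, mul_one]

end BlockGL

section BlockEquiv

variable {N : ℕ} {P : BlockOrder N} {R C : Type} [Fintype R] [DecidableEq R] [Fintype C]
    [DecidableEq C] {bR : R → Fin N} {bC : C → Fin N} {δ δ' ε ε' : Fin N → ℤ} {B B' B'' : Matrix R C ℤ}

theorem BlockEquiv.trans (h : BlockEquiv P bR bC δ δ' B B') (h' : BlockEquiv P bR bC ε ε' B' B'') :
    BlockEquiv P bR bC (ε * δ) (δ' * ε') B B'' := by
  obtain ⟨U, V, hU, hV, rfl⟩ := h
  obtain ⟨U', V', hU', hV', rfl⟩ := h'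
  exact ⟨U' * U, V * V', hU'.mul hU, hV.mul hV', by simp only [Matrix.mul_assoc]⟩

theorem BlockEquiv.trans_one (h : BlockEquiv P bR bC 1 1 B B') (h' : BlockEquiv P bR bC 1 1 B' B'') :
    BlockEquiv P bR bC 1 1 B B'' := by
  simpa using h.trans h'

theorem BlockEquiv.symm (h : BlockEquiv P bR bC 1 1 B B') : BlockEquiv P bR bC 1 1 B' B := by
  obtain ⟨U, V, hU, hV, rfl⟩ := h
  obtain ⟨U', hU', h1, h2⟩ := hU.exists_inv
  obtain ⟨V', hV', h3, h4⟩ := hV.exists_inv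
  refine ⟨U', V', hU', hV', ?_⟩
  rw [Matrix.mul_assoc U, ← Matrix.mul_assoc U', h2, Matrix.one_mul, Matrix.mul_assoc, h3,
    Matrix.mul_one]

theorem BlockEquiv.row (B : Matrix R C ℤ) (x y : R) (c : ℤ) (hxy : x ≠ y) (h : P.rel (bR x) (bR y))
    (hB' : ∀ r v, B' r v = if r = x then B x v + c * B y v else B r v) :
    BlockEquiv P bR bC 1 1 B B' := by
  refine ⟨_, 1, BlockGL.transvection hxy h c, BlockGL.one, ?_⟩
  ext r v
  rw [Matrix.mul_one, hB']
  split_ifs with hr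
  · rw [hr, Matrix.transvection_mul_apply_same]
  · rw [Matrix.transvection_mul_apply_of_ne _ _ _ _ hr]

theorem BlockEquiv.col (B : Matrix R C ℤ) (x y : C) (c : ℤ) (hxy : x ≠ y) (h : P.rel (bC x) (bC y))
    (hB' : ∀ r v, B' r v = if v = y then B r y + c * B r x else B r v) :
    BlockEquiv P bR bC 1 1 B B' := by
  refine ⟨1, _, BlockGL.one, BlockGL.transvection hxy h c, ?_⟩
  ext r v
  rw [Matrix.one_mul, hB']
  split_ifs with hr
  · rw [hr, Matrix.mul_transvection_apply_same]
  · rw [Matrix.mul_transvection_apply_of_ne _ _ _ _ hr]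

/-- This is where signs are absorbed: choosing `u` and `v` equal to the determinants in block `i`
makes both of them `1`, at the cost of changing the corner entry by `u * v`. -/
theorem BlockEquiv.sum_one (h : BlockEquiv P bR bC δ δ' B B') (i : Fin N) {u v : ℤ} (hu : u * u = 1)
    (hv : v * v = 1) (d : ℤ) :
    BlockEquiv P (addIdx bR i) (addIdx bC i) (fun j => if j = i then δ j * u else δ j)
      (fun j => if j = i then δ' j * v else δ' j) (sumOne B d) (sumOne B' (u * d * v)) := by
  obtain ⟨U, V, hU, hV, rfl⟩ := h
  exact ⟨_, _, hU.sum_one i hu, hV.sum_one i hv, by rw [sumOne_mul, sumOne_mul]⟩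

theorem BlockEquiv.sum_one_same (h : BlockEquiv P bR bC 1 1 B B') (i : Fin N) (d : ℤ) :
    BlockEquiv P (addIdx bR i) (addIdx bC i) 1 1 (sumOne B d) (sumOne B' d) := by
  convert h.sum_one i (u := 1) (v := 1) rfl rfl d using 1
  · ext j; simp
  · ext j; simp
  · simp

end BlockEquiv

/-! ### Entries `1` in the Smith normal form -/

theorem SmithHasTwoOnes.mul {p q : ℕ} {B : Matrix (Fin p) (Fin q) ℤ} (h : SmithHasTwoOnes B)
    (U : GL (Fin p) ℤ) (V : GL (Fin q) ℤ) :
    SmithHasTwoOnes ((U : Matrix (Fin p) (Fin p) ℤ) * B * (V : Matrix (Fin q) (Fin q) ℤ)) := by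
  obtain ⟨U₀, V₀, D, h1, h2, h3⟩ := h
  refine ⟨U₀ * U⁻¹, V⁻¹ * V₀, D, ?_, h2, h3⟩
  rw [← h1]
  have hU : ((U⁻¹ : GL (Fin p) ℤ) : Matrix (Fin p) (Fin p) ℤ) * U = 1 := U.inv_mul
  have hV : (V : Matrix (Fin q) (Fin q) ℤ) * ((V⁻¹ : GL (Fin q) ℤ) : Matrix (Fin q) (Fin q) ℤ) = 1 :=
    V.mul_inv
  rw [Units.val_mul, Units.val_mul]
  simp only [Matrix.mul_assoc]
  rw [← Matrix.mul_assoc (V : Matrix (Fin q) (Fin q) ℤ), hV, Matrix.one_mul,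
    ← Matrix.mul_assoc _ (U : Matrix (Fin p) (Fin p) ℤ), hU, Matrix.one_mul]

/-- A matrix over arbitrary finite index types has two entries `1` in its Smith normal form. -/
def TwoOnes {X Y : Type} (M : Matrix X Y ℤ) : Prop :=
  ∃ (p q : ℕ) (e : Fin p ≃ X) (f : Fin q ≃ Y), SmithHasTwoOnes (M.submatrix e f)

theorem TwoOnes.submatrix {X Y X' Y' : Type} {M : Matrix X Y ℤ} (h : TwoOnes M) (e : X' ≃ X)
    (f : Y' ≃ Y) : TwoOnes (M.submatrix e f) := by
  obtain ⟨p, q, e', f', h⟩ := h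
  refine ⟨p, q, e'.trans e.symm, f'.trans f.symm, ?_⟩
  convert h using 1
  ext i j
  simp

theorem TwoOnes.mul {X Y : Type} [Fintype X] [DecidableEq X] [Fintype Y] [DecidableEq Y]
    {M : Matrix X Y ℤ} (h : TwoOnes M) {U U' : Matrix X X ℤ} {V V' : Matrix Y Y ℤ}
    (h1 : U * U' = 1) (h2 : U' * U = 1) (h3 : V * V' = 1) (h4 : V' * V = 1) : TwoOnes (U * M * V) := by
  obtain ⟨p, q, e, f, h⟩ := h
  refine ⟨p, q, e, f, ?_⟩
  let U₀ : GL (Fin p) ℤ := ⟨U.submatrix e e, U'.submatrix e e,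
    by rw [Matrix.submatrix_mul_equiv, h1, Matrix.submatrix_one_equiv],
    by rw [Matrix.submatrix_mul_equiv, h2, Matrix.submatrix_one_equiv]⟩
  let V₀ : GL (Fin q) ℤ := ⟨V.submatrix f f, V'.submatrix f f,
    by rw [Matrix.submatrix_mul_equiv, h3, Matrix.submatrix_one_equiv],
    by rw [Matrix.submatrix_mul_equiv, h4, Matrix.submatrix_one_equiv]⟩
  have := h.mul U₀ V₀
  simpa only [U₀, V₀, Matrix.submatrix_mul_equiv] using this

/-- Reindexing rows and columns amounts to multiplication by permutation matrices, which are in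
`GL`. -/
theorem TwoOnes.smithHasTwoOnes {p q : ℕ} {M : Matrix (Fin p) (Fin q) ℤ} (h : TwoOnes M) :
    SmithHasTwoOnes M := by
  obtain ⟨p', q', e, f, h⟩ := h
  obtain rfl : p' = p := by simpa using Fintype.card_congr e
  obtain rfl : q' = q := by simpa using Fintype.card_congr f
  let perm : ∀ {n : ℕ} (g : Fin n ≃ Fin n), GL (Fin n) ℤ := fun {n} g =>
    ⟨(1 : Matrix (Fin n) (Fin n) ℤ).submatrix g id, (1 : Matrix (Fin n) (Fin n) ℤ).submatrix id g, by
      rw [← Matrix.submatrix_mul _ _ _ _ _ Function.bijective_id, Matrix.mul_one,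
        Matrix.submatrix_one_equiv], by
      rw [Matrix.submatrix_mul_equiv, Matrix.mul_one, Matrix.submatrix_one _ Function.injective_id]⟩
  have := h.mul (perm e)⁻¹ (perm f)
  convert this
  change M = (1 : Matrix (Fin p') (Fin p') ℤ).submatrix id e * M.submatrix e f *
    (1 : Matrix (Fin q') (Fin q') ℤ).submatrix f id
  rw [Matrix.submatrix_mul_equiv, Matrix.submatrix_mul_equiv, Matrix.one_mul, Matrix.mul_one,
    Matrix.submatrix_id_id]

/-- `Fin (p + 1)` as `Fin p` with a new first element. -/
def finSumUnit (p : ℕ) : Fin (p + 1) ≃ Fin p ⊕ Unit where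
  toFun := Fin.cases (Sum.inr ()) Sum.inl
  invFun := Sum.elim Fin.succ fun _ => 0
  left_inv i := by refine Fin.cases ?_ (fun j => ?_) i <;> rfl
  right_inv := by rintro (i | i) <;> rfl

/-- The left factor `u` normalises the new entry to `1`. Placed first on the diagonal it divides all
later entries, so the enlarged matrix is again in Smith form, with no fewer ones. -/
theorem TwoOnes.sum_one {X Y : Type} {M : Matrix X Y ℤ} (h : TwoOnes M) {u : ℤ} (hu : u * u = 1) :
    TwoOnes (sumOne M u) := by
  obtain ⟨p, q, e, f, U, V, D, h1, h2, h3⟩ := h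
  refine ⟨p + 1, q + 1, (finSumUnit p).trans (e.sumCongr (Equiv.refl Unit)),
    (finSumUnit q).trans (f.sumCongr (Equiv.refl Unit)), ?_⟩
  let σ := finSumUnit p
  let τ := finSumUnit q
  let U' : GL (Fin (p + 1)) ℤ := ⟨(sumOne (U : Matrix (Fin p) (Fin p) ℤ) u).submatrix σ σ,
    (sumOne ((U⁻¹ : GL (Fin p) ℤ) : Matrix (Fin p) (Fin p) ℤ) u).submatrix σ σ, by
      rw [Matrix.submatrix_mul_equiv, sumOne_mul, hu, U.mul_inv, sumOne_one,
        Matrix.submatrix_one_equiv], by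
      rw [Matrix.submatrix_mul_equiv, sumOne_mul, hu, U.inv_mul, sumOne_one,
        Matrix.submatrix_one_equiv]⟩
  let V' : GL (Fin (q + 1)) ℤ := ⟨(sumOne (V : Matrix (Fin q) (Fin q) ℤ) 1).submatrix τ τ,
    (sumOne ((V⁻¹ : GL (Fin q) ℤ) : Matrix (Fin q) (Fin q) ℤ) 1).submatrix τ τ, by
      rw [Matrix.submatrix_mul_equiv, sumOne_mul, one_mul, V.mul_inv, sumOne_one,
        Matrix.submatrix_one_equiv], by
      rw [Matrix.submatrix_mul_equiv, sumOne_mul, one_mul, V.inv_mul, sumOne_one,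
        Matrix.submatrix_one_equiv]⟩
  refine ⟨U', V', (sumOne D 1).submatrix σ τ, ?_, ⟨?_, ?_, ?_⟩, ?_⟩
  · have : (sumOne M u).submatrix ((finSumUnit p).trans (e.sumCongr (Equiv.refl Unit)))
        ((finSumUnit q).trans (f.sumCongr (Equiv.refl Unit))) =
        (sumOne (M.submatrix e f) u).submatrix σ τ := by
      ext i j
      refine Fin.cases ?_ (fun i => ?_) i <;> refine Fin.cases ?_ (fun j => ?_) j <;> rfl
    rw [this]
    change (sumOne (U : Matrix (Fin p) (Fin p) ℤ) u).submatrix σ σ * _ *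
      (sumOne (V : Matrix (Fin q) (Fin q) ℤ) 1).submatrix τ τ = _
    rw [Matrix.submatrix_mul_equiv, Matrix.submatrix_mul_equiv, sumOne_mul, sumOne_mul, h1, hu,
      one_mul]
  · intro a b
    refine Fin.cases ?_ (fun a => ?_) a <;> refine Fin.cases ?_ (fun b => ?_) b
    · simp
    · intro _; rfl
    · intro _; rfl
    · intro h; exact h2.offDiag a b (by simpa using h)
  · intro a b
    refine Fin.cases ?_ (fun a => ?_) a <;> refine Fin.cases ?_ (fun b => ?_) b
    · intro _; exact zero_le_one
    · intro _; exact le_rfl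
    · intro _; exact le_rfl
    · intro h; exact h2.nonneg a b (by simpa using h)
  · intro a a' b b'
    refine Fin.cases ?_ (fun a => ?_) a <;> refine Fin.cases ?_ (fun b => ?_) b
    · intro _ _ _; exact one_dvd _
    · intro h; simp at h
    · intro h; simp at h
    · refine Fin.cases ?_ (fun a' => ?_) a' <;> refine Fin.cases ?_ (fun b' => ?_) b'
      · intro _ _ h; exact absurd h (by simp)
      · intro _ h; simp at h
      · intro _ h; simp at h
      · intro h h' h''
        exact h2.dvd a a' b b' (by simpa using h) (by simpa using h') (by simpa using h'')
  · refine h3.trans ?_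
    have hinj : Function.Injective (Prod.map (Fin.succ (n := p)) (Fin.succ (n := q))) :=
      (Fin.succ_injective p).prodMap (Fin.succ_injective q)
    rw [← Set.ncard_image_of_injective _ hinj]
    refine Set.ncard_le_ncard ?_ (Set.toFinite _)
    rintro _ ⟨x, hx, rfl⟩
    exact hx

section

variable {N : ℕ} {P : BlockOrder N} {R C : Type} {bR : R → Fin N} {bC : C → Fin N} {B B' : Matrix R C ℤ}

/-- All diagonal blocks with at least one row have two entries `1` in their Smith normal form. -/
def SmithBlocks (bR : R → Fin N) (bC : C → Fin N) (B : Matrix R C ℤ) : Prop :=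
  ∀ r, TwoOnes (diagBlock bR bC B (bR r))

theorem SmithBlocks.blockEquiv [Fintype R] [DecidableEq R] [Fintype C] [DecidableEq C]
    (h : SmithBlocks bR bC B) (hB : BlockTri P bR bC B) {δ δ' : Fin N → ℤ}
    (he : BlockEquiv P bR bC δ δ' B B') : SmithBlocks bR bC B' := by
  obtain ⟨U, V, hU, hV, rfl⟩ := he
  intro r
  obtain ⟨U', hU', h1, h2⟩ := hU.inv
  obtain ⟨V', hV', h3, h4⟩ := hV.inv
  rw [diagBlock_mul (hU.tri.mul hB) hV.tri, diagBlock_mul hU.tri hB]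
  exact (h r).mul (diagBlock_mul_inv hU.tri hU' h1 _) (diagBlock_mul_inv hU' hU.tri h2 _)
    (diagBlock_mul_inv hV.tri hV' h3 _) (diagBlock_mul_inv hV' hV.tri h4 _)

theorem SmithBlocks.sum_one (h : SmithBlocks bR bC B) (r₀ : R) {u : ℤ} (hu : u * u = 1) :
    SmithBlocks (addIdx bR (bR r₀)) (addIdx bC (bR r₀)) (sumOne B u) := by
  have key : ∀ r : R, TwoOnes (diagBlock (addIdx bR (bR r₀)) (addIdx bC (bR r₀)) (sumOne B u) (bR r)) := by
    intro r
    rw [diagBlock_sumOne]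
    refine TwoOnes.submatrix ?_ _ _
    by_cases hr : bR r₀ = bR r
    · let g : {_x : Unit // bR r₀ = bR r} ≃ Unit :=
        ⟨fun _ => (), fun _ => ⟨(), hr⟩, fun _ => rfl, fun _ => rfl⟩
      convert ((h r).sum_one hu).submatrix ((Equiv.refl _).sumCongr g) ((Equiv.refl _).sumCongr g) using 1
      ext (i | i) (j | j) <;> rfl
    · have : IsEmpty {_x : Unit // bR r₀ = bR r} := ⟨fun x => hr x.2⟩
      convert (h r).submatrix (Equiv.sumEmpty _ {_x : Unit // bR r₀ = bR r})
        (Equiv.sumEmpty _ {_x : Unit // bR r₀ = bR r}) using 1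
      ext (i | i) (j | j)
      · rfl
      · exact isEmptyElim j
      · exact isEmptyElim i
      · exact isEmptyElim i
  rintro (r | r)
  · exact key r
  · exact key r₀

end

open DirGraph

/-! ### Canonical adjacency matrices -/

open Classical in
/-- The matrix `B•` of the graph with adjacency matrix `A`, where `ι` lists the regular vertices. -/
noncomputable def adjB {V R : Type} (ι : R → V) (A : V → V → ℕ∞) : Matrix R V ℤ :=
  fun r v => ((A (ι r) v).toNat : ℤ) - if ι r = v then 1 else 0

/-- Canonical form of an adjacency matrix, except for the condition on Smith normal forms. Here `ι`
lists the regular vertices and `b` is the block map. -/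
structure PreCanon {N : ℕ} (P : BlockOrder N) {V R : Type} (b : V → Fin N) (ι : R → V)
    (A : V → V → ℕ∞) : Prop where
  inj : Function.Injective ι
  ne_top : ∀ r v, A (ι r) v ≠ ⊤
  ne_zero_iff : ∀ r v, A (ι r) v ≠ 0 ↔ P.rel (b (ι r)) (b v)
  two_le : ∀ r, 2 ≤ A (ι r) (ι r)
  -- A singular vertex emits infinitely many edges to whatever it reaches. It reaches itself by a
  -- cycle exactly when its block has a regular vertex; otherwise its block is a single vertex
  -- without a loop.
  eq_top : ∀ v ∉ Set.range ι, ∀ w, P.rel (b v) (b w) → (v ≠ w ∨ ∃ r, b (ι r) = b v) → A v w = ⊤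
  eq_zero : ∀ v ∉ Set.range ι, ∀ w, ¬ P.rel (b v) (b w) → A v w = 0
  no_loop : ∀ v, (∀ r, b (ι r) ≠ b v) → A v v = 0
  size : ∀ i, 3 ≤ Nat.card {r // b (ι r) = i} ∨ ((∃! v, b v = i) ∧ ∀ r, b (ι r) ≠ i)

section PreCanon

variable {N : ℕ} {P : BlockOrder N} {V R : Type} {b : V → Fin N} {ι : R → V} {A : V → V → ℕ∞}

theorem PreCanon.blockTri (h : PreCanon P b ι A) : BlockTri P (fun r => b (ι r)) b (adjB ι A) := by
  intro r v hrv
  rw [← h.ne_zero_iff r v]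
  intro h0
  by_cases hv : ι r = v
  · subst hv
    exact absurd ((h.two_le r).trans_eq h0) (by norm_num)
  · simp [adjB, h0, hv] at hrv

/-- A regular vertex is added to the block of `ι r₀`. A singular vertex emits to it as it does to `ι
r₀`, so the conditions on singular rows are inherited, and only the regular rows need to be checked.
-/
theorem PreCanon.bordered [Finite R] (h : PreCanon P b ι A) (r₀ : R) {A' : V → V → ℕ∞}
    {c d : V → ℕ∞} {z : ℕ∞}
    (hA : ∀ x ∉ Set.range ι, ∀ y, A' x y = A x y)
    (hc : ∀ x ∉ Set.range ι, c x = A x (ι r₀))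
    (hA' : ∀ r y, A' (ι r) y ≠ ⊤ ∧ (A' (ι r) y ≠ 0 ↔ P.rel (b (ι r)) (b y)))
    (hA'' : ∀ r, 2 ≤ A' (ι r) (ι r))
    (hc' : ∀ r, c (ι r) ≠ ⊤ ∧ (c (ι r) ≠ 0 ↔ P.rel (b (ι r)) (b (ι r₀))))
    (hd : ∀ y, d y ≠ ⊤ ∧ (d y ≠ 0 ↔ P.rel (b (ι r₀)) (b y)))
    (hz : z ≠ ⊤) (hz' : 2 ≤ z) :
    PreCanon P (addIdx b (b (ι r₀))) (Sum.map ι id : R ⊕ Unit → V ⊕ Unit) (bordered A' c d z) := by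
  have hrange : ∀ {x}, (Sum.inl x : V ⊕ Unit) ∉ Set.range (Sum.map ι id : R ⊕ Unit → V ⊕ Unit) →
      x ∉ Set.range ι := by
    rintro _ hx ⟨r, rfl⟩
    exact hx ⟨Sum.inl r, rfl⟩
  have hblock : ∀ {x}, (∃ r, addIdx b (b (ι r₀)) (Sum.map ι id r) = b x) → ∃ r, b (ι r) = b x := by
    rintro x ⟨r | r, hr⟩
    · exact ⟨r, hr⟩
    · exact ⟨r₀, hr⟩
  have hunit : ∀ {u : Unit}, (Sum.inr u : V ⊕ Unit) ∈ Set.range (Sum.map ι id : R ⊕ Unit → V ⊕ Unit) :=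
    fun {u} => ⟨Sum.inr u, rfl⟩
  refine ⟨?_, ?_, ?_, ?_, ?_, ?_, ?_, ?_⟩
  · exact Sum.map_injective.2 ⟨h.inj, Function.injective_id⟩
  · rintro (r | r) (v | v)
    · exact (hA' r v).1
    · exact (hc' r).1
    · exact (hd v).1
    · exact hz
  · rintro (r | r) (v | v)
    · exact (hA' r v).2
    · exact (hc' r).2
    · exact (hd v).2
    · refine iff_of_true ?_ (P.refl _)
      rintro rfl
      exact absurd hz' (by norm_num)
  · rintro (r | r)
    · exact hA'' r
    · exact hz'
  · rintro (x | x) hx (y | y) hxy hex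
    · refine (hA x (hrange hx) y).trans (h.eq_top x (hrange hx) y hxy ?_)
      exact hex.imp (fun hne h => hne (congrArg Sum.inl h)) hblock
    · refine (hc x (hrange hx)).trans (h.eq_top x (hrange hx) _ hxy (Or.inl ?_))
      rintro rfl
      exact hrange hx ⟨r₀, rfl⟩
    · exact absurd hunit hx
    · exact absurd hunit hx
  · rintro (x | x) hx (y | y) hxy
    · exact (hA x (hrange hx) y).trans (h.eq_zero x (hrange hx) y hxy)
    · exact (hc x (hrange hx)).trans (h.eq_zero x (hrange hx) _ hxy)
    · exact absurd hunit hx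
    · exact absurd hunit hx
  · rintro (x | x) hx
    · have hx' : x ∉ Set.range ι := by
        rintro ⟨r, rfl⟩
        exact hx (Sum.inl r) rfl
      exact (hA x hx' x).trans (h.no_loop x fun r => hx (Sum.inl r))
    · exact absurd rfl (hx (Sum.inr x))
  · intro i
    rcases h.size i with hi | ⟨⟨v, hv, hv'⟩, hi⟩
    · left
      refine hi.trans (Nat.card_le_card_of_injective
        (fun r => ⟨Sum.inl r.1, r.2⟩ : {r // b (ι r) = i} → {r // addIdx b (b (ι r₀)) (Sum.map ι id r) = i}) ?_)
      intro r r' hrr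
      exact Subtype.ext (Sum.inl_injective (congrArg Subtype.val hrr))
    · right
      refine ⟨⟨Sum.inl v, hv, ?_⟩, ?_⟩
      · rintro (x | x) hx
        · exact congrArg Sum.inl (hv' x hx)
        · exact absurd hx (hi r₀)
      · rintro (r | r)
        · exact hi r
        · exact hi r₀

end PreCanon

/-! ### Elementary operations -/

section ops

variable {N : ℕ} {P : BlockOrder N} {R C : Type} [DecidableEq R] [DecidableEq C]
  {bR : R → Fin N} {bC : C → Fin N}

/-- Add `c` times row `y` to row `x`. -/
def rowOp (M : Matrix R C ℤ) (x y : R) (c : ℤ) : Matrix R C ℤ :=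
  fun r v => if r = x then M x v + c * M y v else M r v

/-- Add `c` times column `x` to column `y`. -/
def colOp (M : Matrix R C ℤ) (x y : C) (c : ℤ) : Matrix R C ℤ :=
  fun r v => if v = y then M r y + c * M r x else M r v

variable [Fintype R] [Fintype C]

theorem BlockEquiv.rowOp {M M' : Matrix R C ℤ} (h : BlockEquiv P bR bC 1 1 M M') {x y : R} (c : ℤ)
    (hxy : x ≠ y) (hrel : P.rel (bR x) (bR y)) : BlockEquiv P bR bC 1 1 M (rowOp M' x y c) :=
  h.trans_one (.row M' x y c hxy hrel fun _ _ => rfl)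

theorem BlockEquiv.colOp {M M' : Matrix R C ℤ} (h : BlockEquiv P bR bC 1 1 M M') {x y : C} (c : ℤ)
    (hxy : x ≠ y) (hrel : P.rel (bC x) (bC y)) : BlockEquiv P bR bC 1 1 M (colOp M' x y c) :=
  h.trans_one (.col M' x y c hxy hrel fun _ _ => rfl)

theorem BlockEquiv.refl (M : Matrix R C ℤ) : BlockEquiv P bR bC 1 1 M M :=
  ⟨1, 1, .one, .one, by simp⟩

end ops

theorem toNat_sub_one_add (k l : ℕ) : ((k : ℕ∞) - 1 + l).toNat = k - 1 + l := by
  rw [show (k : ℕ∞) - 1 + l = ((k - 1 + l : ℕ) : ℕ∞) by push_cast; rfl, ENat.toNat_natCast]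

theorem toNat_sub_zero_add (k l : ℕ) : ((k : ℕ∞) - 0 + l).toNat = k + l := by
  rw [show (k : ℕ∞) - 0 + l = ((k + l : ℕ) : ℕ∞) by simp, ENat.toNat_natCast]

section adjB

variable {V R : Type} [DecidableEq V] {ι : R → V} {A : V → V → ℕ∞}

/-- The edge from `ι r` to `ι r'` makes the truncated subtraction in `addRow` exact, so on `B•` it
becomes an honest row addition. -/
theorem adjB_addRow [DecidableEq R] (hι : Function.Injective ι) (hfin : ∀ r v, A (ι r) v ≠ ⊤) {r r' : R}
    (h : A (ι r) (ι r') ≠ 0) :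
    adjB ι (addRow A (ι r) (ι r')) = rowOp (adjB ι A) r r' 1 := by
  ext x v
  by_cases hx : x = r
  · subst hx
    obtain ⟨k, hk⟩ := ENat.ne_top_iff_exists.1 (hfin x v)
    obtain ⟨l, hl⟩ := ENat.ne_top_iff_exists.1 (hfin r' v)
    simp only [adjB, addRow, rowOp, if_true, ← hk, ← hl]
    by_cases hv : v = ι r'
    · subst hv
      have : k ≠ 0 := by rintro rfl; exact h hk.symm
      simp only [if_true, toNat_sub_one_add, ENat.toNat_natCast]
      split_ifs <;> omega
    · simp only [hv, Ne.symm hv, if_false, toNat_sub_zero_add, ENat.toNat_natCast]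
      push_cast
      ring
  · simp [adjB, addRow, rowOp, hx, hι.ne hx]

theorem adjB_addCol (hfin : ∀ r v, A (ι r) v ≠ ⊤) {u v : V} (huv : u ≠ v) (h : A u v ≠ 0) :
    adjB ι (addCol A u v) = colOp (adjB ι A) u v 1 := by
  ext r y
  by_cases hy : y = v
  · subst hy
    obtain ⟨k, hk⟩ := ENat.ne_top_iff_exists.1 (hfin r y)
    obtain ⟨l, hl⟩ := ENat.ne_top_iff_exists.1 (hfin r u)
    simp only [adjB, addCol, colOp, if_true, ← hk, ← hl]
    by_cases hv : ι r = u
    · have : k ≠ 0 := by rintro rfl; exact h (by rw [← hv]; exact hk.symm)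
      have huv' : ι r ≠ y := hv.trans_ne huv
      simp only [hv, huv, if_true, if_false, toNat_sub_one_add, ENat.toNat_natCast]
      omega
    · simp only [hv, if_false, toNat_sub_zero_add, ENat.toNat_natCast]
      push_cast
      ring
  · simp [adjB, addCol, colOp, hy]

end adjB

/-! ### Enlarging a block -/

section enlarge

variable {V R : Type}

/-- Canonical form of an adjacency matrix. -/
structure Canon {N : ℕ} (P : BlockOrder N) {V R : Type} (b : V → Fin N) (ι : R → V)
    (A : V → V → ℕ∞) : Prop extends PreCanon P b ι A where
  smith : SmithBlocks (fun r => b (ι r)) b (adjB ι A)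

open Classical in
/-- The outsplit graph at `w` in which the new vertex takes over one loop. -/
noncomputable def splitLoopAdj (A : V → V → ℕ∞) (w : V) : V ⊕ Unit → V ⊕ Unit → ℕ∞ :=
  bordered (fun x y => A x y - if x = w ∧ y = w then 1 else 0)
    (fun x => A x w - if x = w then 1 else 0) (Pi.single w 1) 1

theorem splitLoop_equiv [Finite V] (A : V → V → ℕ∞) (w : V) (hw : 2 ≤ A w w) :
    MovePrimeEquiv (ofAdj V A) (ofAdj (V ⊕ Unit) (splitLoopAdj A w)) := by
  classical
  have h1 : 1 ≤ A w w := le_trans (by norm_num) hw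
  have h2 : A w w - 1 ≠ 0 := by
    rw [Ne, tsub_eq_zero_iff_le, not_le]
    exact lt_of_lt_of_le (by norm_num) hw
  refine outsplit A w (Pi.single w 1) ?_ ?_ ⟨w, by simp⟩ ⟨w, by simpa using h2⟩ _ ?_ ?_ ?_ ?_ ?_
  · intro y
    by_cases hy : y = w
    · subst hy; simpa using h1
    · simp [hy]
  · intro y
    by_cases hy : y = w <;> simp [hy]
  · intro x y hx; simp [splitLoopAdj, bordered, hx]
  · intro y; simp [splitLoopAdj, bordered, Pi.single_apply]
  · intro x; simp [splitLoopAdj, bordered]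
  · intro y; simp [splitLoopAdj, bordered]
  · simp [splitLoopAdj, bordered]

variable {N : ℕ} {P : BlockOrder N} [Fintype V] [DecidableEq V] [Fintype R] [DecidableEq R]
  {b : V → Fin N} {ι : R → V} {A : V → V → ℕ∞}

theorem adjB_splitLoop (hι : Function.Injective ι) (hfin : ∀ r v, A (ι r) v ≠ ⊤) (r₀ : R)
    (hw : 2 ≤ A (ι r₀) (ι r₀)) :
    BlockEquiv P (addIdx (fun r => b (ι r)) (b (ι r₀))) (addIdx b (b (ι r₀))) 1 1
      (adjB (Sum.map ι id) (splitLoopAdj A (ι r₀))) (sumOne (adjB ι A) (-1)) := by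
  have h : BlockEquiv P (addIdx (fun r => b (ι r)) (b (ι r₀))) (addIdx b (b (ι r₀))) 1 1
      (adjB (Sum.map ι id) (splitLoopAdj A (ι r₀))) _ :=
    -- The matrix of the split graph is `[[B - E, Bε], [εᵀ, 0]]`, with `ε` the unit vector at `w`
    -- and `E` the matrix unit at `(w, w)`. Subtracting column `w` from the new column gives `[[B -
    -- E, ε], [εᵀ, -1]]`. Adding the new row to row `w` and then the new column to column `w` clears
    -- the borders.
    (((BlockEquiv.refl (adjB (Sum.map ι id) (splitLoopAdj A (ι r₀)))).colOp (-1)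
    (x := Sum.inl (ι r₀)) (y := Sum.inr ()) Sum.inl_ne_inr (by exact P.refl _)).rowOp 1
    (x := Sum.inl r₀) (y := Sum.inr ()) Sum.inl_ne_inr (by exact P.refl _)).colOp 1
    (x := Sum.inr ()) (y := Sum.inl (ι r₀)) Sum.inr_ne_inl (by exact P.refl _)
  convert h using 1
  obtain ⟨k, hk⟩ := ENat.ne_top_iff_exists.1 (hfin r₀ (ι r₀))
  rw [← hk] at hw
  have hk2 : 2 ≤ k := by exact_mod_cast hw
  have hsub : ((k : ℕ∞) - 1).toNat = k - 1 := by
    rw [show (k : ℕ∞) - 1 = ((k - 1 : ℕ) : ℕ∞) by push_cast; rfl, ENat.toNat_natCast]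
  ext (r | r) (v | v)
  · by_cases hr : r = r₀
    · subst hr
      by_cases hv : v = ι r
      · subst hv
        simp [sumOne, colOp, rowOp, adjB, splitLoopAdj, bordered, ← hk, hsub]
        omega
      · simp [sumOne, colOp, rowOp, adjB, splitLoopAdj, bordered, hv]
    · by_cases hv : v = ι r₀
      · subst hv
        simp [sumOne, colOp, rowOp, adjB, splitLoopAdj, bordered, hr, hι.ne hr]
      · simp [sumOne, colOp, rowOp, adjB, splitLoopAdj, bordered, hr, hι.ne hr, hv]
  · by_cases hr : r = r₀
    · subst hr
      simp [sumOne, colOp, rowOp, adjB, splitLoopAdj, bordered, ← hk, hsub]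
    · simp [sumOne, colOp, rowOp, adjB, splitLoopAdj, bordered, hr, hι.ne hr]
  · by_cases hv : v = ι r₀
    · subst hv
      simp [sumOne, colOp, rowOp, adjB, splitLoopAdj, bordered]
    · simp [sumOne, colOp, rowOp, adjB, splitLoopAdj, bordered, hv]
  · simp [sumOne, colOp, rowOp, adjB, splitLoopAdj, bordered]

theorem adjB_splice (hι : Function.Injective ι) (r₀ : R) :
    BlockEquiv P (addIdx (addIdx (fun r => b (ι r)) (b (ι r₀))) (b (ι r₀)))
      (addIdx (addIdx b (b (ι r₀))) (b (ι r₀))) 1 1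
      (adjB (Sum.map (Sum.map ι id) id) (spliceAdj A (ι r₀)))
      (sumOne (sumOne (adjB ι A) 1) (-1)) := by
  have h : BlockEquiv P (addIdx (addIdx (fun r => b (ι r)) (b (ι r₀))) (b (ι r₀)))
      (addIdx (addIdx b (b (ι r₀))) (b (ι r₀))) 1 1
      (adjB (Sum.map (Sum.map ι id) id) (spliceAdj A (ι r₀))) _ :=
    -- The spliced matrix is `[[B, ε, 0], [εᵀ, 0, 1], [0, 1, 0]]`. The first two operations use the
    -- last row and column to remove `ε` and `εᵀ`. The other three turn the swap `[[0, 1], [1, 0]]`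
    -- into `diag(1, -1)`.
    (((((BlockEquiv.refl (adjB (Sum.map (Sum.map ι id) id) (spliceAdj A (ι r₀)))).rowOp (-1)
    (x := Sum.inl (Sum.inl r₀)) (y := Sum.inr ()) Sum.inl_ne_inr (by exact P.refl _)).colOp (-1)
    (x := Sum.inr ()) (y := Sum.inl (Sum.inl (ι r₀))) Sum.inr_ne_inl (by exact P.refl _)).rowOp 1
    (x := Sum.inl (Sum.inr ())) (y := Sum.inr ()) Sum.inl_ne_inr (by exact P.refl _)).rowOp (-1)
    (x := Sum.inr ()) (y := Sum.inl (Sum.inr ())) Sum.inr_ne_inl (by exact P.refl _)).rowOp 1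
    (x := Sum.inl (Sum.inr ())) (y := Sum.inr ()) Sum.inl_ne_inr (by exact P.refl _)
  convert h using 1
  ext ((r | r) | r) ((v | v) | v)
  · by_cases hr : r = r₀ <;> by_cases hv : v = ι r₀ <;>
      simp [sumOne, colOp, rowOp, adjB, spliceAdj, bordered, hr, hv, hι.eq_iff]
  · by_cases hr : r = r₀ <;>
      simp [sumOne, colOp, rowOp, adjB, spliceAdj, bordered, hr, hι.eq_iff]
  · by_cases hr : r = r₀ <;>
      simp [sumOne, colOp, rowOp, adjB, spliceAdj, bordered, hr]
  · by_cases hv : v = ι r₀ <;>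
      simp [sumOne, colOp, rowOp, adjB, spliceAdj, bordered, hv]
  · simp [sumOne, colOp, rowOp, adjB, spliceAdj, bordered]
  · simp [sumOne, colOp, rowOp, adjB, spliceAdj, bordered]
  · by_cases hv : v = ι r₀ <;>
      simp [sumOne, colOp, rowOp, adjB, spliceAdj, bordered, hv]
  · simp [sumOne, colOp, rowOp, adjB, spliceAdj, bordered]
  · simp [sumOne, colOp, rowOp, adjB, spliceAdj, bordered]

end enlarge

/-! ### Canonical enlargements by an outsplit and by a Cuntz splice -/

section enlarge

variable {V R : Type} {N : ℕ} {P : BlockOrder N} {b : V → Fin N} {ι : R → V} {A : V → V → ℕ∞}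

theorem enat_add_ne_top {a b : ℕ∞} (h : a ≠ ⊤ ∧ b ≠ ⊤) : a + b ≠ ⊤ := by
  simpa [ENat.add_eq_top] using h

theorem addRow_ne_top (hfin : ∀ r v, A (ι r) v ≠ ⊤) (r₁ r₂ : R) (r : R) (v : V) :
    addRow A (ι r₁) (ι r₂) (ι r) v ≠ ⊤ := by
  classical
  simp only [addRow]
  split_ifs
  · exact enat_add_ne_top ⟨ne_top_of_le_ne_top (hfin _ _) tsub_le_self, hfin _ _⟩
  · exact enat_add_ne_top ⟨ne_top_of_le_ne_top (hfin _ _) tsub_le_self, hfin _ _⟩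
  · exact hfin r v

theorem addCol_ne_top (hfin : ∀ r v, A (ι r) v ≠ ⊤) (u w : V) (r : R) (v : V) :
    addCol A u w (ι r) v ≠ ⊤ := by
  classical
  simp only [addCol]
  split_ifs
  · exact enat_add_ne_top ⟨ne_top_of_le_ne_top (hfin _ _) tsub_le_self, hfin _ _⟩
  · exact enat_add_ne_top ⟨ne_top_of_le_ne_top (hfin _ _) tsub_le_self, hfin _ _⟩
  · exact hfin r v

/-- After the split, the new vertex emits only to `w` and itself, and `w` may be left with one loop.
Adding row `w` to the new row and then the new row to row `w` restores positivity of `B•`; the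
closed form makes this visible. -/
theorem addRow_splitLoopAdj [DecidableEq V] (A : V → V → ℕ∞) (w : V) (h2 : 2 ≤ A w w) (hw : A w w ≠ ⊤) :
    addRow (addRow (splitLoopAdj A w) (Sum.inr ()) (Sum.inl w)) (Sum.inl w) (Sum.inr ()) =
      bordered
        (fun x y => if x = w then (A w y - if y = w then 1 else 0) + (A w y - if y = w then 1 else 0)
          else A x y)
        (fun x => if x = w then (A w w - 1) + (A w w - 1) else A x w)
        (fun y => A w y - if y = w then 1 else 0) (A w w) := by
  obtain ⟨k, hk⟩ := ENat.ne_top_iff_exists.1 hw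
  rw [← hk] at h2
  have hk2 : 2 ≤ k := by exact_mod_cast h2
  have e1 : (1 : ℕ∞) + ((k : ℕ∞) - 1) = k := by
    have : 1 + (k - 1) = k := by omega
    exact_mod_cast congrArg (Nat.cast : ℕ → ℕ∞) this
  have e2 : (k : ℕ∞) - 1 - 1 + k = (k : ℕ∞) - 1 + (k - 1) := by
    have : k - 1 - 1 + k = k - 1 + (k - 1) := by omega
    exact_mod_cast congrArg (Nat.cast : ℕ → ℕ∞) this
  ext (x | x) (y | y)
  · by_cases hx : x = w <;> by_cases hy : y = w <;>
      simp [addRow, splitLoopAdj, bordered, hx, hy]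
  · by_cases hx : x = w
    · simp [addRow, splitLoopAdj, bordered, hx, ← hk, e1, e2]
    · simp [addRow, splitLoopAdj, bordered, hx]
  · by_cases hy : y = w <;> simp [addRow, splitLoopAdj, bordered, hy]
  · simp [addRow, splitLoopAdj, bordered, ← hk, e1]

/-- The additions propagate the row and the column of `w` to the first new vertex and from there to
the second. The new vertices then see the old ones exactly as `w` does, and have additional loops.
-/
theorem addRow_addCol_spliceAdj [DecidableEq V] (A : V → V → ℕ∞) (w : V) (hw : A w w ≠ ⊤) :
    addCol (addCol (addRow (addRow (spliceAdj A w) (Sum.inl (Sum.inr ())) (Sum.inl (Sum.inl w)))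
        (Sum.inr ()) (Sum.inl (Sum.inr ()))) (Sum.inl (Sum.inl w)) (Sum.inl (Sum.inr ())))
        (Sum.inl (Sum.inr ())) (Sum.inr ()) =
      bordered (bordered A (fun x => A x w) (fun y => A w y) (2 + A w w))
        (Sum.elim (fun x => A x w) fun _ => 2 + A w w)
        (Sum.elim (fun y => A w y) fun _ => 2 + A w w) (4 + A w w) := by
  obtain ⟨k, hk⟩ := ENat.ne_top_iff_exists.1 hw
  have e1 : (1 : ℕ∞) + 1 = 2 := by norm_num
  have e3 : (1 : ℕ∞) + 1 + (1 + 1 + k) = 4 + k := by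
    have : 1 + 1 + (1 + 1 + k) = 4 + k := by omega
    exact_mod_cast congrArg (Nat.cast : ℕ → ℕ∞) this
  ext ((x | x) | x) ((y | y) | y)
  · simp [addRow, addCol, spliceAdj, bordered]
  · by_cases hx : x = w <;> simp [addRow, addCol, spliceAdj, bordered, hx]
  · by_cases hx : x = w <;> simp [addRow, addCol, spliceAdj, bordered, hx]
  · by_cases hy : y = w <;> simp [addRow, addCol, spliceAdj, bordered, hy]
  · simp [addRow, addCol, spliceAdj, bordered, ← hk, e1]
  · simp [addRow, addCol, spliceAdj, bordered, ← hk, e1]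
  · by_cases hy : y = w <;> simp [addRow, addCol, spliceAdj, bordered, hy]
  · simp [addRow, addCol, spliceAdj, bordered, ← hk, e1]
  · simp [addRow, addCol, spliceAdj, bordered, ← hk]
    exact e3
variable [Fintype V] [DecidableEq V] [Fintype R] [DecidableEq R]

theorem Canon.exists_enlarge (h : Canon P b ι A) (r₀ : R) : ∃ A' : V ⊕ Unit → V ⊕ Unit → ℕ∞,
    MovePrimeEquiv (ofAdj V A) (ofAdj (V ⊕ Unit) A') ∧
    Canon P (addIdx b (b (ι r₀))) (Sum.map ι id : R ⊕ Unit → V ⊕ Unit) A' ∧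
    BlockEquiv P (addIdx (fun r => b (ι r)) (b (ι r₀))) (addIdx b (b (ι r₀))) 1 1
      (adjB (Sum.map ι id) A') (sumOne (adjB ι A) (-1)) := by
  classical
  have h2 := h.two_le r₀
  have hw := h.ne_top r₀ (ι r₀)
  have hinj : Function.Injective (Sum.map ι id : R ⊕ Unit → V ⊕ Unit) :=
    Sum.map_injective.2 ⟨h.inj, Function.injective_id⟩
  have hsub : ∀ r y, A (ι r) y ≠ 0 → A (ι r) y - (if y = ι r then 1 else 0) ≠ 0 := by
    intro r y hy
    split_ifs with hyr
    · rw [Ne, tsub_eq_zero_iff_le, not_le, hyr]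
      exact lt_of_lt_of_le (by norm_num) (h.two_le r)
    · simpa using hy
  have hsub' : ∀ r y, A (ι r) y - (if y = ι r then 1 else 0) ≠ ⊤ := fun r y =>
    ne_top_of_le_ne_top (h.ne_top r y) tsub_le_self
  have hsubiff : ∀ r y, A (ι r) y - (if y = ι r then 1 else 0) ≠ 0 ↔ P.rel (b (ι r)) (b y) :=
    fun r y => ⟨fun h0 => (h.ne_zero_iff r y).1 fun h1 => h0 (by simp [h1]),
      fun h0 => hsub r y ((h.ne_zero_iff r y).2 h0)⟩
  have hdouble : ∀ a : ℕ∞, a + a ≠ 0 ↔ a ≠ 0 := fun a => by simp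
  set A₀ := splitLoopAdj A (ι r₀) with hA₀
  set A₁ := addRow A₀ (Sum.inr ()) (Sum.inl (ι r₀)) with hA₁
  set A₂ := addRow A₁ (Sum.inl (ι r₀)) (Sum.inr ()) with hA₂
  have hA₂' := addRow_splitLoopAdj A (ι r₀) h2 hw
  rw [← hA₀, ← hA₁, ← hA₂] at hA₂'
  have fin₀ : ∀ r v, A₀ (Sum.map ι id r) v ≠ ⊤ := by
    rintro (r | r) (v | v)
    · exact ne_top_of_le_ne_top (h.ne_top r v) tsub_le_self
    · exact ne_top_of_le_ne_top (h.ne_top r (ι r₀)) tsub_le_self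
    · by_cases hv : v = ι r₀ <;> simp [hA₀, splitLoopAdj, bordered, hv]
    · simp [hA₀, splitLoopAdj, bordered]
  have fin₁ : ∀ r v, A₁ (Sum.map ι id r) v ≠ ⊤ := addRow_ne_top fin₀ (Sum.inr ()) (Sum.inl r₀)
  have ne₀ : A₀ (Sum.inr ()) (Sum.inl (ι r₀)) ≠ 0 := by simp [hA₀, splitLoopAdj, bordered]
  have ne₁ : A₁ (Sum.inl (ι r₀)) (Sum.inr ()) ≠ 0 := by
    simpa [hA₁, hA₀, addRow, splitLoopAdj, bordered] using hsub r₀ (ι r₀) (by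
      intro h0; rw [h0] at h2; exact absurd h2 (by norm_num))
  have hmove : MovePrimeEquiv (ofAdj V A) (ofAdj (V ⊕ Unit) A₂) := by
    refine (splitLoop_equiv A (ι r₀) h2).trans _ _ _ ((addRow_equiv A₀ Sum.inr_ne_inl ne₀
      (fin₀ (Sum.inl r₀)) ?_).trans _ _ _ (addRow_equiv A₁ Sum.inl_ne_inr ne₁ (fin₁ (Sum.inr ())) ?_))
    · simpa [hA₀, splitLoopAdj, bordered] using hsub r₀ (ι r₀) (by
        intro h0; rw [h0] at h2; exact absurd h2 (by norm_num))
    · simp [hA₁, hA₀, addRow, splitLoopAdj, bordered]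
  have hpre : PreCanon P (addIdx b (b (ι r₀))) (Sum.map ι id : R ⊕ Unit → V ⊕ Unit) A₂ := by
    rw [hA₂']
    refine h.toPreCanon.bordered r₀ ?_ ?_ ?_ ?_ ?_ ?_ hw h2
    · intro x hx y
      rw [if_neg fun h0 => hx ⟨r₀, h0.symm⟩]
    · intro x hx
      rw [if_neg fun h0 => hx ⟨r₀, h0.symm⟩]
    · intro r y
      by_cases hr : ι r = ι r₀
      · obtain rfl := h.inj hr
        simp only [if_true]
        refine ⟨enat_add_ne_top ⟨hsub' r y, hsub' r y⟩, ?_⟩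
        rw [← hsubiff r y]
        exact hdouble _
      · simp only [hr, if_false]
        exact ⟨h.ne_top r y, h.ne_zero_iff r y⟩
    · intro r
      split_ifs with hr
      · have h1 : ∀ a : ℕ∞, 2 ≤ a → 2 ≤ a - 1 + (a - 1) := by
          intro a ha
          have : (1 : ℕ∞) ≤ a - 1 := by
            rw [Order.one_le_iff_pos, tsub_pos_iff_lt]
            exact lt_of_lt_of_le (by norm_num) ha
          calc (2 : ℕ∞) = 1 + 1 := by norm_num
            _ ≤ _ := add_le_add this this
        obtain rfl := h.inj hr
        simpa using h1 _ h2
      · exact h.two_le r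
    · intro r
      split_ifs with hr
      · obtain rfl := h.inj hr
        have h1 := hsub' r (ι r)
        have h3 := hsubiff r (ι r)
        rw [if_pos rfl] at h1 h3
        refine ⟨enat_add_ne_top ⟨h1, h1⟩, ?_⟩
        rw [← h3]
        exact hdouble _
      · exact ⟨h.ne_top r _, h.ne_zero_iff r _⟩
    · exact fun y => ⟨hsub' r₀ y, hsubiff r₀ y⟩
  have hB : BlockEquiv P (addIdx (fun r => b (ι r)) (b (ι r₀))) (addIdx b (b (ι r₀))) 1 1
      (adjB (Sum.map ι id) A₂) (sumOne (adjB ι A) (-1)) := by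
    have e₁ : adjB (Sum.map ι id) A₁ = rowOp (adjB (Sum.map ι id) A₀) (Sum.inr ()) (Sum.inl r₀) 1 :=
      adjB_addRow (r := Sum.inr ()) (r' := Sum.inl r₀) hinj fin₀ ne₀
    have e₂ : adjB (Sum.map ι id) A₂ = rowOp (adjB (Sum.map ι id) A₁) (Sum.inl r₀) (Sum.inr ()) 1 :=
      adjB_addRow (r := Sum.inl r₀) (r' := Sum.inr ()) hinj fin₁ ne₁
    refine BlockEquiv.trans_one (BlockEquiv.symm ?_) (adjB_splitLoop h.inj h.ne_top r₀ h2)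
    rw [e₂, e₁]
    exact ((BlockEquiv.refl _).rowOp 1 Sum.inr_ne_inl (P.refl _)).rowOp 1 Sum.inl_ne_inr (P.refl _)
  have hblock : (fun r => addIdx b (b (ι r₀)) (Sum.map ι id r)) =
      addIdx (fun r => b (ι r)) (b (ι r₀)) := by
    ext (r | r) <;> rfl
  refine ⟨A₂, hmove, ⟨hpre, ?_⟩, hB⟩
  rw [hblock]
  -- The Smith condition is checked on the direct sum, where it is inherited from `A`, and carried
  -- back along the equivalence.
  exact (h.smith.sum_one r₀ (u := -1) (by norm_num)).blockEquiv (h.blockTri.sum_one _ _) hB.symm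

theorem Canon.exists_splice (h : Canon P b ι A) (r₀ : R) :
    ∃ A' : (V ⊕ Unit) ⊕ Unit → (V ⊕ Unit) ⊕ Unit → ℕ∞,
    MovePrimeEquiv (ofAdj V A) (ofAdj ((V ⊕ Unit) ⊕ Unit) A') ∧
    Canon P (addIdx (addIdx b (b (ι r₀))) (b (ι r₀)))
      (Sum.map (Sum.map ι id) id : (R ⊕ Unit) ⊕ Unit → (V ⊕ Unit) ⊕ Unit) A' ∧
    BlockEquiv P (addIdx (addIdx (fun r => b (ι r)) (b (ι r₀))) (b (ι r₀)))
      (addIdx (addIdx b (b (ι r₀))) (b (ι r₀))) 1 1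
      (adjB (Sum.map (Sum.map ι id) id) A') (sumOne (sumOne (adjB ι A) 1) (-1)) := by
  classical
  have h2 := h.two_le r₀
  have hw := h.ne_top r₀ (ι r₀)
  have h0 : A (ι r₀) (ι r₀) ≠ 0 := by
    intro h0; rw [h0] at h2; exact absurd h2 (by norm_num)
  let ι' : (R ⊕ Unit) ⊕ Unit → (V ⊕ Unit) ⊕ Unit := Sum.map (Sum.map ι id) id
  have hinj : Function.Injective ι' :=
    Sum.map_injective.2 ⟨Sum.map_injective.2 ⟨h.inj, Function.injective_id⟩, Function.injective_id⟩
  let w : (V ⊕ Unit) ⊕ Unit := Sum.inl (Sum.inl (ι r₀))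
  let p : (V ⊕ Unit) ⊕ Unit := Sum.inl (Sum.inr ())
  let q : (V ⊕ Unit) ⊕ Unit := Sum.inr ()
  have hpw : p ≠ w := by simp [p, w]
  have hqp : q ≠ p := by simp [p, q]
  set A₀ := spliceAdj A (ι r₀) with hA₀
  set A₁ := addRow A₀ p w with hA₁
  set A₂ := addRow A₁ q p with hA₂
  set A₃ := addCol A₂ w p with hA₃
  set A₄ := addCol A₃ p q with hA₄
  have hA₄' := addRow_addCol_spliceAdj A (ι r₀) hw
  change A₄ = _ at hA₄'
  have fin₀ : ∀ r v, A₀ (ι' r) v ≠ ⊤ := by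
    rintro ((r | r) | r) ((v | v) | v)
    · exact h.ne_top r v
    · by_cases hr : ι r = ι r₀ <;> simp [hA₀, ι', spliceAdj, bordered, hr]
    · simp [hA₀, ι', spliceAdj, bordered]
    · by_cases hv : v = ι r₀ <;> simp [hA₀, ι', spliceAdj, bordered, hv]
    · simp [hA₀, ι', spliceAdj, bordered]
    · simp [hA₀, ι', spliceAdj, bordered]
    · simp [hA₀, ι', spliceAdj, bordered]
    · simp [hA₀, ι', spliceAdj, bordered]
    · simp [hA₀, ι', spliceAdj, bordered]
  have fin₁ : ∀ r v, A₁ (ι' r) v ≠ ⊤ := addRow_ne_top fin₀ (Sum.inl (Sum.inr ())) (Sum.inl (Sum.inl r₀))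
  have fin₂ : ∀ r v, A₂ (ι' r) v ≠ ⊤ := addRow_ne_top fin₁ (Sum.inr ()) (Sum.inl (Sum.inr ()))
  have fin₃ : ∀ r v, A₃ (ι' r) v ≠ ⊤ := addCol_ne_top fin₂ _ _
  have ne₀ : A₀ p w ≠ 0 := by simp [hA₀, p, w, spliceAdj, bordered]
  have ne₁ : A₁ q p ≠ 0 := by simp [hA₁, hA₀, p, q, w, addRow, spliceAdj, bordered]
  have ne₂ : A₂ w p ≠ 0 := by simp [hA₂, hA₁, hA₀, p, q, w, addRow, spliceAdj, bordered]
  have ne₃ : A₃ p q ≠ 0 := by simp [hA₃, hA₂, hA₁, hA₀, p, q, w, addRow, addCol, spliceAdj, bordered]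
  have hmove : MovePrimeEquiv (ofAdj V A) (ofAdj ((V ⊕ Unit) ⊕ Unit) A₄) := by
    refine (splice_equiv A (ι r₀) h2 (h.ne_top r₀)).trans _ _ _
      ((addRow_equiv A₀ hpw ne₀ (fin₀ (Sum.inl (Sum.inl r₀))) ?_).trans _ _ _
      ((addRow_equiv A₁ hqp ne₁ (fin₁ (Sum.inl (Sum.inr ()))) ?_).trans _ _ _
      ((addCol_equiv A₂ hpw.symm ne₂ ?_).trans _ _ _ (addCol_equiv A₃ hqp.symm ne₃ ?_))))
    · exact h0
    · simp [hA₁, hA₀, p, w, addRow, spliceAdj, bordered]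
    · simpa [hA₂, hA₁, hA₀, p, q, w, addRow, spliceAdj, bordered] using h0
    · simp [hA₃, hA₂, hA₁, hA₀, p, q, w, addRow, addCol, spliceAdj, bordered]
  have hpre : PreCanon P (addIdx (addIdx b (b (ι r₀))) (b (ι r₀))) ι' A₄ := by
    rw [hA₄']
    have t2 : (2 : ℕ∞) + A (ι r₀) (ι r₀) ≠ ⊤ := enat_add_ne_top ⟨by simp, hw⟩
    have t4 : (4 : ℕ∞) + A (ι r₀) (ι r₀) ≠ ⊤ := enat_add_ne_top ⟨by simp, hw⟩
    have z2 : (2 : ℕ∞) + A (ι r₀) (ι r₀) ≠ 0 := by simp [add_eq_zero]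
    have hpre₁ := h.toPreCanon.bordered r₀ (A' := A) (c := fun x => A x (ι r₀))
      (d := fun y => A (ι r₀) y) (z := 2 + A (ι r₀) (ι r₀)) (fun _ _ _ => rfl) (fun _ _ => rfl)
      (fun r y => ⟨h.ne_top r y, h.ne_zero_iff r y⟩) h.two_le
      (fun r => ⟨h.ne_top r _, h.ne_zero_iff r _⟩) (fun y => ⟨h.ne_top _ y, h.ne_zero_iff _ y⟩)
      t2 le_self_add
    refine hpre₁.bordered (Sum.inl r₀) (fun _ _ _ => rfl) ?_
      (fun r y => ⟨hpre₁.ne_top r y, hpre₁.ne_zero_iff r y⟩) hpre₁.two_le ?_ ?_ t4 ?_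
    · rintro (x | x) hx
      · rfl
      · exact absurd ⟨Sum.inr x, rfl⟩ hx
    · rintro (r | r)
      · exact ⟨h.ne_top r _, h.ne_zero_iff r _⟩
      · exact ⟨t2, iff_of_true z2 (P.refl _)⟩
    · rintro (y | y)
      · exact ⟨h.ne_top _ y, h.ne_zero_iff _ y⟩
      · exact ⟨t2, iff_of_true z2 (P.refl _)⟩
    · exact le_trans (by norm_num) (le_self_add : (4 : ℕ∞) ≤ _)
  have hB : BlockEquiv P (addIdx (addIdx (fun r => b (ι r)) (b (ι r₀))) (b (ι r₀)))
      (addIdx (addIdx b (b (ι r₀))) (b (ι r₀))) 1 1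
      (adjB ι' A₄) (sumOne (sumOne (adjB ι A) 1) (-1)) := by
    have e₁ : adjB ι' A₁ = rowOp (adjB ι' A₀) (Sum.inl (Sum.inr ())) (Sum.inl (Sum.inl r₀)) 1 :=
      adjB_addRow (r := Sum.inl (Sum.inr ())) (r' := Sum.inl (Sum.inl r₀)) hinj fin₀ ne₀
    have e₂ : adjB ι' A₂ = rowOp (adjB ι' A₁) (Sum.inr ()) (Sum.inl (Sum.inr ())) 1 :=
      adjB_addRow (r := Sum.inr ()) (r' := Sum.inl (Sum.inr ())) hinj fin₁ ne₁
    have e₃ : adjB ι' A₃ = colOp (adjB ι' A₂) w p 1 := adjB_addCol fin₂ hpw.symm ne₂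
    have e₄ : adjB ι' A₄ = colOp (adjB ι' A₃) p q 1 := adjB_addCol fin₃ hqp.symm ne₃
    have g₁ : BlockEquiv P (addIdx (addIdx (fun r => b (ι r)) (b (ι r₀))) (b (ι r₀)))
        (addIdx (addIdx b (b (ι r₀))) (b (ι r₀))) 1 1 (adjB ι' A₀) (adjB ι' A₁) :=
      e₁ ▸ (BlockEquiv.refl (adjB ι' A₀)).rowOp 1 (x := Sum.inl (Sum.inr ())) (y := Sum.inl (Sum.inl r₀))
        (by simp) (P.refl (b (ι r₀)))
    have g₂ : BlockEquiv P (addIdx (addIdx (fun r => b (ι r)) (b (ι r₀))) (b (ι r₀)))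
        (addIdx (addIdx b (b (ι r₀))) (b (ι r₀))) 1 1 (adjB ι' A₁) (adjB ι' A₂) :=
      e₂ ▸ (BlockEquiv.refl (adjB ι' A₁)).rowOp 1 (x := Sum.inr ()) (y := Sum.inl (Sum.inr ()))
        (by simp) (P.refl (b (ι r₀)))
    have g₃ : BlockEquiv P (addIdx (addIdx (fun r => b (ι r)) (b (ι r₀))) (b (ι r₀)))
        (addIdx (addIdx b (b (ι r₀))) (b (ι r₀))) 1 1 (adjB ι' A₂) (adjB ι' A₃) :=
      e₃ ▸ (BlockEquiv.refl (adjB ι' A₂)).colOp 1 (x := w) (y := p)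
        hpw.symm (P.refl (b (ι r₀)))
    have g₄ : BlockEquiv P (addIdx (addIdx (fun r => b (ι r)) (b (ι r₀))) (b (ι r₀)))
        (addIdx (addIdx b (b (ι r₀))) (b (ι r₀))) 1 1 (adjB ι' A₃) (adjB ι' A₄) :=
      e₄ ▸ (BlockEquiv.refl (adjB ι' A₃)).colOp 1 (x := p) (y := q)
        hqp.symm (P.refl (b (ι r₀)))
    exact (((g₁.trans_one g₂).trans_one g₃).trans_one g₄).symm.trans_one (adjB_splice h.inj r₀)
  have hblock : (fun r => addIdx (addIdx b (b (ι r₀))) (b (ι r₀)) (ι' r)) =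
      addIdx (addIdx (fun r => b (ι r)) (b (ι r₀))) (b (ι r₀)) := by
    ext ((r | r) | r) <;> rfl
  refine ⟨A₄, hmove, ⟨hpre, ?_⟩, hB⟩
  rw [hblock]
  exact ((h.smith.sum_one r₀ (u := 1) (by norm_num)).sum_one (Sum.inl r₀) (u := -1)
    (by norm_num)).blockEquiv ((h.blockTri.sum_one _ _).sum_one _ _) hB.symm

end enlarge

/-! ### Correcting the determinants of a pair -/

section pair

variable {N : ℕ} {P : BlockOrder N}

/-- Both signs are obtained with exactly two new vertices, by a splice for `1` and two outsplits for
`-1`. The two graphs of a pair therefore keep common index sets even when treated differently. -/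
theorem Canon.exists_enlarge_twice {V R : Type} [Fintype V] [DecidableEq V] [Fintype R] [DecidableEq R]
    {b : V → Fin N} {ι : R → V} {A : V → V → ℕ∞} (h : Canon P b ι A) (r₀ : R) (d : ℤ)
    (hd : d = 1 ∨ d = -1) :
    ∃ A' : (V ⊕ Unit) ⊕ Unit → (V ⊕ Unit) ⊕ Unit → ℕ∞,
    MovePrimeEquiv (ofAdj V A) (ofAdj ((V ⊕ Unit) ⊕ Unit) A') ∧
    Canon P (addIdx (addIdx b (b (ι r₀))) (b (ι r₀)))
      (Sum.map (Sum.map ι id) id : (R ⊕ Unit) ⊕ Unit → (V ⊕ Unit) ⊕ Unit) A' ∧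
    BlockEquiv P (addIdx (addIdx (fun r => b (ι r)) (b (ι r₀))) (b (ι r₀)))
      (addIdx (addIdx b (b (ι r₀))) (b (ι r₀))) 1 1
      (adjB (Sum.map (Sum.map ι id) id) A') (sumOne (sumOne (adjB ι A) d) (-1)) := by
  rcases hd with rfl | rfl
  · exact h.exists_splice r₀
  · obtain ⟨A₁, hm₁, hc₁, he₁⟩ := h.exists_enlarge r₀
    obtain ⟨A₂, hm₂, hc₂, he₂⟩ := hc₁.exists_enlarge (Sum.inl r₀)
    refine ⟨A₂, hm₁.trans _ _ _ hm₂, hc₂, ?_⟩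
    have hblock : (fun r => addIdx b (b (ι r₀)) (Sum.map ι id r)) =
        addIdx (fun r => b (ι r)) (b (ι r₀)) := by
      ext (r | r) <;> rfl
    rw [hblock] at he₂
    exact he₂.trans_one (he₁.sum_one_same (b (ι r₀)) (-1))

/-- The determinants of the diagonal blocks of an equivalence can be made `1`. -/
theorem exists_blockEquiv_one (S : Finset (Fin N)) : ∀ (V R : Type) [Fintype V] [DecidableEq V]
    [Fintype R] [DecidableEq R] (b : V → Fin N) (ι : R → V) (A₁ A₂ : V → V → ℕ∞) (δ δ' : Fin N → ℤ),
    Canon P b ι A₁ → Canon P b ι A₂ →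
    BlockEquiv P (fun r => b (ι r)) b δ δ' (adjB ι A₁) (adjB ι A₂) →
    (∀ i, (δ i = 1 ∨ δ i = -1) ∧ (δ' i = 1 ∨ δ' i = -1)) →
    (∀ i, (∀ r, b (ι r) ≠ i) → δ i = 1 ∧ δ' i = 1) → (∀ i ∉ S, δ i = 1 ∧ δ' i = 1) →
    ∃ (V' R' : Type) (_ : Fintype V') (_ : DecidableEq V') (_ : Fintype R') (_ : DecidableEq R')
      (b' : V' → Fin N) (ι' : R' → V') (A₁' A₂' : V' → V' → ℕ∞),
      MovePrimeEquiv (ofAdj V A₁) (ofAdj V' A₁') ∧ MovePrimeEquiv (ofAdj V A₂) (ofAdj V' A₂') ∧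
      Canon P b' ι' A₁' ∧ Canon P b' ι' A₂' ∧
      BlockEquiv P (fun r => b' (ι' r)) b' 1 1 (adjB ι' A₁') (adjB ι' A₂') := by
  induction S using Finset.induction_on with
  | empty =>
    intro V R _ _ _ _ b ι A₁ A₂ δ δ' h₁ h₂ he _ _ hS
    obtain rfl : δ = 1 := funext fun i => (hS i (by simp)).1
    obtain rfl : δ' = 1 := funext fun i => (hS i (by simp)).2
    exact ⟨V, R, _, _, _, _, b, ι, A₁, A₂, .refl _, .refl _, h₁, h₂, he⟩
  | insert i S _ ih =>
    intro V R _ _ _ _ b ι A₁ A₂ δ δ' h₁ h₂ he hδ hempty hS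
    by_cases hi : δ i = 1 ∧ δ' i = 1
    · refine ih V R b ι A₁ A₂ δ δ' h₁ h₂ he hδ hempty fun j hj => ?_
      by_cases hji : j = i
      · rw [hji]; exact hi
      · exact hS j (by simp [hji, hj])
    -- Only a block with a regular vertex can have a wrong sign, and such a vertex is what the
    -- enlargement needs.
    · obtain ⟨r₀, rfl⟩ : ∃ r₀, b (ι r₀) = i := by
        by_contra hcon
        exact hi (hempty i fun r hr => hcon ⟨r, hr⟩)
      set i := b (ι r₀) with hi'
      have hu : δ i * δ i = 1 := by rcases (hδ i).1 with h | h <;> simp [h]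
      have hv : δ' i * δ' i = 1 := by rcases (hδ i).2 with h | h <;> simp [h]
      -- The summand is `-(δ i * δ' i)` because bordering by `δ i` on the left and `δ' i` on the
      -- right sends it to `-1`, the summand given to the second graph.
      obtain ⟨A₁', hm₁, hc₁, he₁⟩ := h₁.exists_enlarge_twice r₀ (-(δ i * δ' i)) (by
        rcases (hδ i).1 with h | h <;> rcases (hδ i).2 with h' | h' <;> simp [h, h'])
      obtain ⟨A₂', hm₂, hc₂, he₂⟩ := h₂.exists_enlarge_twice r₀ (-1) (Or.inr rfl)
      have hblock : (fun r => addIdx (addIdx b i) i (Sum.map (Sum.map ι id) id r)) =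
          addIdx (addIdx (fun r => b (ι r)) i) i := by
        ext ((r | r) | r) <;> rfl
      let ε : Fin N → ℤ := fun j => if j = i then 1 else δ j
      let ε' : Fin N → ℤ := fun j => if j = i then 1 else δ' j
      have he' : BlockEquiv P (addIdx (addIdx (fun r => b (ι r)) i) i) (addIdx (addIdx b i) i) ε ε'
          (adjB (Sum.map (Sum.map ι id) id) A₁') (adjB (Sum.map (Sum.map ι id) id) A₂') := by
        have h3 := (he.sum_one i hu hv (-(δ i * δ' i))).sum_one i (u := 1) (v := 1) rfl rfl (-1)
        have hd : δ i * -(δ i * δ' i) * δ' i = -1 := by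
          calc δ i * -(δ i * δ' i) * δ' i = -((δ i * δ i) * (δ' i * δ' i)) := by ring
            _ = -1 := by rw [hu, hv]; rfl
        rw [hd] at h3
        convert (he₁.trans h3).trans he₂.symm using 1
        · ext j
          by_cases hj : j = i <;> simp [ε, hj, hu]
        · ext j
          by_cases hj : j = i <;> simp [ε', hj, hv]
      obtain ⟨V', R', i₁, i₂, i₃, i₄, b', ι', B₁, B₂, hm₁', hm₂', hrest⟩ :=
        ih _ _ _ _ A₁' A₂' ε ε' hc₁ hc₂ (by rw [hblock]; exact he') (fun j => by
          by_cases hj : j = i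
          · simp [ε, ε', hj]
          · simpa [ε, ε', hj] using hδ j) (fun j hj => by
          have hji : j ≠ i := fun h => hj (Sum.inr ()) h.symm
          simpa [ε, ε', hji] using hempty j fun r => hj (Sum.inl (Sum.inl r))) (fun j hj => by
          by_cases hji : j = i
          · simp [ε, ε', hji]
          · simpa [ε, ε', hji] using hS j (by simp [hji, hj]))
      exact ⟨V', R', i₁, i₂, i₃, i₄, b', ι', B₁, B₂, hm₁.trans _ _ _ hm₁', hm₂.trans _ _ _ hm₂', hrest⟩

end pair

/-! ### From canonical graphs to canonical matrices -/

namespace DirGraph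

variable {E : DirGraph}

theorem IsPath.append {u v w : E.V} {μ ν : List E.Edge} (h : E.IsPath u μ v) (h' : E.IsPath v ν w) :
    E.IsPath u (μ ++ ν) w := by
  induction μ generalizing u with
  | nil => obtain rfl : u = v := h; exact h'
  | cons e μ ih => exact ⟨h.1, ih h.2⟩

theorem IsPath.reaches_of_mem {u v : E.V} {μ : List E.Edge} (h : E.IsPath u μ v) {e : E.Edge}
    (he : e ∈ μ) : E.Reaches u (E.s e) ∧ E.Reaches (E.r e) v := by
  induction μ generalizing u with
  | nil => simp at he
  | cons f μ ih =>
    rcases List.mem_cons.1 he with rfl | he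
    · exact ⟨⟨[], h.1.symm⟩, ⟨μ, h.2⟩⟩
    · obtain ⟨⟨ν, hν⟩, h2⟩ := ih h.2 he
      exact ⟨⟨f :: ν, h.1, hν⟩, h2⟩

theorem reaches_edge (e : E.Edge) : E.Reaches (E.s e) (E.r e) := ⟨[e], rfl, rfl⟩

theorem Reaches.trans {u v w : E.V} (h : E.Reaches u v) (h' : E.Reaches v w) : E.Reaches u w := by
  obtain ⟨μ, hμ⟩ := h
  obtain ⟨ν, hν⟩ := h'
  exact ⟨μ ++ ν, hμ.append hν⟩

theorem Reaches.exists_pos {u v : E.V} (h : E.Reaches u v) (huv : u ≠ v) :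
    ∃ μ, μ ≠ [] ∧ E.IsPath u μ v := by
  obtain ⟨μ, hμ⟩ := h
  refine ⟨μ, ?_, hμ⟩
  rintro rfl
  exact huv hμ

theorem exists_cycle_of_reaches {u v : E.V} (h : E.Reaches u v) (h' : E.Reaches v u) (huv : u ≠ v) :
    ∃ μ, μ ≠ [] ∧ E.IsPath u μ u := by
  obtain ⟨μ, hne, hμ⟩ := h.exists_pos huv
  obtain ⟨ν, hν⟩ := h'
  exact ⟨μ ++ ν, by simp [hne], hμ.append hν⟩

theorem exists_edge_of_adj {u v : E.V} (h : E.adj u v ≠ 0) : ∃ e, E.s e = u ∧ E.r e = v :=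
  Set.encard_ne_zero.1 h

end DirGraph

/-- Positivity of `B•` forces two loops at each regular vertex and nonzero entries exactly where `≼`
allows them. The size alternative reflects whether the component contains a cycle. -/
theorem canon_of_graph {N : ℕ} {P : BlockOrder N} {V R : Type} {b : V → Fin N} {ι : R → V}
    {E : DirGraph} (φ : V ≃ E.V) (hinj : Function.Injective ι)
    (hreg : ∀ v, v ∈ Set.range ι ↔ E.IsRegular (φ v))
    (hreach : ∀ x y, E.Reaches (φ x) (φ y) ↔ P.rel (b x) (b y)) (hsurj : ∀ i, ∃ v, b v = i)
    (hloops : ∀ v : E.V, (E.IsRegular v ∧ ∃ e, E.s e = v ∧ E.r e = v) ∨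
      (¬ E.IsRegular v ∧ ∀ w, (∃ μ, μ ≠ [] ∧ E.IsPath v μ w) → E.adj v w = ⊤))
    (hpos : ∀ r v, P.rel (b (ι r)) (b v) → 0 < adjB ι (fun x y => E.adj (φ x) (φ y)) r v)
    (hsize : ∀ v, (∃ μ, μ ≠ [] ∧ E.IsPath (φ v) μ (φ v)) → 3 ≤ Nat.card {r // b (ι r) = b v})
    (hsmith : SmithBlocks (fun r => b (ι r)) b (adjB ι (fun x y => E.adj (φ x) (φ y)))) :
    Canon P b ι (fun x y => E.adj (φ x) (φ y)) := by
  have hadj : ∀ x y, E.adj (φ x) (φ y) ≠ 0 → P.rel (b x) (b y) := by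
    intro x y h
    obtain ⟨e, h1, h2⟩ := exists_edge_of_adj h
    rw [← hreach, ← h1, ← h2]
    exact reaches_edge e
  have hfin : ∀ r v, E.adj (φ (ι r)) (φ v) ≠ ⊤ := by
    intro r v
    exact Set.encard_ne_top_iff.2 (((hreg (ι r)).1 ⟨r, rfl⟩).1.subset fun e he => he.1)
  have hsing : ∀ v ∉ Set.range ι, ∀ w, (∃ μ, μ ≠ [] ∧ E.IsPath (φ v) μ w) → E.adj (φ v) w = ⊤ := by
    intro v hv
    exact ((hloops (φ v)).resolve_left fun h => hv ((hreg v).2 h.1)).2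
  have hloop : ∀ r, ∃ μ, μ ≠ [] ∧ E.IsPath (φ (ι r)) μ (φ (ι r)) := by
    intro r
    obtain ⟨-, e, h1, h2⟩ := (hloops (φ (ι r))).resolve_right fun h => h.1 ((hreg _).1 ⟨r, rfl⟩)
    exact ⟨[e], by simp, h1, h2⟩
  refine ⟨⟨hinj, hfin, ?_, ?_, ?_, ?_, ?_, ?_⟩, hsmith⟩
  · refine fun r v => ⟨hadj _ _, fun h h0 => ?_⟩
    have := hpos r v h
    simp only [adjB, h0] at this
    split_ifs at this <;> simp at this
  · intro r
    have := hpos r (ι r) (P.refl _)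
    obtain ⟨k, hk⟩ := ENat.ne_top_iff_exists.1 (hfin r (ι r))
    simp only [adjB, ← hk, if_true, ENat.toNat_natCast] at this
    simp only [← hk]
    have : 2 ≤ k := by omega
    exact_mod_cast this
  · intro v hv w hvw h
    by_cases hne : v = w
    · subst hne
      obtain ⟨r, hr⟩ := h.resolve_left fun h => h rfl
      refine hsing v hv _ (exists_cycle_of_reaches (v := φ (ι r)) ?_ ?_ ?_)
      · rw [hreach, hr]; exact P.refl _
      · rw [hreach, hr]; exact P.refl _
      · intro h
        exact hv ⟨r, (φ.injective h).symm⟩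
    · exact hsing v hv _ (((hreach v w).2 hvw).exists_pos (φ.injective.ne hne))
  · intro v _ w hvw
    by_contra h
    exact hvw (hadj _ _ h)
  · intro v hv
    by_contra h
    obtain ⟨e, h1, h2⟩ := exists_edge_of_adj h
    have h3 := hsize v ⟨[e], by simp, h1, h2⟩
    have : IsEmpty {r // b (ι r) = b v} := ⟨fun r => hv r.1 r.2⟩
    simp at h3
  · intro i
    obtain ⟨v, rfl⟩ := hsurj i
    by_cases hv : ∃ μ, μ ≠ [] ∧ E.IsPath (φ v) μ (φ v)
    · exact Or.inl (hsize v hv)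
    · right
      -- Two vertices of a strongly connected component lie on a common cycle, so a component
      -- without cycles is a point. It is not regular either, as regular vertices carry loops.
      have huniq : ∀ u, b u = b v → u = v := by
        intro u hu
        by_contra hne
        refine hv (exists_cycle_of_reaches (v := φ u) ?_ ?_ (φ.injective.ne (Ne.symm hne)))
        · rw [hreach, hu]; exact P.refl _
        · rw [hreach, hu]; exact P.refl _
      refine ⟨⟨v, rfl, huniq⟩, fun r hr => ?_⟩
      have := hloop r
      rw [huniq _ hr] at this
      exact hv this

namespace BlockForm

variable {N : ℕ} {P : BlockOrder N} {m n : Fin N → ℕ} {E : DirGraph}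

/-- The list of the regular vertices, in terms of the indices of the vertices. -/
def rows (β : BlockForm P m n E) (x : Σ i, Fin (m i)) : Σ i, Fin (n i) := ⟨x.1, β.row x.1 x.2⟩

theorem rows_injective (β : BlockForm P m n E) : Function.Injective β.rows := by
  rintro ⟨i, a⟩ ⟨j, c⟩ h
  obtain rfl : i = j := congrArg Sigma.fst h
  simpa [rows] using h

theorem mem_range_rows (β : BlockForm P m n E) (x : Σ i, Fin (n i)) :
    x ∈ Set.range β.rows ↔ E.IsRegular (β.vertex x) := by
  rw [← β.mem_range_row x.1 x.2]
  constructor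
  · rintro ⟨y, rfl⟩
    exact ⟨y.2, rfl⟩
  · rintro ⟨a, ha⟩
    exact ⟨⟨x.1, a⟩, by rw [rows]; simp [ha]⟩

/-- Every vertex on the cycle is in the strongly connected component of its base point, which is `H1
\ H0`. -/
theorem hasCycle_of_path (β : BlockForm P m n E) (v : Σ i, Fin (n i)) {μ : List E.Edge} (hne : μ ≠ [])
    (hμ : E.IsPath (β.vertex v) μ (β.vertex v)) : β.HasCycle v.1 := by
  have hblock : ∀ x, E.Reaches (β.vertex v) x → E.Reaches x (β.vertex v) → β.block x = v.1 := by
    intro x h1 h2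
    obtain ⟨y, rfl⟩ := β.vertex.surjective x
    rw [β.reaches_iff] at h1 h2
    simpa [block] using P.antisymm _ _ h2 h1
  have hmem : ∀ x, β.block x = v.1 → x ∈ β.H1 v.1 \ β.H0 v.1 := by
    intro x hx
    exact ⟨by rw [H1, Set.mem_ofPred_eq, hx]; exact P.refl _, fun h => h.2 hx⟩
  refine ⟨β.vertex v, hmem _ (by simp [block]), μ, hne, hμ, fun e he => ?_⟩
  obtain ⟨h1, h2⟩ := hμ.reaches_of_mem he
  exact ⟨hmem _ (hblock _ (h1.trans (reaches_edge e)) h2),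
    (hmem _ (hblock _ h1 ((reaches_edge e).trans h2))).1⟩

theorem adjB_eq (β : BlockForm P m n E) (σ : (Σ i, Fin (n i)) ≃ (Σ i, Fin (n i)))
    {ι : (Σ i, Fin (m i)) → Σ i, Fin (n i)} (hι : ∀ x, σ (ι x) = β.rows x) :
    adjB ι (fun x y => E.adj (β.vertex (σ x)) (β.vertex (σ y))) = β.B.submatrix id σ := by
  ext x y
  simp only [adjB, Matrix.submatrix_apply, B, DirGraph.Bdot, hι, id]
  congr 1
  have : ι x = y ↔ β.vertex ⟨x.1, β.row x.1 x.2⟩ = β.vertex (σ y) := by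
    rw [β.vertex.injective.eq_iff, ← σ.injective.eq_iff, hι]
    rfl
  by_cases hxy : ι x = y
  · exact (if_pos hxy).trans (if_pos (this.1 hxy)).symm
  · exact (if_neg hxy).trans (if_neg fun h => hxy (this.2 h)).symm

/-- The blockwise relabelling `σ` is allowed so that both graphs of a pair can be described by the
same list `ι` of regular vertices. -/
theorem IsCanonical.canon {β : BlockForm P m n E} (h : β.IsCanonical)
    (σ : (Σ i, Fin (n i)) ≃ (Σ i, Fin (n i))) (hσ : ∀ x, (σ x).1 = x.1)
    {ι : (Σ i, Fin (m i)) → Σ i, Fin (n i)} (hι : ∀ x, σ (ι x) = β.rows x) :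
    Canon P Sigma.fst ι (fun x y => E.adj (β.vertex (σ x)) (β.vertex (σ y))) := by
  have hι1 : ∀ x, (ι x).1 = x.1 := fun x => by rw [← hσ, hι]; rfl
  have hB := β.adjB_eq σ hι
  refine canon_of_graph (E := E) (σ.trans β.vertex) ?_ ?_ ?_ ?_ h.loops_inf ?_ ?_ ?_
  · intro x y hxy
    apply β.rows_injective
    rw [← hι, ← hι, hxy]
  · intro v
    rw [Equiv.trans_apply, ← β.mem_range_rows]
    constructor
    · rintro ⟨x, rfl⟩; exact ⟨x, (hι x).symm⟩
    · rintro ⟨x, hx⟩; exact ⟨x, σ.injective ((hι x).trans hx)⟩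
  · intro x y
    rw [← hσ x, ← hσ y]
    exact β.reaches_iff _ _
  · exact fun i => ⟨⟨i, ⟨0, β.pos i⟩⟩, rfl⟩
  · intro r v hrv
    refine lt_of_lt_of_eq ?_ (congrFun (congrFun hB r) v).symm
    refine h.positive r.1 (σ v).1 ?_ r.2 (σ v).2
    rw [hσ, ← hι1]
    exact hrv
  · rintro v ⟨μ, hne, hμ⟩
    refine (h.size_three _ (β.hasCycle_of_path (σ v) hne hμ)).trans (le_of_eq ?_)
    rw [hσ]
    have e : {r // (ι r).1 = v.1} ≃ Fin (m v.1) :=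
      (Equiv.subtypeEquivRight fun r => by rw [hι1]).trans (Equiv.sigmaSubtype v.1)
    rw [Nat.card_congr e, Nat.card_eq_fintype_card, Fintype.card_fin]
  · have key : ∀ i, m i ≠ 0 → TwoOnes (diagBlock (fun r => (ι r).1) Sigma.fst
        (adjB ι fun x y => E.adj (β.vertex (σ x)) (β.vertex (σ y))) i) := by
      intro i hi
      let e : {x : Σ i, Fin (m i) // x.1 = i} ≃ {x // (ι x).1 = i} :=
        Equiv.subtypeEquivRight fun x => by rw [hι1]
      let f : {x : Σ i, Fin (n i) // x.1 = i} ≃ {x : Σ i, Fin (n i) // x.1 = i} :=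
        σ.symm.subtypeEquiv fun x => by rw [← hσ (σ.symm x), Equiv.apply_symm_apply]
      refine ⟨m i, n i, (Equiv.sigmaSubtype i).symm.trans e, (Equiv.sigmaSubtype i).symm.trans f, ?_⟩
      convert h.smith i hi (β.pos _).ne' using 1
      ext a c
      refine (congrFun (congrFun hB _) _).trans ?_
      simp only [Matrix.submatrix_apply, blk, f, e]
      exact congrArg (β.B _) (σ.apply_symm_apply _)
    refine fun r => key _ fun h0 => ?_
    have := r.2.2
    have h1 : m r.1 = 0 := (congrArg m (hι1 r)).symm.trans h0
    omega

end BlockForm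

/-! ### From canonical matrices back to graphs with a block form -/

section listing

variable {N : ℕ} {P : BlockOrder N}

/-- Numberings of the vertices in each block, and of the regular ones among them. -/
structure Listing {V R : Type} (b : V → Fin N) (ι : R → V) (m n : Fin N → ℕ) where
  vertex : (Σ i, Fin (n i)) ≃ V
  row : ∀ i, Fin (m i) ↪o Fin (n i)
  rowEquiv : (Σ i, Fin (m i)) ≃ R
  block_vertex : ∀ x, b (vertex x) = x.1
  mem_range_row : ∀ i a, a ∈ Set.range (row i) ↔ vertex ⟨i, a⟩ ∈ Set.range ι
  rowEquiv_eq : ∀ x, ι (rowEquiv x) = vertex ⟨x.1, row x.1 x.2⟩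

/-- Each block is numbered arbitrarily. The regular indices are then enumerated in increasing order,
which forces their listing to be the induced one. -/
theorem exists_listing {V R : Type} [Fintype V] (b : V → Fin N) {ι : R → V}
    (hι : Function.Injective ι) : ∃ m n, Nonempty (Listing b ι m n) := by
  classical
  let n : Fin N → ℕ := fun i => Fintype.card {v // b v = i}
  let κ : (Σ i, Fin (n i)) ≃ V :=
    (Equiv.sigmaCongrRight fun i => (Fintype.equivFin {v // b v = i}).symm).trans
      (Equiv.sigmaFiberEquiv b)
  have hκ : ∀ x, b (κ x) = x.1 := fun x => ((Fintype.equivFin {v // b v = x.1}).symm x.2).2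
  let s : ∀ i, Finset (Fin (n i)) := fun i => Finset.univ.filter fun a => κ ⟨i, a⟩ ∈ Set.range ι
  let m : Fin N → ℕ := fun i => (s i).card
  let row : ∀ i, Fin (m i) ↪o Fin (n i) := fun i => (s i).orderEmbOfFin rfl
  have hrow : ∀ i a, a ∈ Set.range (row i) ↔ κ ⟨i, a⟩ ∈ Set.range ι := by
    intro i a
    rw [Finset.range_orderEmbOfFin]
    simp [s]
  have hex : ∀ x : Σ i, Fin (m i), ∃ r, ι r = κ ⟨x.1, row x.1 x.2⟩ := fun x =>
    (hrow x.1 _).1 ⟨x.2, rfl⟩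
  choose ρ hρ using hex
  have hbij : Function.Bijective ρ := by
    constructor
    · rintro ⟨i, a⟩ ⟨j, c⟩ h
      have h1 := (hρ ⟨i, a⟩).symm.trans ((congrArg ι h).trans (hρ ⟨j, c⟩))
      have h2 := κ.injective h1
      obtain rfl : i = j := congrArg Sigma.fst h2
      simpa using h2
    · intro r
      obtain ⟨⟨i, a⟩, ha⟩ := κ.surjective (ι r)
      obtain ⟨c, rfl⟩ := (hrow i a).2 ⟨r, ha.symm⟩
      exact ⟨⟨i, c⟩, hι ((hρ ⟨i, c⟩).trans ha)⟩
  exact ⟨m, n, ⟨κ, row, Equiv.ofBijective ρ hbij, hκ, hrow, hρ⟩⟩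

variable {V R : Type} {b : V → Fin N} {ι : R → V} {m n : Fin N → ℕ}

namespace Listing

theorem block_rowEquiv (L : Listing b ι m n) (x : Σ i, Fin (m i)) : b (ι (L.rowEquiv x)) = x.1 := by
  rw [L.rowEquiv_eq, L.block_vertex]

/-- The numbering of the vertices in a block. -/
def blockVertex (L : Listing b ι m n) (i : Fin N) : Fin (n i) ≃ {v // b v = i} :=
  (Equiv.sigmaSubtype i).symm.trans (L.vertex.subtypeEquiv fun x => by rw [L.block_vertex])

/-- The numbering of the regular vertices in a block. -/
def blockRow (L : Listing b ι m n) (i : Fin N) : Fin (m i) ≃ {r // b (ι r) = i} :=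
  (Equiv.sigmaSubtype i).symm.trans (L.rowEquiv.subtypeEquiv fun x => by rw [L.block_rowEquiv])

end Listing

end listing

section blockForm

variable {N : ℕ} {P : BlockOrder N} {V R : Type} {b : V → Fin N} {ι : R → V}
  {m n : Fin N → ℕ} {A : V → V → ℕ∞}

theorem PreCanon.adj_ne_zero_of_rel (h : PreCanon P b ι A) {u v : V} (huv : u ≠ v)
    (hrel : P.rel (b u) (b v)) : A u v ≠ 0 := by
  by_cases hu : u ∈ Set.range ι
  · obtain ⟨r, rfl⟩ := hu
    exact (h.ne_zero_iff r v).2 hrel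
  · rw [h.eq_top u hu v hrel (Or.inl huv)]
    simp

theorem PreCanon.rel_of_adj_ne_zero (h : PreCanon P b ι A) {u v : V} (huv : A u v ≠ 0) :
    P.rel (b u) (b v) := by
  by_cases hu : u ∈ Set.range ι
  · obtain ⟨r, rfl⟩ := hu
    exact (h.ne_zero_iff r v).1 huv
  · by_contra hrel
    exact huv (h.eq_zero u hu v hrel)

variable [Finite V]

theorem PreCanon.rel_of_isPath (h : PreCanon P b ι A) {u v : V} {μ : List (ofAdj V A).Edge}
    (hμ : (ofAdj V A).IsPath u μ v) : P.rel (b u) (b v) := by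
  induction μ generalizing u with
  | nil => obtain rfl : u = v := hμ; exact P.refl _
  | cons e μ ih =>
    obtain ⟨h1, h2⟩ := hμ
    have h3 := h.rel_of_adj_ne_zero (DirGraph.adj_ne_zero A e)
    rw [h1] at h3
    exact P.trans _ _ _ h3 (ih h2)

theorem PreCanon.reaches_iff (h : PreCanon P b ι A) (u v : V) :
    (ofAdj V A).Reaches u v ↔ P.rel (b u) (b v) := by
  refine ⟨fun ⟨μ, hμ⟩ => h.rel_of_isPath hμ, fun hrel => ?_⟩
  by_cases huv : u = v
  · exact ⟨[], huv⟩
  · obtain ⟨e, h1, h2⟩ := exists_edge_ofAdj A (h.adj_ne_zero_of_rel huv hrel)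
    exact ⟨[e], h1, h2⟩

/-- A vertex of a cycle lies in a block with regular vertices. -/
theorem PreCanon.exists_row_of_cycle (h : PreCanon P b ι A) {v : V} {μ : List (ofAdj V A).Edge}
    (hne : μ ≠ []) (hμ : (ofAdj V A).IsPath v μ v) : 3 ≤ Nat.card {r // b (ι r) = b v} := by
  refine (h.size (b v)).resolve_right ?_
  rintro ⟨⟨w, -, hw⟩, hr⟩
  obtain ⟨e, μ, rfl⟩ := List.exists_cons_of_ne_nil hne
  obtain ⟨h1, h2⟩ := hμ
  have h3 := DirGraph.adj_ne_zero A e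
  have h4 := h.rel_of_adj_ne_zero h3
  rw [h1] at h3 h4
  have h5 : b ((ofAdj V A).r e) = b v := P.antisymm _ _ (h.rel_of_isPath h2) h4
  rw [(hw _ h5).trans (hw v rfl).symm] at h3
  exact h3 (h.no_loop v hr)

/-- A vertex outside `ι` that emits an edge emits infinitely many parallel to it; a loop at a vertex
whose block has no regular vertices is excluded by `no_loop`. -/
theorem PreCanon.isRegular_iff (h : PreCanon P b ι A) (v : V) :
    (ofAdj V A).IsRegular v ↔ v ∈ Set.range ι := by
  constructor
  · rintro ⟨hfin, e, he⟩
    by_contra hv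
    have h1 := DirGraph.adj_ne_zero A e
    rw [show (ofAdj V A).s e = v from he] at h1
    have h2 := h.rel_of_adj_ne_zero h1
    have htop : A v ((ofAdj V A).r e) = ⊤ := by
      refine h.eq_top v hv _ h2 ?_
      by_contra hcon
      push Not at hcon
      rw [← hcon.1] at h1
      exact h1 (h.no_loop v hcon.2)
    refine absurd ((adj_ofAdj A _ _).trans htop) ?_
    exact Set.encard_ne_top_iff.2 (hfin.subset fun e he => he.1)
  · rintro ⟨r, rfl⟩
    exact isRegular_ofAdj A (h.ne_top r) ((h.ne_zero_iff r (ι r)).2 (P.refl _))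

/-- The block form of the graph of a canonical adjacency matrix. -/
def PreCanon.blockForm (h : PreCanon P b ι A) (L : Listing b ι m n) : BlockForm P m n (ofAdj V A) where
  vertex := L.vertex
  pos i := by
    have hv : ∃ v, b v = i := by
      rcases h.size i with hi | ⟨⟨v, hv, -⟩, -⟩
      · have : Nonempty {r // b (ι r) = i} := by
          by_contra hcon
          rw [not_nonempty_iff] at hcon
          simp at hi
        exact ⟨_, this.some.2⟩
      · exact ⟨v, hv⟩
    obtain ⟨v, hv⟩ := hv
    exact Fin.pos ((L.blockVertex i).symm ⟨v, hv⟩)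
  reaches_iff x y := by
    rw [← L.block_vertex x, ← L.block_vertex y]
    exact h.reaches_iff _ _
  row := L.row
  mem_range_row i a := by
    rw [L.mem_range_row]
    exact (h.isRegular_iff _).symm

theorem PreCanon.blockForm_B (h : PreCanon P b ι A) (L : Listing b ι m n) :
    (h.blockForm L).B = (adjB ι A).submatrix L.rowEquiv L.vertex := by
  classical
  ext x y
  have hx := L.rowEquiv_eq x
  change (((ofAdj V A).adj (L.vertex ⟨x.1, L.row x.1 x.2⟩) (L.vertex y)).toNat : ℤ) -
    (if L.vertex ⟨x.1, L.row x.1 x.2⟩ = L.vertex y then 1 else 0) =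
    ((A (ι (L.rowEquiv x)) (L.vertex y)).toNat : ℤ) - if ι (L.rowEquiv x) = L.vertex y then 1 else 0
  rw [← hx]
  exact congrArg (fun a : ℕ∞ => (a.toNat : ℤ) - _) (adj_ofAdj A _ _)

/-- Regular vertices that reach each other are joined by an edge, which gives paths through regular
vertices. A cycle rules out the one-point alternative for the size of its block. -/
theorem Canon.isCanonical (h : Canon P b ι A) (L : Listing b ι m n) :
    (h.toPreCanon.blockForm L).IsCanonical := by
  have hB := h.toPreCanon.blockForm_B L
  have hpos : ∀ r v, P.rel (b (ι r)) (b v) → 0 < adjB ι A r v := by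
    intro r v hrv
    obtain ⟨k, hk⟩ := ENat.ne_top_iff_exists.1 (h.ne_top r v)
    simp only [adjB, ← hk, ENat.toNat_natCast]
    split_ifs with hv
    · have h2 := h.two_le r
      rw [show A (ι r) (ι r) = k by rw [hk, ← hv]] at h2
      have : 2 ≤ k := by exact_mod_cast h2
      omega
    · have h0 := (h.ne_zero_iff r v).2 hrv
      rw [← hk] at h0
      have : k ≠ 0 := by exact_mod_cast h0
      omega
  refine ⟨?_, ?_, ?_, ?_, ?_⟩
  · intro v
    by_cases hv : v ∈ Set.range ι
    · left
      refine ⟨(h.isRegular_iff v).2 hv, ?_⟩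
      obtain ⟨r, rfl⟩ := hv
      exact exists_edge_ofAdj A ((h.ne_zero_iff r (ι r)).2 (P.refl _))
    · right
      refine ⟨fun hreg => hv ((h.isRegular_iff v).1 hreg), ?_⟩
      rintro w ⟨μ, hne, hμ⟩
      refine (adj_ofAdj A v w).trans (h.eq_top v hv w (h.rel_of_isPath hμ) ?_)
      by_cases hvw : v = w
      · subst hvw
        right
        have h3 := h.exists_row_of_cycle hne hμ
        by_contra hcon
        have : IsEmpty {r // b (ι r) = b v} := ⟨fun r => hcon ⟨r.1, r.2⟩⟩
        simp at h3
      · exact Or.inl hvw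
  · intro v w hv hw hvw
    have hrel := (h.reaches_iff v w).1 hvw
    obtain ⟨r, rfl⟩ := (h.isRegular_iff v).1 hv
    obtain ⟨e, h1, h2⟩ := exists_edge_ofAdj A ((h.ne_zero_iff r w).2 hrel)
    refine ⟨[e], ⟨h1, h2⟩, ?_⟩
    rintro e' he'
    obtain rfl := List.mem_singleton.1 he'
    exact ⟨(congrArg (ofAdj V A).IsRegular h1).mpr hv, (congrArg (ofAdj V A).IsRegular h2).mpr hw⟩
  · rintro i ⟨v, hv, μ, hne, hμ, -⟩
    have hb : b v = i := by
      obtain ⟨x, rfl⟩ := L.vertex.surjective v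
      rw [L.block_vertex]
      by_contra hcon
      refine hv.2 ⟨hv.1, fun h => hcon ?_⟩
      rw [← h]
      exact (congrArg Sigma.fst (L.vertex.symm_apply_apply x)).symm
    have h3 := h.exists_row_of_cycle hne hμ
    rw [hb, ← Nat.card_congr (L.blockRow i), Nat.card_eq_fintype_card, Fintype.card_fin] at h3
    exact h3
  · intro i j hij a c
    refine lt_of_lt_of_eq (hpos (L.rowEquiv ⟨i, a⟩) (L.vertex ⟨j, c⟩) ?_)
      (congrFun (congrFun hB ⟨i, a⟩) ⟨j, c⟩).symm
    rw [L.block_rowEquiv, L.block_vertex]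
    exact hij
  · intro i hi _
    have hsmith := h.smith (L.rowEquiv ⟨i, ⟨0, Nat.pos_of_ne_zero hi⟩⟩)
    beta_reduce at hsmith
    rw [show b (ι (L.rowEquiv ⟨i, ⟨0, Nat.pos_of_ne_zero hi⟩⟩)) = i from L.block_rowEquiv _] at hsmith
    convert (hsmith.submatrix (L.blockRow i) (L.blockVertex i)).smithHasTwoOnes using 1
    ext a c
    exact congrFun (congrFun hB ⟨i, a⟩) ⟨i, c⟩

end blockForm

/-! ### Reindexing, and the theorem -/

section final

variable {N : ℕ} {P : BlockOrder N}

theorem mem_MP_iff {m n : Fin N → ℕ} (M : BlockMatrix m n) :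
    M ∈ MP P m n ↔ BlockTri P Sigma.fst Sigma.fst M := by
  constructor
  · rintro h ⟨i, a⟩ ⟨j, c⟩ hne
    exact h i j fun h0 => hne (congrFun (congrFun h0 a) c)
  · intro h i j hne
    by_contra hcon
    refine hne (Matrix.ext fun a c => ?_)
    by_contra h0
    exact hcon (h ⟨i, a⟩ ⟨j, c⟩ h0)

theorem BlockTri.submatrix_equiv {X Y : Type} {b : X → Fin N} {b' : Y → Fin N} {M : Matrix X Y ℤ}
    (h : BlockTri P b b' M) {m n : Fin N → ℕ} (e : (Σ i, Fin (m i)) ≃ X) (f : (Σ i, Fin (n i)) ≃ Y)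
    (he : ∀ x, b (e x) = x.1) (hf : ∀ y, b' (f y) = y.1) :
    (M.submatrix e f : BlockMatrix m n) ∈ MP P m n := by
  rw [mem_MP_iff]
  intro x y hxy
  have := h _ _ hxy
  rwa [he, hf] at this

theorem BlockGL.submatrix_mem_SLP {X : Type} [Fintype X] [DecidableEq X] {b : X → Fin N}
    {U : Matrix X X ℤ} (h : BlockGL P b 1 U) {n : Fin N → ℕ} (e : (Σ i, Fin (n i)) ≃ X)
    (he : ∀ x, b (e x) = x.1) : (U.submatrix e e : BlockMatrix n n) ∈ SLP P n := by
  obtain ⟨W, hW, h1, h2⟩ := h.inv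
  refine ⟨⟨h.tri.submatrix_equiv e e he he, W.submatrix e e, hW.submatrix_equiv e e he he, ?_, ?_⟩,
    fun i _ => ?_⟩
  · rw [Matrix.submatrix_mul_equiv, h1, Matrix.submatrix_one_equiv]
  · rw [Matrix.submatrix_mul_equiv, h2, Matrix.submatrix_one_equiv]
  · let g : Fin (n i) ≃ {x // b x = i} :=
      (Equiv.sigmaSubtype i).symm.trans (e.subtypeEquiv fun x => by rw [he])
    rw [show blk (U.submatrix e e : BlockMatrix n n) i i = (diagBlock b b U i).submatrix g g from rfl,
      Matrix.det_submatrix_equiv_self, h.det]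
    rfl

theorem BlockEquiv.slpEquivalent {X Y : Type} [Fintype X] [DecidableEq X] [Fintype Y] [DecidableEq Y]
    {bX : X → Fin N} {bY : Y → Fin N} {B B' : Matrix X Y ℤ} (h : BlockEquiv P bX bY 1 1 B B')
    (hB : BlockTri P bX bY B) {m n : Fin N → ℕ} (e : (Σ i, Fin (m i)) ≃ X) (f : (Σ i, Fin (n i)) ≃ Y)
    (he : ∀ x, bX (e x) = x.1) (hf : ∀ y, bY (f y) = y.1) :
    SLPEquivalent P (B.submatrix e f : BlockMatrix m n) (B'.submatrix e f) := by
  obtain ⟨U, V, hU, hV, rfl⟩ := h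
  refine ⟨hB.submatrix_equiv e f he hf, ((hU.tri.mul hB).mul hV.tri).submatrix_equiv e f he hf,
    _, hU.submatrix_mem_SLP e he, _, hV.submatrix_mem_SLP f hf, ?_⟩
  rw [Matrix.submatrix_mul_equiv, Matrix.submatrix_mul_equiv]

/-- Two increasing lists of the same length are related by a blockwise permutation. -/
theorem exists_perm_rows {m n : Fin N → ℕ} (r₁ r₂ : ∀ i, Fin (m i) ↪o Fin (n i)) :
    ∃ σ : (Σ i, Fin (n i)) ≃ (Σ i, Fin (n i)), (∀ x, (σ x).1 = x.1) ∧
      ∀ i a, σ ⟨i, r₁ i a⟩ = ⟨i, r₂ i a⟩ := by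
  have hex : ∀ i, ∃ τ : Equiv.Perm (Fin (n i)), ∀ a, τ (r₁ i a) = r₂ i a := by
    classical
    intro i
    let e : {x // x ∈ Set.range (r₁ i)} ≃ {x // x ∈ Set.range (r₂ i)} :=
      (Equiv.ofInjective _ (r₁ i).injective).symm.trans (Equiv.ofInjective _ (r₂ i).injective)
    -- A bijection between two subsets of a finite set extends to a permutation.
    refine ⟨e.extendSubtype, fun a => ?_⟩
    rw [Equiv.extendSubtype_apply_of_mem e _ ⟨a, rfl⟩]
    have : (⟨r₁ i a, ⟨a, rfl⟩⟩ : {x // x ∈ Set.range (r₁ i)}) = Equiv.ofInjective _ (r₁ i).injective a := rfl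
    rw [this]
    simp [e]
  choose τ hτ using hex
  exact ⟨Equiv.sigmaCongrRight τ, fun x => rfl, fun i a => Sigma.ext rfl (heq_of_eq (hτ i a))⟩

end final

theorem theorem8p5 {N : ℕ} (P : BlockOrder N) (m n : Fin N → ℕ) (E₁ E₂ : DirGraph)
    (β₁ : BlockForm P m n E₁) (β₂ : BlockForm P m n E₂)
    (hstd : BlockForm.IsStandardForm β₁ β₂)
    (U : BlockMatrix m m) (V : BlockMatrix n n) (hUV : IsGLPEquiv P U V β₁.B β₂.B)
    (hV : ∀ i, n i = 1 → blk V i i = 1) :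
    ∃ (F₁ F₂ : DirGraph) (m' n' : Fin N → ℕ)
      (γ₁ : BlockForm P m' n' F₁) (γ₂ : BlockForm P m' n' F₂),
      DirGraph.MovePrimeEquiv E₁ F₁ ∧ DirGraph.MovePrimeEquiv E₂ F₂ ∧
      BlockForm.IsStandardForm γ₁ γ₂ ∧ SLPEquivalent P γ₁.B γ₂.B := by
  obtain ⟨hcan₁, hcan₂⟩ := hstd
  obtain ⟨⟨hU, WU, hWU, hU1, hU2⟩, ⟨hVm, WV, hWV, hV1, hV2⟩, hmul⟩ := hUV
  -- The regular vertices may occupy different positions in the two listings. The vertices of the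
  -- second graph are permuted by `σ`, so that both matrices share one list of regular vertices.
  obtain ⟨σ, hσ, hσrow⟩ := exists_perm_rows β₁.row β₂.row
  have hι : ∀ x, σ (β₁.rows x) = β₂.rows x := fun x => hσrow x.1 x.2
  have hc₁ := hcan₁.canon (Equiv.refl _) (fun _ => rfl) (ι := β₁.rows) (fun _ => rfl)
  have hc₂ := hcan₂.canon σ hσ hι
  have hB₁ := β₁.adjB_eq (Equiv.refl _) (ι := β₁.rows) (fun _ => rfl)
  have hB₂ := β₂.adjB_eq σ hι
  rw [mem_MP_iff] at hU hWU hVm hWV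
  have hσsymm : ∀ x, (σ.symm x).1 = x.1 := fun x => by rw [← hσ, Equiv.apply_symm_apply]
  obtain ⟨δ, hδ, hUδ⟩ := exists_blockGL hU hWU hU1 hU2
  -- The permutation is absorbed into `V`, possibly changing signs of its diagonal blocks; these are
  -- corrected along with the rest.
  obtain ⟨δ', hδ', hVδ⟩ := exists_blockGL (P := P) (b := Sigma.fst) (U := V.submatrix id σ)
    (W := WV.submatrix σ id)
    (fun x y hxy => by rw [← hσ y]; exact hVm _ _ hxy)
    (fun x y hxy => by rw [← hσ x]; exact hWV _ _ hxy)
    (by rw [Matrix.submatrix_mul_equiv, hV1, Matrix.submatrix_id_id])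
    (by rw [← Matrix.submatrix_mul _ _ _ _ _ Function.bijective_id, hV2, Matrix.submatrix_one_equiv])
  have hequiv : BlockEquiv P (fun r => (β₁.rows r).1) Sigma.fst δ δ'
      (adjB β₁.rows fun x y => E₁.adj (β₁.vertex x) (β₁.vertex y))
      (adjB β₁.rows fun x y => E₂.adj (β₂.vertex (σ x)) (β₂.vertex (σ y))) := by
    refine ⟨U, V.submatrix id σ, hUδ, hVδ, ?_⟩
    rw [hB₂, ← hmul, Matrix.submatrix_mul _ _ _ _ _ Function.bijective_id, Matrix.submatrix_id_id]
    exact congrArg (fun M => U * M * V.submatrix id σ) hB₁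
  have hempty : ∀ i, (∀ r, (β₁.rows r).1 ≠ i) → δ i = 1 ∧ δ' i = 1 := by
    intro i hi
    constructor
    · rw [← hUδ.det]
      have : IsEmpty {x : Σ i, Fin (m i) // x.1 = i} := ⟨fun x => hi x.1 x.2⟩
      exact Matrix.det_isEmpty
    -- A block without regular vertices is a single vertex, so the hypothesis on `V` applies, and
    -- `σ` acts trivially on this block.
    · have hni : n i = 1 := by
        rcases hc₁.size i with h | ⟨⟨v, hv, huniq⟩, -⟩
        · have : IsEmpty {r // (β₁.rows r).1 = i} := ⟨fun x => hi x.1 x.2⟩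
          simp at h
        · have h1 : ∀ a c : Fin (n i), a = c := fun a c => by
            have := (huniq ⟨i, a⟩ rfl).trans (huniq ⟨i, c⟩ rfl).symm
            simpa using this
          have : Subsingleton (Fin (n i)) := ⟨h1⟩
          have h2 := Fin.subsingleton_iff_le_one.1 this
          have h3 := β₁.pos i
          omega
      have hone := hV i hni
      rw [← hVδ.det]
      have hsub : Subsingleton (Fin (n i)) := Fin.subsingleton_iff_le_one.2 hni.le
      have hx : ∀ x : Σ i, Fin (n i), x.1 = i → x = ⟨i, ⟨0, β₁.pos i⟩⟩ := by
        rintro ⟨j, a⟩ rfl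
        exact congrArg (Sigma.mk j) (hsub.elim _ _)
      have : Unique {x : Σ i, Fin (n i) // x.1 = i} :=
        ⟨⟨⟨⟨i, ⟨0, β₁.pos i⟩⟩, rfl⟩⟩, fun x => Subtype.ext (hx x.1 x.2)⟩
      rw [Matrix.det_unique]
      change V _ (σ _) = 1
      rw [hx _ (default : {x : Σ i, Fin (n i) // x.1 = i}).2,
        hx (σ _) ((hσ _).trans rfl)]
      exact (congrFun (congrFun hone _) _).trans (Matrix.one_apply_eq _)
  obtain ⟨V', R', _, _, _, _, b', ι', A₁, A₂, hm₁, hm₂, hd₁, hd₂, he⟩ :=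
    exists_blockEquiv_one (P := P) Finset.univ _ _ Sigma.fst β₁.rows _ _ δ δ' hc₁ hc₂ hequiv
      (fun i => ⟨hδ i, hδ' i⟩) hempty (fun i hi => absurd (Finset.mem_univ i) hi)
  obtain ⟨m', n', ⟨L⟩⟩ := exists_listing b' hd₁.inj
  refine ⟨ofAdj V' A₁, ofAdj V' A₂, m', n', hd₁.toPreCanon.blockForm L, hd₂.toPreCanon.blockForm L,
    (equiv_ofAdj _ β₁.vertex.symm fun u v => ?_).trans _ _ _ hm₁,
    (equiv_ofAdj _ (σ.trans β₂.vertex).symm fun u v => ?_).trans _ _ _ hm₂,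
    ⟨hd₁.isCanonical L, hd₂.isCanonical L⟩, ?_⟩
  · simp
  · simp
  · rw [PreCanon.blockForm_B, PreCanon.blockForm_B]
    exact he.slpEquivalent hd₁.blockTri _ _ L.block_rowEquiv L.block_vertex
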